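/- **Setting.** Let $(a_i)_{i\ge 1},(b_i)_{i\ge1}$ be strictly positive. The Becker–Döring equations for $c(t)=(c_i(t))_{i\ge 1}$ are $$\frac{d}{dt}c_i=W_{i-1}-W_i\quad(i\ge 2),\qquad \frac{d}{dt}c_1=-W_1-\sum_{k\ge1}W_k,\qquad W_i=a_ic_1c_i-b_{i+1}c_{i+1}.$$ A solution is understood in the sense of Ball, Carr and Penrose: the $c_i$ are nonnegative and continuous on $[0,\infty)$, $\sum_i i\,c_i(t)$ is finite and locally bounded in $t$, $\int_0^T\sum_i a_ic_i\,dt$ and $\int_0^T\sum_i b_{i+1}c_{i+1}\,dt$ are finite for every $T$, and the time-integrated equations hold. Its mass is $\varrho=\sum_i i\,c_i(0)$. Let $Q_1=1$, $Q_{i+1}=\frac{a_i}{b_{i+1}}Q_i$; let $z_s\in[0,\infty]$ be the largest value such that $\sum_i iQ_iz^i<\infty$ for all $0\le z<z_s$, and let $\varrho_s=\sum_i iQ_iz_s^i\in[0,\infty]$. For $0<\varrho<\varrho_s$ let $\overline z\ge0$ be the number with $\sum_i iQ_i\overline z^i=\varrho$, put $\mathcal Q_i=Q_i\overline z^i$ and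 $$H(c|\mathcal Q)=\sum_{i\ge1}c_i\Big(\log\frac{c_i}{\mathcal Q_i}-1\Big)+\sum_{i\ge1}\mathcal Q_i$$ (terms with $c_i=0$ in the first sum are $0$), and $M_\beta(c)=\sum_i i^\beta c_i$. Assume that $0<z_s<\infty$; that $Q_i=z_s^{1-i}\alpha_i$ for all $i$, where $(\alpha_i)$ is positive and non-increasing with $\alpha_{i+1}/\alpha_i\to1$; and that $C_1i^\gamma\le a_i\le C_2i^\gamma$ for all $i$, for some $0\le\gamma\le1$ and $C_1,C_2>0$. **Theorem.** Let $c$ be a solution of the Becker–Döring equations with mass $\varrho\in(0,\varrho_s)$. (i) If $\gamma=1$, there are a constant $K>0$ depending only on $z_s,\varrho,(\alpha_i),C_1,C_2$ and a constant $C>0$ depending only on these and on $H(c(0)|\mathcal Q)$ such that, for all $t\ge0$, the series defining $H(c(t)|\mathcal Q)$ converges and $$H(c(t)|\mathcal Q)\le C e^{-Kt}.$$ (ii) If $\gamma<1$ and $M_\beta(c(0))<\infty$ for some $\beta>1$, there are a constant $K>0$ depending only on $z_s,\varrho,(\alpha_i),\gamma,C_1,C_2,\beta,M_\beta(c(0))$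 and a constant $C>0$ depending only on these and on $H(c(0)|\mathcal Q)$ such that, for all $t\ge0$, the series defining $H(c(t)|\mathcal Q)$ converges and $$H(c(t)|\mathcal Q)\le\Big(C+\frac{1-\gamma}{\beta-1}Kt\Big)^{-\frac{\beta-1}{1-\gamma}}.$$ -/

import Mathlib

open Filter Topology Set MeasureTheory
open scoped ENNReal NNReal

noncomputable section

namespace BeckerDoring

/-- The detailed balance coefficients: `Q₁ = 1`, `Q_{i+1} = (a_i / b_{i+1}) Q_i`. -/
def detailedBalance (a b : ℕ+ → ℝ) (i : ℕ+) : ℝ :=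
  PNat.recOn i 1 (fun i q => a i / b (i + 1) * q)

theorem detailedBalance_one (a b : ℕ+ → ℝ) : detailedBalance a b 1 = 1 := by
  simp [detailedBalance]

theorem detailedBalance_succ (a b : ℕ+ → ℝ) (i : ℕ+) :
    detailedBalance a b (i + 1) = a i / b (i + 1) * detailedBalance a b i := by
  simp [detailedBalance, PNat.recOn_succ]

/-- The critical monomer density `z_s ∈ [0, ∞]`: the largest `z` such that
`∑ i Q_i w^i < ∞` for all `0 ≤ w < z`. -/
def criticalMonomerDensity (Q : ℕ+ → ℝ) : ℝ≥0∞ :=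
  sSup {z : ℝ≥0∞ | ∀ w : ℝ≥0, (w : ℝ≥0∞) < z →
    Summable fun i : ℕ+ => (i : ℝ) * Q i * (w : ℝ) ^ (i : ℕ)}

/-- The critical mass `ϱ_s = ∑ i Q_i z_s^i ∈ [0, ∞]` (for nonnegative `Q`). -/
def criticalMass (Q : ℕ+ → ℝ) : ℝ≥0∞ :=
  ∑' i : ℕ+, ((i : ℕ) : ℝ≥0∞) * ENNReal.ofReal (Q i) * criticalMonomerDensity Q ^ (i : ℕ)

/-- `z` is the equilibrium monomer density for the mass `ϱ`: `z ≥ 0` and `∑ i Q_i z^i = ϱ`. -/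
def IsEquilibriumMonomerDensity (Q : ℕ+ → ℝ) (ϱ z : ℝ) : Prop :=
  0 ≤ z ∧ HasSum (fun i : ℕ+ => (i : ℝ) * Q i * z ^ (i : ℕ)) ϱ

/-- Standing assumptions on the coagulation coefficients `a` and the fragmentation coefficients
`b`: positivity, `0 < z_s < ∞`, `Q_i = z_s^{1-i} α_i` with `α` positive, non-increasing and
`α_{i+1} / α_i → 1`, and `C₁ i^γ ≤ a_i ≤ C₂ i^γ`. (The value `b 1` is irrelevant.) -/
structure Admissible (a b : ℕ+ → ℝ) (zs : ℝ) (α : ℕ+ → ℝ) (γ C₁ C₂ : ℝ) : Prop where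
  a_pos : ∀ i, 0 < a i
  b_pos : ∀ i, 0 < b i
  zs_pos : 0 < zs
  zs_eq : criticalMonomerDensity (detailedBalance a b) = ENNReal.ofReal zs
  Q_eq : ∀ i : ℕ+, detailedBalance a b i = zs ^ (1 - ((i : ℕ) : ℤ)) * α i
  α_pos : ∀ i, 0 < α i
  α_anti : Antitone α
  α_ratio : Tendsto (fun i : ℕ+ => α (i + 1) / α i) atTop (𝓝 1)
  C₁_pos : 0 < C₁
  C₂_pos : 0 < C₂
  le_a : ∀ i : ℕ+, C₁ * (i : ℝ) ^ γ ≤ a i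
  a_le : ∀ i : ℕ+, a i ≤ C₂ * (i : ℝ) ^ γ

/-- The net rate `W_i = a_i c_1 c_i - b_{i+1} c_{i+1}` of the reaction `{i} + {1} ⇌ {i+1}`. -/
def netRate (a b c : ℕ+ → ℝ) (i : ℕ+) : ℝ :=
  a i * c 1 * c i - b (i + 1) * c (i + 1)

/-- Global solutions of the Becker–Döring equations in the sense of Ball, Carr and Penrose:
nonnegative continuous functions `c_i` on `[0, ∞)` with locally bounded mass for which
`∫₀ᵀ ∑ a_i c_i` and `∫₀ᵀ ∑ b_{i+1} c_{i+1}` are finite and the time-integrated equations hold. -/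
structure IsSolution (a b : ℕ+ → ℝ) (c : ℝ → ℕ+ → ℝ) : Prop where
  nonneg : ∀ t, 0 ≤ t → ∀ i, 0 ≤ c t i
  continuousOn : ∀ i, ContinuousOn (fun t => c t i) (Ici 0)
  mass_bounded : ∀ T : ℝ, ∃ B : ℝ, ∀ t ∈ Icc 0 T,
    (Summable fun i : ℕ+ => (i : ℝ) * c t i) ∧ ∑' i : ℕ+, (i : ℝ) * c t i ≤ B
  coagulation_integrable : ∀ T : ℝ,
    ∫⁻ s in Icc 0 T, ∑' i : ℕ+, ENNReal.ofReal (a i * c s i) < ∞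
  fragmentation_integrable : ∀ T : ℝ,
    ∫⁻ s in Icc 0 T, ∑' i : ℕ+, ENNReal.ofReal (b (i + 1) * c s (i + 1)) < ∞
  eq_succ : ∀ t, 0 ≤ t → ∀ i : ℕ+, c t (i + 1) = c 0 (i + 1) +
    ∫ s in (0 : ℝ)..t, (netRate a b (c s) i - netRate a b (c s) (i + 1))
  eq_one : ∀ t, 0 ≤ t → c t 1 = c 0 1 +
    ∫ s in (0 : ℝ)..t, (-netRate a b (c s) 1 - ∑' k : ℕ+, netRate a b (c s) k)

/-- The sequence `c` has mass `∑ i c_i = ϱ`. -/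
def HasMass (c : ℕ+ → ℝ) (ϱ : ℝ) : Prop :=
  HasSum (fun i : ℕ+ => (i : ℝ) * c i) ϱ

/-- The sequence `c` has finite moment `M_β(c) = ∑ i^β c_i = M`. -/
def HasMoment (β : ℝ) (c : ℕ+ → ℝ) (M : ℝ) : Prop :=
  HasSum (fun i : ℕ+ => (i : ℝ) ^ β * c i) M

/-- The terms `c_i (log (c_i / (z^i Q_i)) - 1)` of the relative free energy (`0` if `c_i = 0`). -/
def freeEnergyTerm (Q : ℕ+ → ℝ) (z : ℝ) (c : ℕ+ → ℝ) (i : ℕ+) : ℝ :=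
  c i * (Real.log (c i / (z ^ (i : ℕ) * Q i)) - 1)

/-- The relative free energy
`H(c|𝒬) = ∑ c_i (log (c_i / (z^i Q_i)) - 1) + ∑ z^i Q_i`, where `𝒬_i = z^i Q_i`. -/
def relFreeEnergy (Q : ℕ+ → ℝ) (z : ℝ) (c : ℕ+ → ℝ) : ℝ :=
  ∑' i : ℕ+, freeEnergyTerm Q z c i + ∑' i : ℕ+, z ^ (i : ℕ) * Q i

/-- A subcritical solution `c` of mass `ϱ ∈ (0, ϱ_s)`, with equilibrium monomer density `z`. -/
structure IsSubcriticalSolution (a b : ℕ+ → ℝ) (ϱ z : ℝ) (c : ℝ → ℕ+ → ℝ) : Prop where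
  mass_pos : 0 < ϱ
  mass_lt : ENNReal.ofReal ϱ < criticalMass (detailedBalance a b)
  equilibrium : IsEquilibriumMonomerDensity (detailedBalance a b) ϱ z
  solution : IsSolution a b c
  mass : HasMass (c 0) ϱ

end BeckerDoring

end

/-! The relative free energy H is a Lyapunov functional. By detailed balance its dissipation is a
sum of terms a_i (u - v)(log u - log v) with u = c_1 c_i and v = (Q_i / Q_{i+1}) c_{i+1}. Each term
dominates a_i (√u - √v)², and only the sum D of these smaller, always finite quantities is used. The
core is the inequality K H^p ≤ D (`exists_coercivity`), with p = 1 for γ = 1 and p = 1 + (1 - γ)/(β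
- 1) for γ < 1. Combined with H(t) + ∫ D ≤ H(s), it yields the stated decay.

The inequality is proved in three regimes of the monomer density. If c_1 stays away from 0 and from
z_s, then c is compared with the quasi-equilibrium q_i = Q_i c_1^i. Here D is a weighted sum of
squared increments of √(c_i/q_i), and as q decays geometrically, a discrete Hardy inequality bounds
∑ i^γ (√c_i - √q_i)² by a multiple of D. Conversely, H is at most the entropy relative to q, hence
at most a multiple of ∑ i (√c_i - √q_i)²; the weight i comes from the linear bound log(c_i/q_i) ≤ L
i. For γ = 1 the weights agree; for γ < 1 the gap is closed by interpolation with the β-th moment.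
If c_1 exceeds the equilibrium density by a fixed margin, or is very small, then D is bounded below
by a positive constant while H is bounded in terms of the mass.

Two facts about solutions are needed. The energy inequality (`freeEnergy_add_integral_le`) follows
by truncating the sum at size N: the boundary terms vanish along a subsequence. The moment bound
uniform in time (`exists_moment_bound`) comes from a comparison principle: the tails ∑_{k≥n} c_k lie
below supersolutions that are stationary while c_1 ≤ w < z_s. The excess of c_1 over w has bounded
time integral, because D is bounded below whenever c_1 ≥ w. -/

namespace BeckerDoring

/-! ### Entropy density and a weighted Hardy inequality -/

/-- The relative entropy density `x (log (x / q) - 1) + q`. -/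
noncomputable def entropyDensity (q x : ℝ) : ℝ := x * (Real.log (x / q) - 1) + q

theorem mul_log_div_ge {q x : ℝ} (hq : 0 < q) (hx : 0 ≤ x) : x - q ≤ x * Real.log (x / q) := by
  rcases hx.eq_or_lt with rfl | hx
  · simp [hq.le]
  · have h := Real.one_sub_inv_le_log_of_pos (div_pos hx hq)
    rw [inv_div] at h
    have := mul_le_mul_of_nonneg_left h hx.le
    have e : x * (1 - q / x) = x - q := by field_simp
    linarith

theorem entropyDensity_nonneg {q x : ℝ} (hq : 0 < q) (hx : 0 ≤ x) : 0 ≤ entropyDensity q x := by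
  have := mul_log_div_ge hq hx
  unfold entropyDensity
  linarith

/-- With r = √(x/q) and log r ≤ r - 1, the density is at most q (2r + 1)(r - 1)², which suffices for
r ≤ 4. For r ≥ 4 the logarithm is replaced by Λ and r² ≤ 2 (r - 1)² is used. -/
theorem entropyDensity_le_sq {q x Λ : ℝ} (hq : 0 < q) (hx : 0 ≤ x) (hΛ : 0 ≤ Λ)
    (h : Real.log (x / q) ≤ Λ) : entropyDensity q x ≤ (9 + 2 * Λ) * (√x - √q) ^ 2 := by
  rcases hx.eq_or_lt with rfl | hx
  · simp [entropyDensity, Real.sq_sqrt hq.le]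
    nlinarith
  set r := √x / √q with hr
  have hsq : 0 < √q := Real.sqrt_pos.2 hq
  have hr0 : 0 < r := div_pos (Real.sqrt_pos.2 hx) hsq
  have hxq : x / q = r ^ 2 := by
    rw [hr, div_pow, Real.sq_sqrt hx.le, Real.sq_sqrt hq.le]
  have hx' : x = q * r ^ 2 := by rw [← hxq]; field_simp
  have hs : (√x - √q) ^ 2 = q * (r - 1) ^ 2 := by
    have : √x = √q * r := by rw [hr]; field_simp
    rw [this]
    calc (√q * r - √q) ^ 2 = √q ^ 2 * (r - 1) ^ 2 := by ring
      _ = _ := by rw [Real.sq_sqrt hq.le]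
  have hlog : Real.log (x / q) = 2 * Real.log r := by
    rw [hxq, Real.log_pow]; norm_num
  have hE : entropyDensity q x = q * (r ^ 2 * (2 * Real.log r) - r ^ 2 + 1) := by
    unfold entropyDensity
    rw [hlog, hx']; ring
  rw [hE, hs]
  have key : r ^ 2 * (2 * Real.log r) - r ^ 2 + 1 ≤ (9 + 2 * Λ) * (r - 1) ^ 2 := by
    rcases le_total r 4 with h4 | h4
    · have := Real.log_le_sub_one_of_pos hr0
      have h1 : r ^ 2 * (2 * Real.log r) ≤ r ^ 2 * (2 * (r - 1)) := by gcongr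
      have h2 : (2 * r + 1) * (r - 1) ^ 2 ≤ (9 + 2 * Λ) * (r - 1) ^ 2 :=
        mul_le_mul_of_nonneg_right (by linarith) (sq_nonneg _)
      nlinarith
    · rw [hlog] at h
      have h1 : r ^ 2 * (2 * Real.log r) ≤ r ^ 2 * Λ := by gcongr
      have h2 : r ^ 2 * Λ ≤ 2 * Λ * (r - 1) ^ 2 := by
        have : r ^ 2 ≤ 2 * (r - 1) ^ 2 := by nlinarith
        nlinarith
      nlinarith
  calc q * (r ^ 2 * (2 * Real.log r) - r ^ 2 + 1) ≤ q * ((9 + 2 * Λ) * (r - 1) ^ 2) := by gcongr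
    _ = _ := by ring

/-- Weighted discrete Hardy inequality for weights decaying geometrically. -/
theorem sum_mul_sq_le_of_geometric {μ s : ℕ → ℝ} {θ : ℝ} (hθ₀ : 0 ≤ θ) (hθ₁ : θ < 1)
    (hμ : ∀ n, 0 ≤ μ n) (hdec : ∀ n, μ (n + 1) ≤ θ * μ n) (hs : s 0 = 0) (N : ℕ) :
    ∑ n ∈ Finset.range N, μ n * s n ^ 2 ≤
      4 / (1 - θ) ^ 2 * ∑ n ∈ Finset.range N, μ n * (s (n + 1) - s n) ^ 2 := by
  have he : 0 < 1 - θ := by linarith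
  have step : ∀ n, μ (n + 1) * s (n + 1) ^ 2 ≤
      (1 + θ) / 2 * (μ n * s n ^ 2) + 2 / (1 - θ) * (μ n * (s (n + 1) - s n) ^ 2) := by
    intro n
    set d := s (n + 1) - s n with hd
    have h1 : s (n + 1) = s n + d := by rw [hd]; ring
    -- Young's inequality, tuned so that the coefficient (1 + θ)/2 of the old term is still below 1.
    -- After summation it is absorbed, leaving (1 - θ)/2 on the left.
    have h2 : θ * (s n + d) ^ 2 ≤ (1 + θ) / 2 * s n ^ 2 + 2 / (1 - θ) * d ^ 2 := by
      have h3 : 2 / (1 - θ) * d ^ 2 = 2 * d ^ 2 / (1 - θ) := by ring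
      rw [h3, ← sub_le_iff_le_add', le_div_iff₀ he]
      nlinarith [sq_nonneg ((1 - θ) * s n - 2 * θ * d),
        mul_nonneg (mul_nonneg he.le (by linarith : 0 ≤ 2 + θ)) (sq_nonneg d)]
    calc μ (n + 1) * s (n + 1) ^ 2 ≤ (θ * μ n) * s (n + 1) ^ 2 := by
          gcongr; exact hdec n
      _ = μ n * (θ * (s n + d) ^ 2) := by rw [h1]; ring
      _ ≤ μ n * ((1 + θ) / 2 * s n ^ 2 + 2 / (1 - θ) * d ^ 2) := by
          gcongr; exact hμ n
      _ = _ := by ring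
  have h1 : ∑ n ∈ Finset.range N, μ n * s n ^ 2 ≤
      ∑ n ∈ Finset.range N, μ (n + 1) * s (n + 1) ^ 2 := by
    have h2 := Finset.sum_range_succ' (fun n => μ n * s n ^ 2) N
    rw [Finset.sum_range_succ] at h2
    simp only [hs] at h2
    have h3 : 0 ≤ μ N * s N ^ 2 := mul_nonneg (hμ N) (sq_nonneg _)
    linarith
  have h2 := h1.trans (Finset.sum_le_sum fun n _ => step n)
  rw [Finset.sum_add_distrib, ← Finset.mul_sum, ← Finset.mul_sum] at h2
  set S := ∑ n ∈ Finset.range N, μ n * s n ^ 2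
  set T := ∑ n ∈ Finset.range N, μ n * (s (n + 1) - s n) ^ 2
  have h3 : (1 - θ) / 2 * S ≤ 2 / (1 - θ) * T := by linarith
  calc S = 2 / (1 - θ) * ((1 - θ) / 2 * S) := by field_simp
    _ ≤ 2 / (1 - θ) * (2 / (1 - θ) * T) := by gcongr
    _ = _ := by field_simp; ring

/-! ### Equilibria, states of given mass and the relative free energy -/

/-- Detailed balance coefficients `Q` (indexed from `0`), with critical density at least `zs` and
equilibrium density `z < zs` for the mass `ϱ`. -/
structure EquilibriumData (Q : ℕ → ℝ) (zs R ϱ z : ℝ) : Prop where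
  Q_zero : Q 0 = 1
  Q_pos : ∀ n, 0 < Q n
  zs_pos : 0 < zs
  le_Q : ∀ n, zs * Q (n + 1) ≤ Q n
  Q_le : ∀ n, Q n ≤ R * Q (n + 1)
  z_pos : 0 < z
  z_lt : z < zs
  hasSum : HasSum (fun n : ℕ => ((n : ℝ) + 1) * (z ^ (n + 1) * Q n)) ϱ

/-- Rates `A` (indexed from `0`) comparable with `i ^ γ`. -/
structure RateBounds (A : ℕ → ℝ) (γ C₁ C₂ : ℝ) : Prop where
  le_rate : ∀ n : ℕ, C₁ * ((n : ℝ) + 1) ^ γ ≤ A n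
  rate_le : ∀ n : ℕ, A n ≤ C₂ * ((n : ℝ) + 1) ^ γ

/-- Nonnegative sequences of mass `ϱ`, indexed from `0`. -/
structure MassState (ϱ : ℝ) (x : ℕ → ℝ) : Prop where
  nonneg : ∀ n, 0 ≤ x n
  hasSum : HasSum (fun n : ℕ => ((n : ℝ) + 1) * x n) ϱ

/-- The terms of the lower free energy dissipation. -/
noncomputable def dissipation (Q A x : ℕ → ℝ) (n : ℕ) : ℝ :=
  A n * (√(x 0 * x n) - √(Q n / Q (n + 1) * x (n + 1))) ^ 2

theorem RateBounds.nonneg {A : ℕ → ℝ} {γ C₁ C₂ : ℝ} (h : RateBounds A γ C₁ C₂) (hC : 0 < C₁)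
    (n : ℕ) : 0 ≤ A n := le_trans (by positivity) (h.le_rate n)

theorem RateBounds.pos {A : ℕ → ℝ} {γ C₁ C₂ : ℝ} (h : RateBounds A γ C₁ C₂) (hC : 0 < C₁)
    (n : ℕ) : 0 < A n := lt_of_lt_of_le (by positivity) (h.le_rate n)

theorem RateBounds.C₂_pos {A : ℕ → ℝ} {γ C₁ C₂ : ℝ} (h : RateBounds A γ C₁ C₂) (hC : 0 < C₁) :
    0 < C₂ := by
  have := (h.le_rate 0).trans (h.rate_le 0)
  simp at this; linarith

theorem RateBounds.rate_le_linear {A : ℕ → ℝ} {γ C₁ C₂ : ℝ} (h : RateBounds A γ C₁ C₂)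
    (hC : 0 < C₁) (hγ : γ ≤ 1) (n : ℕ) : A n ≤ C₂ * ((n : ℝ) + 1) := by
  refine (h.rate_le n).trans ?_
  have := h.C₂_pos hC
  gcongr
  calc ((n : ℝ) + 1) ^ γ ≤ ((n : ℝ) + 1) ^ (1 : ℝ) :=
        Real.rpow_le_rpow_of_exponent_le (by linarith [n.cast_nonneg (α := ℝ)]) hγ
    _ = _ := Real.rpow_one _

theorem dissipation_nonneg {Q A x : ℕ → ℝ} (hA : ∀ n, 0 ≤ A n) (n : ℕ) :
    0 ≤ dissipation Q A x n := mul_nonneg (hA n) (sq_nonneg _)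

namespace MassState

variable {ϱ : ℝ} {x : ℕ → ℝ}

theorem summable (h : MassState ϱ x) : Summable fun n : ℕ => ((n : ℝ) + 1) * x n :=
  h.hasSum.summable

theorem summable_coe (h : MassState ϱ x) : Summable x := by
  refine Summable.of_nonneg_of_le h.nonneg (fun n => ?_) h.summable
  have := h.nonneg n
  nlinarith [n.cast_nonneg (α := ℝ)]

theorem mul_le (h : MassState ϱ x) (n : ℕ) : ((n : ℝ) + 1) * x n ≤ ϱ :=
  le_hasSum h.hasSum n fun m _ => mul_nonneg (by positivity) (h.nonneg m)

theorem le (h : MassState ϱ x) (n : ℕ) : x n ≤ ϱ := by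
  have := h.mul_le n
  have := h.nonneg n
  nlinarith [n.cast_nonneg (α := ℝ)]

theorem mass_nonneg (h : MassState ϱ x) : 0 ≤ ϱ := (h.nonneg 0).trans (h.le 0)

theorem sum_le (h : MassState ϱ x) (s : Finset ℕ) : ∑ n ∈ s, ((n : ℝ) + 1) * x n ≤ ϱ :=
  sum_le_hasSum s (fun n _ => mul_nonneg (by positivity) (h.nonneg n)) h.hasSum

theorem summable_succ (h : MassState ϱ x) : Summable fun n : ℕ => ((n : ℝ) + 1) * x (n + 1) := by
  refine Summable.of_nonneg_of_le (fun n => mul_nonneg (by positivity) (h.nonneg _)) (fun n => ?_)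
    ((summable_nat_add_iff 1).2 h.summable)
  have := h.nonneg (n + 1)
  push_cast
  nlinarith

end MassState

namespace EquilibriumData

variable {Q : ℕ → ℝ} {zs R ϱ z : ℝ}

theorem state (h : EquilibriumData Q zs R ϱ z) : MassState ϱ fun n => z ^ (n + 1) * Q n :=
  ⟨fun n => (mul_pos (pow_pos h.z_pos _) (h.Q_pos n)).le, h.hasSum⟩

theorem mass_pos (h : EquilibriumData Q zs R ϱ z) : 0 < ϱ := by
  have := h.state.mul_le 0
  have h2 := mul_pos (pow_pos h.z_pos 1) (h.Q_pos 0)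
  norm_num at *
  linarith

theorem ratio_ge (h : EquilibriumData Q zs R ϱ z) (n : ℕ) : zs ≤ Q n / Q (n + 1) := by
  rw [le_div_iff₀ (h.Q_pos _)]; exact h.le_Q n

theorem ratio_le (h : EquilibriumData Q zs R ϱ z) (n : ℕ) : Q n / Q (n + 1) ≤ R := by
  rw [div_le_iff₀ (h.Q_pos _)]; exact h.Q_le n

theorem ratio_pos (h : EquilibriumData Q zs R ϱ z) (n : ℕ) : 0 < Q n / Q (n + 1) :=
  h.zs_pos.trans_le (h.ratio_ge n)

theorem R_pos (h : EquilibriumData Q zs R ϱ z) : 0 < R :=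
  (h.ratio_pos 0).trans_le (h.ratio_le 0)

theorem Q_le_pow (h : EquilibriumData Q zs R ϱ z) (n : ℕ) : Q n ≤ (zs⁻¹) ^ n := by
  induction n with
  | zero => simp [h.Q_zero]
  | succ n ih =>
    have h1 := h.le_Q n
    have := h.zs_pos
    rw [pow_succ, ← div_eq_mul_inv, le_div_iff₀ this]
    linarith

theorem le_Q_pow (h : EquilibriumData Q zs R ϱ z) (n : ℕ) : (R⁻¹) ^ n ≤ Q n := by
  induction n with
  | zero => simp [h.Q_zero]
  | succ n ih =>
    have h1 := h.Q_le n
    have := h.R_pos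
    rw [pow_succ, ← div_eq_mul_inv, div_le_iff₀ this]
    linarith

theorem summable_rpow (h : EquilibriumData Q zs R ϱ z) {w : ℝ} (hw₀ : 0 ≤ w) (hw : w < zs)
    (β : ℝ) : Summable fun n : ℕ => ((n : ℝ) + 1) ^ β * (w ^ (n + 1) * Q n) := by
  have hzs := h.zs_pos
  obtain ⟨k, hk⟩ := exists_nat_ge β
  have hr : ‖w / zs‖ < 1 := by
    rw [Real.norm_of_nonneg (by positivity), div_lt_one hzs]; exact hw
  have h0 : Summable fun n : ℕ => ((n : ℝ) ^ k * (w / zs) ^ n : ℝ) :=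
    summable_pow_mul_geometric_of_norm_lt_one k hr
  have h1 : Summable fun n : ℕ => zs * (((n + 1 : ℕ) : ℝ) ^ k * (w / zs) ^ (n + 1)) :=
    ((summable_nat_add_iff 1).2 h0).mul_left zs
  refine Summable.of_nonneg_of_le (fun n => ?_) (fun n => ?_) h1
  · have := (h.Q_pos n).le; positivity
  · have e : zs * (((n + 1 : ℕ) : ℝ) ^ k * (w / zs) ^ (n + 1)) =
        ((n : ℝ) + 1) ^ k * (w ^ (n + 1) * (zs⁻¹) ^ n) := by
      have e1 : (w / zs) ^ (n + 1) = w ^ (n + 1) * (zs⁻¹) ^ n * zs⁻¹ := by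
        rw [div_eq_mul_inv, mul_pow, pow_succ zs⁻¹]; ring
      rw [e1, Nat.cast_succ]
      field_simp
    rw [e]
    have h2 := (h.Q_pos n).le
    have h3 := h.Q_le_pow n
    have h4 : ((n : ℝ) + 1) ^ β ≤ ((n : ℝ) + 1) ^ k := by
      rw [← Real.rpow_natCast]
      exact Real.rpow_le_rpow_of_exponent_le (by linarith [n.cast_nonneg (α := ℝ)]) hk
    exact mul_le_mul h4 (mul_le_mul_of_nonneg_left h3 (by positivity)) (by positivity)
      (by positivity)

theorem summable_pow (h : EquilibriumData Q zs R ϱ z) {w : ℝ} (hw₀ : 0 ≤ w) (hw : w < zs) :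
    Summable fun n : ℕ => ((n : ℝ) + 1) * (w ^ (n + 1) * Q n) := by
  simpa using h.summable_rpow hw₀ hw 1

/-- The constant in the linear bound of `log (x / (y ^ (n + 1) * Q n))`. -/
noncomputable def logBound (R ϱ y : ℝ) : ℝ := |Real.log ϱ| + |Real.log R| + |Real.log y|

theorem logBound_nonneg (R ϱ y : ℝ) : 0 ≤ logBound R ϱ y := by unfold logBound; positivity

/-- Since x ≤ ϱ and Q_n ≥ R^{-n}, the logarithm grows at most linearly in n. This is the source of
the weight n + 1 in the entropy estimates. -/
theorem log_div_le (h : EquilibriumData Q zs R ϱ z) {x y δ : ℝ} (hx : 0 ≤ x) (hxϱ : x ≤ ϱ)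
    (hδ : 0 < δ) (hy : δ ≤ y) (n : ℕ) :
    Real.log (x / (y ^ (n + 1) * Q n)) ≤ logBound R ϱ δ * ((n : ℝ) + 1) := by
  rcases hx.eq_or_lt with rfl | hx
  · simp only [zero_div, Real.log_zero]
    have := logBound_nonneg R ϱ δ
    positivity
  have hR := h.R_pos
  have hQ := h.Q_pos n
  have hϱ := hx.trans_le hxϱ
  have h1 : x / (y ^ (n + 1) * Q n) ≤ ϱ / (δ ^ (n + 1) * (R⁻¹) ^ n) := by
    have := h.le_Q_pow n
    have hy₀ : 0 < y := hδ.trans_le hy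
    gcongr
  have h2 : 0 < x / (y ^ (n + 1) * Q n) := by
    have := hδ.trans_le hy
    positivity
  refine (Real.log_le_log h2 h1).trans ?_
  rw [Real.log_div hϱ.ne' (by positivity), Real.log_mul (by positivity) (by positivity),
    Real.log_pow, Real.log_pow, Real.log_inv]
  unfold logBound
  have a1 := le_abs_self (Real.log ϱ)
  have a2 := le_abs_self (Real.log R)
  have a3 := neg_abs_le (Real.log δ)
  have b1 := abs_nonneg (Real.log ϱ)
  have b2 := abs_nonneg (Real.log R)
  have hn := n.cast_nonneg (α := ℝ)
  push_cast
  nlinarith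

/-- Terms of the relative free energy. -/
noncomputable def freeEnergyDensity (Q : ℕ → ℝ) (z : ℝ) (x : ℕ → ℝ) (n : ℕ) : ℝ :=
  entropyDensity (z ^ (n + 1) * Q n) (x n)

theorem abs_mul_log_le (h : EquilibriumData Q zs R ϱ z) {x : ℕ → ℝ} (hx : MassState ϱ x) {y : ℝ}
    (hy : 0 < y) (n : ℕ) :
    |x n * Real.log (x n / (y ^ (n + 1) * Q n))| ≤
      logBound R ϱ y * (((n : ℝ) + 1) * x n) + y ^ (n + 1) * Q n := by
  have hq : 0 < y ^ (n + 1) * Q n := mul_pos (pow_pos hy _) (h.Q_pos n)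
  have h1 := mul_log_div_ge hq (hx.nonneg n)
  have h2 := mul_le_mul_of_nonneg_left (h.log_div_le (hx.nonneg n) (hx.le n) hy le_rfl n)
    (hx.nonneg n)
  have h3 := hx.nonneg n
  have h4 : 0 ≤ logBound R ϱ y * (((n : ℝ) + 1) * x n) :=
    mul_nonneg (logBound_nonneg _ _ _) (by positivity)
  rw [abs_le]
  constructor <;> nlinarith

theorem summable_mul_log (h : EquilibriumData Q zs R ϱ z) {x : ℕ → ℝ} (hx : MassState ϱ x) {y : ℝ}
    (hy : 0 < y) (hy' : y < zs) :
    Summable fun n => x n * Real.log (x n / (y ^ (n + 1) * Q n)) := by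
  refine Summable.of_abs (Summable.of_nonneg_of_le (fun n => abs_nonneg _)
    (fun n => h.abs_mul_log_le hx hy n) ?_)
  refine (hx.summable.mul_left _).add ?_
  simpa using h.summable_rpow hy.le hy' 0

theorem summable_freeEnergyDensity (h : EquilibriumData Q zs R ϱ z) {x : ℕ → ℝ}
    (hx : MassState ϱ x) {y : ℝ} (hy : 0 < y) (hy' : y < zs) :
    Summable (freeEnergyDensity Q y x) := by
  have h1 := ((h.summable_mul_log hx hy hy').sub hx.summable_coe).add
    (by simpa using h.summable_rpow hy.le hy' 0 : Summable fun n : ℕ => y ^ (n + 1) * Q n)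
  refine h1.congr fun n => ?_
  unfold freeEnergyDensity entropyDensity; ring

theorem freeEnergyDensity_nonneg (h : EquilibriumData Q zs R ϱ z) {x : ℕ → ℝ}
    (hx : MassState ϱ x) {y : ℝ} (hy : 0 < y) (n : ℕ) : 0 ≤ freeEnergyDensity Q y x n :=
  entropyDensity_nonneg (mul_pos (pow_pos hy _) (h.Q_pos n)) (hx.nonneg n)

/-- The relative free energy. -/
noncomputable def freeEnergy (Q : ℕ → ℝ) (z : ℝ) (x : ℕ → ℝ) : ℝ := ∑' n, freeEnergyDensity Q z x n

theorem freeEnergy_nonneg (h : EquilibriumData Q zs R ϱ z) {x : ℕ → ℝ} (hx : MassState ϱ x) :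
    0 ≤ freeEnergy Q z x := tsum_nonneg fun n => h.freeEnergyDensity_nonneg hx h.z_pos n

/-- A bound of the relative free energy in terms of the mass. -/
noncomputable def freeEnergyBound (R ϱ z : ℝ) : ℝ := logBound R ϱ z * ϱ + 2 * ϱ + 1

theorem freeEnergyBound_pos (h : EquilibriumData Q zs R ϱ z) : 0 < freeEnergyBound R ϱ z := by
  have := h.mass_pos
  have := logBound_nonneg R ϱ z
  unfold freeEnergyBound; positivity

/-- A bound by the mass alone. It makes the regimes with dissipation bounded below harmless and
provides the starting value for the decay estimates. -/
theorem freeEnergy_le (h : EquilibriumData Q zs R ϱ z) {x : ℕ → ℝ} (hx : MassState ϱ x) :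
    freeEnergy Q z x ≤ freeEnergyBound R ϱ z := by
  have hs : HasSum (fun n : ℕ => logBound R ϱ z * (((n : ℝ) + 1) * x n) +
      2 * (((n : ℝ) + 1) * (z ^ (n + 1) * Q n))) (logBound R ϱ z * ϱ + 2 * ϱ) :=
    (hx.hasSum.mul_left _).add (h.hasSum.mul_left _)
  have := hasSum_le (fun n => ?_)
    (h.summable_freeEnergyDensity hx h.z_pos h.z_lt).hasSum hs
  · unfold freeEnergy freeEnergyBound; linarith
  · have h1 := (le_abs_self _).trans (h.abs_mul_log_le hx h.z_pos n)
    have h2 := hx.nonneg n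
    have h3 : 0 ≤ (n : ℝ) * (z ^ (n + 1) * Q n) :=
      mul_nonneg n.cast_nonneg (h.state.nonneg n)
    unfold freeEnergyDensity entropyDensity
    linarith

/-- Among all equilibria, the one with the same mass minimises the relative free energy. -/
theorem freeEnergy_le_of_density (h : EquilibriumData Q zs R ϱ z) {x : ℕ → ℝ} (hx : MassState ϱ x)
    {y : ℝ} (hy : 0 < y) (hy' : y < zs) :
    freeEnergy Q z x ≤ ∑' n, freeEnergyDensity Q y x n := by
  -- The added terms sum to zero because the state and the equilibrium at z have equal mass; what
  -- remains is a termwise inequality.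
  have h1 : HasSum (fun n : ℕ => freeEnergyDensity Q z x n + Real.log (z / y) *
      (((n : ℝ) + 1) * x n - ((n : ℝ) + 1) * (z ^ (n + 1) * Q n)))
      (freeEnergy Q z x + Real.log (z / y) * (ϱ - ϱ)) :=
    (h.summable_freeEnergyDensity hx h.z_pos h.z_lt).hasSum.add
      ((hx.hasSum.sub h.hasSum).mul_left _)
  have h2 := hasSum_le (fun n => ?_) h1 (h.summable_freeEnergyDensity hx hy hy').hasSum
  · linarith
  have hz := h.z_pos
  have hQ := h.Q_pos n
  have e1 : Real.log (z / y) = Real.log z - Real.log y := Real.log_div hz.ne' hy.ne'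
  -- This is exp(-u) ≥ 1 - u with u = (n + 1) log(z/y).
  have hexp : z ^ (n + 1) * (1 - ((n : ℝ) + 1) * Real.log (z / y)) ≤ y ^ (n + 1) := by
    have h3 := Real.add_one_le_exp (-(((n : ℝ) + 1) * Real.log (z / y)))
    have h4 : Real.exp (-(((n : ℝ) + 1) * Real.log (z / y))) = y ^ (n + 1) / z ^ (n + 1) := by
      rw [neg_mul_eq_mul_neg, ← Real.log_inv, inv_div, ← div_pow,
        show (n : ℝ) + 1 = ((n + 1 : ℕ) : ℝ) by push_cast; ring, ← Real.log_pow,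
        Real.exp_log (by positivity)]
    rw [h4, le_div_iff₀ (by positivity)] at h3
    linarith
  have hlog : x n * Real.log (x n / (y ^ (n + 1) * Q n)) =
      x n * Real.log (x n / (z ^ (n + 1) * Q n)) + ((n : ℝ) + 1) * Real.log (z / y) * x n := by
    rcases (hx.nonneg n).eq_or_lt with h0 | h0
    · simp [← h0]
    · rw [Real.log_div h0.ne' (by positivity), Real.log_div h0.ne' (by positivity),
        Real.log_mul (by positivity) (by positivity), Real.log_mul (by positivity) (by positivity),
        Real.log_pow, Real.log_pow, e1]
      push_cast; ring
  have h5 := mul_le_mul_of_nonneg_right hexp hQ.le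
  unfold freeEnergyDensity entropyDensity
  nlinarith

end EquilibriumData

/-! ### Interpolation between moments -/

/-- A quantitative comparison of the first and the `γ`-th moment of all sequences below `v`. -/
def Interpolates (γ p C : ℝ) (v : ℕ → ℝ) : Prop :=
  ∀ u : ℕ → ℝ, (∀ n, 0 ≤ u n) → (∀ n, u n ≤ v n) →
    (∑' n : ℕ, ((n : ℝ) + 1) * u n) ^ p ≤ C * ∑' n : ℕ, ((n : ℝ) + 1) ^ γ * u n

theorem interpolates_one (v : ℕ → ℝ) : Interpolates 1 1 1 v := by
  intro u _ _
  simp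

theorem summable_rpow_mul_of_le {u : ℕ → ℝ} {γ β : ℝ} (hγ : γ ≤ β) (hu : ∀ n, 0 ≤ u n)
    (h : Summable fun n : ℕ => ((n : ℝ) + 1) ^ β * u n) :
    Summable fun n : ℕ => ((n : ℝ) + 1) ^ γ * u n := by
  refine Summable.of_nonneg_of_le (fun n => mul_nonneg (by positivity) (hu n)) (fun n => ?_) h
  have := Real.rpow_le_rpow_of_exponent_le
    (by linarith [n.cast_nonneg (α := ℝ)] : (1 : ℝ) ≤ (n : ℝ) + 1) hγ
  exact mul_le_mul_of_nonneg_right this (hu n)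

/-- Sizes below a cutoff L satisfy n + 1 ≤ L^{1-γ} (n + 1)^γ, sizes above it n + 1 ≤ L^{1-β} (n +
1)^β. The second contribution is controlled by M, and L is chosen to make it at most half of the
first moment. -/
theorem interpolates_of_moment {γ β M : ℝ} (hγ : γ < 1) (hβ : 1 < β) (hM : 0 < M) {v : ℕ → ℝ}
    (hv : Summable fun n : ℕ => ((n : ℝ) + 1) ^ β * v n)
    (hvM : ∑' n : ℕ, ((n : ℝ) + 1) ^ β * v n ≤ M) :
    Interpolates γ (1 + (1 - γ) / (β - 1)) (2 * (2 * M) ^ ((1 - γ) / (β - 1))) v := by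
  intro u hu huv
  set κ := (1 - γ) / (β - 1) with hκ
  have hβ' : 0 < β - 1 := by linarith
  have hκ0 : 0 < κ := div_pos (by linarith) hβ'
  have sβ : Summable fun n : ℕ => ((n : ℝ) + 1) ^ β * u n :=
    Summable.of_nonneg_of_le (fun n => mul_nonneg (by positivity) (hu n))
      (fun n => mul_le_mul_of_nonneg_left (huv n) (by positivity)) hv
  have hSβ : ∑' n : ℕ, ((n : ℝ) + 1) ^ β * u n ≤ M :=
    (sβ.tsum_le_tsum (fun n => mul_le_mul_of_nonneg_left (huv n) (by positivity)) hv).trans hvM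
  have sγ := summable_rpow_mul_of_le (by linarith : γ ≤ β) hu sβ
  have s1 : Summable fun n : ℕ => ((n : ℝ) + 1) * u n := by
    simpa using summable_rpow_mul_of_le hβ.le hu sβ
  set S := ∑' n : ℕ, ((n : ℝ) + 1) * u n
  set G := ∑' n : ℕ, ((n : ℝ) + 1) ^ γ * u n
  have hG : 0 ≤ G := tsum_nonneg fun n => mul_nonneg (by positivity) (hu n)
  have hS : 0 ≤ S := tsum_nonneg fun n => mul_nonneg (by positivity) (hu n)
  rcases hS.eq_or_lt with hS0 | hS0
  · rw [← hS0, Real.zero_rpow (by linarith)]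
    positivity
  -- Solves L^{1-β} M = S/2.
  set L := (2 * M / S) ^ (1 / (β - 1)) with hL
  have hL0 : 0 < L := by positivity
  have hLβ : L ^ (1 - β) = S / (2 * M) := by
    rw [hL, ← Real.rpow_mul (by positivity),
      show 1 / (β - 1) * (1 - β) = -1 by field_simp; ring, Real.rpow_neg_one, inv_div]
  have hLγ : L ^ (1 - γ) = (2 * M / S) ^ κ := by
    rw [hL, ← Real.rpow_mul (by positivity), hκ]; congr 1; ring
  have key : ∀ n : ℕ, ((n : ℝ) + 1) * u n ≤
      L ^ (1 - γ) * (((n : ℝ) + 1) ^ γ * u n) + L ^ (1 - β) * (((n : ℝ) + 1) ^ β * u n) := by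
    intro n
    have hn : (0 : ℝ) < (n : ℝ) + 1 := by positivity
    have : (n : ℝ) + 1 ≤ L ^ (1 - γ) * ((n : ℝ) + 1) ^ γ + L ^ (1 - β) * ((n : ℝ) + 1) ^ β := by
      rcases le_total ((n : ℝ) + 1) L with h | h
      · have h1 : ((n : ℝ) + 1) ^ (1 - γ) ≤ L ^ (1 - γ) :=
          Real.rpow_le_rpow hn.le h (by linarith)
        have h2 : (n : ℝ) + 1 = ((n : ℝ) + 1) ^ (1 - γ) * ((n : ℝ) + 1) ^ γ := by
          rw [← Real.rpow_add hn]; simp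
        have h3 : 0 ≤ L ^ (1 - β) * ((n : ℝ) + 1) ^ β := by positivity
        have h4 := mul_le_mul_of_nonneg_right h1 (by positivity : 0 ≤ ((n : ℝ) + 1) ^ γ)
        linarith
      · have h1 : ((n : ℝ) + 1) ^ (1 - β) ≤ L ^ (1 - β) :=
          Real.rpow_le_rpow_of_nonpos hL0 h (by linarith)
        have h2 : (n : ℝ) + 1 = ((n : ℝ) + 1) ^ (1 - β) * ((n : ℝ) + 1) ^ β := by
          rw [← Real.rpow_add hn]; simp
        have h3 : 0 ≤ L ^ (1 - γ) * ((n : ℝ) + 1) ^ γ := by positivity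
        have h4 := mul_le_mul_of_nonneg_right h1 (by positivity : 0 ≤ ((n : ℝ) + 1) ^ β)
        linarith
    calc ((n : ℝ) + 1) * u n ≤ (L ^ (1 - γ) * ((n : ℝ) + 1) ^ γ + L ^ (1 - β) * ((n : ℝ) + 1) ^ β) *
          u n := mul_le_mul_of_nonneg_right this (hu n)
      _ = _ := by ring
  have h1 : S ≤ L ^ (1 - γ) * G + L ^ (1 - β) * ∑' n : ℕ, ((n : ℝ) + 1) ^ β * u n :=
    hasSum_le key s1.hasSum ((sγ.hasSum.mul_left _).add (sβ.hasSum.mul_left _))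
  have h2 : L ^ (1 - β) * ∑' n : ℕ, ((n : ℝ) + 1) ^ β * u n ≤ S / 2 := by
    rw [hLβ]
    calc S / (2 * M) * _ ≤ S / (2 * M) * M := by gcongr
      _ = S / 2 := by field_simp
  have h3 : S ≤ 2 * ((2 * M / S) ^ κ * G) := by rw [← hLγ]; linarith
  rw [Real.rpow_add hS0, Real.rpow_one]
  calc S * S ^ κ ≤ 2 * ((2 * M / S) ^ κ * G) * S ^ κ := by gcongr
    _ = 2 * (2 * M) ^ κ * G := by
      rw [Real.div_rpow (by positivity) hS]
      have : S ^ κ ≠ 0 := by positivity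
      field_simp

/-! ### The entropy - entropy dissipation inequality -/

namespace EquilibriumData

variable {Q A x : ℕ → ℝ} {zs R ϱ z γ C₁ C₂ : ℝ}

theorem dissipation_le (h : EquilibriumData Q zs R ϱ z) (hA : RateBounds A γ C₁ C₂) (hC₁ : 0 < C₁)
    (hγ : γ ≤ 1) (hx : MassState ϱ x) (n : ℕ) :
    dissipation Q A x n ≤
      C₂ * (ϱ + R) * (((n : ℝ) + 1) * x n + ((n : ℝ) + 1) * x (n + 1)) := by
  have h0 := hx.nonneg 0
  have hn := hx.nonneg n
  have hn1 := hx.nonneg (n + 1)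
  have hr := (h.ratio_pos n).le
  have hϱ := hx.mass_nonneg
  have hR := h.R_pos
  have e1 : (√(x 0 * x n) - √(Q n / Q (n + 1) * x (n + 1))) ^ 2 ≤
      x 0 * x n + Q n / Q (n + 1) * x (n + 1) := by
    have a1 := Real.sq_sqrt (mul_nonneg h0 hn)
    have a2 := Real.sq_sqrt (mul_nonneg hr hn1)
    have a3 := mul_nonneg (Real.sqrt_nonneg (x 0 * x n))
      (Real.sqrt_nonneg (Q n / Q (n + 1) * x (n + 1)))
    nlinarith
  have e2 : x 0 * x n + Q n / Q (n + 1) * x (n + 1) ≤ (ϱ + R) * (x n + x (n + 1)) := by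
    have b1 := mul_le_mul_of_nonneg_right (hx.le 0) hn
    have b2 := mul_le_mul_of_nonneg_right (h.ratio_le n) hn1
    have b3 := mul_nonneg hR.le hn
    have b4 := mul_nonneg hϱ hn1
    linarith
  have e3 := hA.rate_le_linear hC₁ hγ n
  have e4 : 0 ≤ (ϱ + R) * (x n + x (n + 1)) := by positivity
  calc dissipation Q A x n ≤ A n * ((ϱ + R) * (x n + x (n + 1))) :=
        mul_le_mul_of_nonneg_left (e1.trans e2) (hA.nonneg hC₁ n)
    _ ≤ C₂ * ((n : ℝ) + 1) * ((ϱ + R) * (x n + x (n + 1))) := mul_le_mul_of_nonneg_right e3 e4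
    _ = _ := by ring

theorem summable_dissipation (h : EquilibriumData Q zs R ϱ z) (hA : RateBounds A γ C₁ C₂)
    (hC₁ : 0 < C₁) (hγ : γ ≤ 1) (hx : MassState ϱ x) : Summable (dissipation Q A x) :=
  Summable.of_nonneg_of_le (dissipation_nonneg (hA.nonneg hC₁))
    (h.dissipation_le hA hC₁ hγ hx) ((hx.summable.add hx.summable_succ).mul_left _)

/-- The quasi-equilibrium q_n = x_0^{n+1} Q_n satisfies x_0 q_n = (Q_n / Q_{n+1}) q_{n+1}, so this
factor comes out of both square roots. The dissipation becomes a weighted squared increment of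
√(x_n/q_n), the form needed for Hardy's inequality. -/
theorem dissipation_eq (h : EquilibriumData Q zs R ϱ z) (h0 : 0 < x 0)
    (n : ℕ) : dissipation Q A x n = A n * (x 0 * (x 0 ^ (n + 1) * Q n)) *
      (√(x (n + 1)) / √(x 0 ^ (n + 2) * Q (n + 1)) - √(x n) / √(x 0 ^ (n + 1) * Q n)) ^ 2 := by
  have hq : ∀ k, 0 < x 0 ^ (k + 1) * Q k := fun k => mul_pos (pow_pos h0 _) (h.Q_pos k)
  set q : ℕ → ℝ := fun k => x 0 ^ (k + 1) * Q k with hqdef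
  change dissipation Q A x n = A n * (x 0 * q n) * (√(x (n + 1)) / √(q (n + 1)) - √(x n) / √(q n)) ^ 2
  have hq' : ∀ k, 0 < q k := hq
  have e1 : √(x 0 * x n) = √(x 0 * q n) * (√(x n) / √(q n)) := by
    have := Real.sqrt_pos.2 (hq' n)
    rw [Real.sqrt_mul h0.le, Real.sqrt_mul h0.le]
    field_simp
  have e2 : √(Q n / Q (n + 1) * x (n + 1)) = √(x 0 * q n) * (√(x (n + 1)) / √(q (n + 1))) := by
    have := Real.sqrt_pos.2 (hq' (n + 1))
    have h3 : x 0 * q n = Q n / Q (n + 1) * q (n + 1) := by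
      have := h.Q_pos (n + 1)
      simp only [hqdef]
      field_simp
      ring
    rw [h3, Real.sqrt_mul (h.ratio_pos n).le, Real.sqrt_mul (h.ratio_pos n).le]
    field_simp
  unfold dissipation
  rw [e1, e2]
  calc _ = A n * (√(x 0 * q n) ^ 2 * (√(x (n + 1)) / √(q (n + 1)) - √(x n) / √(q n)) ^ 2) := by ring
    _ = _ := by rw [Real.sq_sqrt (mul_pos h0 (hq' n)).le]; ring

end EquilibriumData

theorem exists_pos_le_of_lt {f : ℕ → ℝ} (hf : ∀ n, 0 < f n) (N : ℕ) :
    ∃ m, 0 < m ∧ ∀ n < N, m ≤ f n := by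
  induction N with
  | zero => exact ⟨1, one_pos, by simp⟩
  | succ N ih =>
    obtain ⟨m, hm, h⟩ := ih
    refine ⟨min m (f N), lt_min hm (hf N), fun n hn => ?_⟩
    rcases Nat.lt_succ_iff_lt_or_eq.1 hn with h1 | rfl
    · exact (min_le_left _ _).trans (h n h1)
    · exact min_le_right _ _

namespace EquilibriumData

variable {Q : ℕ → ℝ} {zs R ϱ z γ C₁ C₂ : ℝ}

/-- The dissipation is bounded below if the monomer density exceeds the equilibrium value. -/
theorem exists_le_dissipation_of_le (h : EquilibriumData Q zs R ϱ z) (hC₁ : 0 < C₁) (hγ₀ : 0 ≤ γ)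
    (hγ : γ ≤ 1) {w : ℝ} (hzw : z < w) (hw : w < zs) :
    ∃ ε, 0 < ε ∧ ∀ A x : ℕ → ℝ, RateBounds A γ C₁ C₂ → MassState ϱ x → w ≤ x 0 →
      ε ≤ ∑' n, dissipation Q A x n := by
  have hw0 : 0 < w := h.z_pos.trans hzw
  have hS := h.summable_pow hw0.le hw
  have hlt : ϱ < ∑' n : ℕ, ((n : ℝ) + 1) * (w ^ (n + 1) * Q n) := by
    rw [← h.hasSum.tsum_eq]
    refine Summable.tsum_lt_tsum (i := 0) (fun n => ?_) ?_ h.hasSum.summable hS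
    · have := (h.Q_pos n).le
      have := h.z_pos.le
      have : z ^ (n + 1) ≤ w ^ (n + 1) := by gcongr
      dsimp only
      gcongr
    · simp [h.Q_zero, hzw]
  obtain ⟨N, hN⟩ := ((hS.hasSum.tendsto_sum_nat.eventually (lt_mem_nhds hlt))).exists
  set P := ∑ n ∈ Finset.range N, ((n : ℝ) + 1) * (w ^ (n + 1) * Q n) with hP
  have hϱ := h.mass_pos
  have hP0 : 0 < P := hϱ.trans hN
  have hN0 : 0 < N := by
    rcases Nat.eq_zero_or_pos N with h0 | h0
    · rw [hP, h0] at hP0; simp at hP0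
    · exact h0
  have hNr : (0 : ℝ) < N := by exact_mod_cast hN0
  -- The threshold with r² P = ϱ. Decrements below (1 - r)/N keep the ratio above r on all of n < N.
  set r := √(ϱ / P) with hr
  have hr1 : r < 1 := by
    rw [hr, Real.sqrt_lt' one_pos, one_pow, div_lt_one hP0]; exact hN
  have hr0 : 0 < r := Real.sqrt_pos.2 (div_pos hϱ hP0)
  obtain ⟨m, hm, hmle⟩ := exists_pos_le_of_lt
    (f := fun n => C₁ * (w * (w ^ (n + 1) * Q n)))
    (fun n => by have := h.Q_pos n; positivity) N
  refine ⟨m * ((1 - r) / N) ^ 2, ?_, fun A x hA hx hx0 => ?_⟩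
  · have : 0 < 1 - r := by linarith
    positivity
  by_contra! hlt'
  have h0 : 0 < x 0 := hw0.trans_le hx0
  set q : ℕ → ℝ := fun n => x 0 ^ (n + 1) * Q n with hq
  have hq0 : ∀ n, 0 < q n := fun n => mul_pos (pow_pos h0 _) (h.Q_pos n)
  set g : ℕ → ℝ := fun n => √(x n) / √(q n) with hg
  have hstep : ∀ n < N, g n - g (n + 1) < (1 - r) / N := by
    intro n hn
    have h1 : dissipation Q A x n < m * ((1 - r) / N) ^ 2 :=
      ((h.summable_dissipation hA hC₁ hγ hx).le_tsum n
        (fun k _ => dissipation_nonneg (hA.nonneg hC₁) k)).trans_lt hlt'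
    rw [h.dissipation_eq h0] at h1
    have h2 : m ≤ A n * (x 0 * (x 0 ^ (n + 1) * Q n)) := by
      refine (hmle n hn).trans ?_
      have h3 := (h.Q_pos n).le
      have h4 : C₁ ≤ A n := by
        refine le_trans ?_ (hA.le_rate n)
        have : (1 : ℝ) ≤ ((n : ℝ) + 1) ^ γ :=
          Real.one_le_rpow (by linarith [n.cast_nonneg (α := ℝ)]) hγ₀
        nlinarith
      have h5 := hC₁.le.trans h4
      gcongr
    have h3 : m * (g (n + 1) - g n) ^ 2 < m * ((1 - r) / N) ^ 2 :=
      (mul_le_mul_of_nonneg_right h2 (sq_nonneg _)).trans_lt h1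
    have h4 := lt_of_mul_lt_mul_left h3 hm.le
    have h5 := abs_lt_of_sq_lt_sq h4 (div_nonneg (by linarith) hNr.le)
    linarith [(abs_lt.1 h5).1]
  have hg0 : g 0 = 1 := by
    simp only [hg, hq, h.Q_zero]
    simp [div_self (Real.sqrt_pos.2 h0).ne']
  have hgn : ∀ n ≤ N, 1 - n * ((1 - r) / N) ≤ g n := by
    intro n
    induction n with
    | zero => intro _; simp [hg0]
    | succ n ih =>
      intro hn
      have := ih (by omega)
      have := hstep n (by omega)
      push_cast
      linarith
  have hgr : ∀ n < N, r < g n := by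
    intro n hn
    refine lt_of_lt_of_le ?_ (hgn n hn.le)
    have h1 : (n : ℝ) < N := by exact_mod_cast hn
    have h2 : (n : ℝ) * ((1 - r) / N) < 1 - r := by
      rw [mul_div_assoc', div_lt_iff₀ hNr]
      nlinarith
    linarith
  have hxn : ∀ n, x n = q n * g n ^ 2 := by
    intro n
    simp only [hg]
    rw [div_pow, Real.sq_sqrt (hx.nonneg n), Real.sq_sqrt (hq0 n).le]
    field_simp [(hq0 n).ne']
  have hfin : ϱ < ∑ n ∈ Finset.range N, ((n : ℝ) + 1) * x n := by
    have h1 : ϱ = ∑ n ∈ Finset.range N, ((n : ℝ) + 1) * (w ^ (n + 1) * Q n) * r ^ 2 := by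
      rw [← Finset.sum_mul, ← hP, hr, Real.sq_sqrt (by positivity)]
      field_simp
    rw [h1]
    refine Finset.sum_lt_sum_of_nonempty (by simpa using hN0.ne') fun n hn => ?_
    rw [hxn n]
    have h2 := hgr n (Finset.mem_range.1 hn)
    have h3 : r ^ 2 < g n ^ 2 := by gcongr
    have h4 := h.Q_pos n
    calc ((n : ℝ) + 1) * (w ^ (n + 1) * Q n) * r ^ 2
        < ((n : ℝ) + 1) * (w ^ (n + 1) * Q n) * g n ^ 2 := by gcongr
      _ ≤ ((n : ℝ) + 1) * (x 0 ^ (n + 1) * Q n) * g n ^ 2 := by gcongr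
      _ = _ := by simp only [hq]; ring
  exact absurd (hx.sum_le _) (not_le.2 hfin)

/-- Hardy-type estimate of the distance to the quasi-equilibrium `x 0 ^ (n + 1) * Q n`. -/
theorem exists_sum_sq_le_dissipation (h : EquilibriumData Q zs R ϱ z) (hC₁ : 0 < C₁) (hγ₀ : 0 ≤ γ)
    (hγ : γ ≤ 1) {δ w : ℝ} (hδ : 0 < δ) (hw0 : 0 < w) (hw : w < zs) :
    ∃ B, 0 < B ∧ ∀ A x : ℕ → ℝ, RateBounds A γ C₁ C₂ → MassState ϱ x → δ ≤ x 0 → x 0 ≤ w →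
      ∑' n : ℕ, ((n : ℝ) + 1) ^ γ * (√(x n) - √(x 0 ^ (n + 1) * Q n)) ^ 2 ≤
        B * ∑' n, dissipation Q A x n := by
  have hzs := h.zs_pos
  set l := w / zs with hl
  have hl0 : 0 < l := div_pos hw0 hzs
  have hl1 : l < 1 := (div_lt_one hzs).2 hw
  -- The shift in (n + m)^γ slows the growth of the weight to a factor at most 1 + 1/m per step, and
  -- (1 + 1/m) l ≤ (1 + l)/2 since 2l ≤ 1 + l². The product with q therefore still decays
  -- geometrically.
  set m := 2 / (1 - l) with hm
  have hl2 : 0 < 1 - l := by linarith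
  have hm1 : 1 ≤ m := by rw [hm, le_div_iff₀ hl2]; linarith
  set θ := (1 + l) / 2 with hθ
  have hθ1 : θ < 1 := by rw [hθ]; linarith
  refine ⟨4 / (1 - θ) ^ 2 * (m / (C₁ * δ)), ?_, fun A x hA hx hδx hxw => ?_⟩
  · have : 0 < 1 - θ := by linarith
    positivity
  have h0 : 0 < x 0 := hδ.trans_le hδx
  set q : ℕ → ℝ := fun n => x 0 ^ (n + 1) * Q n with hq
  have hq0 : ∀ n, 0 < q n := fun n => mul_pos (pow_pos h0 _) (h.Q_pos n)
  set s : ℕ → ℝ := fun n => √(x n) / √(q n) - 1 with hs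
  set μ : ℕ → ℝ := fun n => ((n : ℝ) + m) ^ γ * q n with hμ
  have hs0 : s 0 = 0 := by
    simp only [hs, hq, h.Q_zero]
    simp [div_self (Real.sqrt_pos.2 h0).ne']
  have hμ0 : ∀ n, 0 ≤ μ n := fun n => mul_nonneg (by positivity) (hq0 n).le
  have hqdec : ∀ n, q (n + 1) ≤ l * q n := by
    intro n
    have h1 := h.le_Q n
    have h2 : q (n + 1) * zs ≤ w * q n := by
      calc q (n + 1) * zs = x 0 * x 0 ^ (n + 1) * (zs * Q (n + 1)) := by simp only [hq]; ring
        _ ≤ w * x 0 ^ (n + 1) * Q n := by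
          have := h.Q_pos (n + 1)
          gcongr
        _ = _ := by simp only [hq]; ring
    rw [hl, div_mul_eq_mul_div, le_div_iff₀ hzs]
    exact h2
  have hdec : ∀ n, μ (n + 1) ≤ θ * μ n := by
    intro n
    have hnm : 0 < (n : ℝ) + m := by positivity
    have hk : (((n + 1 : ℕ) : ℝ) + m) ≤ (1 + 1 / m) * ((n : ℝ) + m) := by
      have : 1 / m * ((n : ℝ) + m) = n / m + 1 := by field_simp
      have h2 : 0 ≤ (n : ℝ) / m := by positivity
      push_cast
      linarith
    have h1 : (((n + 1 : ℕ) : ℝ) + m) ^ γ ≤ (1 + 1 / m) * ((n : ℝ) + m) ^ γ := by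
      calc (((n + 1 : ℕ) : ℝ) + m) ^ γ ≤ ((1 + 1 / m) * ((n : ℝ) + m)) ^ γ :=
            Real.rpow_le_rpow (by positivity) hk hγ₀
        _ = (1 + 1 / m) ^ γ * ((n : ℝ) + m) ^ γ := Real.mul_rpow (by positivity) hnm.le
        _ ≤ (1 + 1 / m) * ((n : ℝ) + m) ^ γ := by
          gcongr
          calc (1 + 1 / m) ^ γ ≤ (1 + 1 / m) ^ (1 : ℝ) :=
                Real.rpow_le_rpow_of_exponent_le (by simp; positivity) hγ
            _ = _ := Real.rpow_one _
    have h2 : (1 + 1 / m) * l ≤ θ := by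
      rw [hm, hθ, one_div_div]; nlinarith
    calc μ (n + 1) ≤ ((1 + 1 / m) * ((n : ℝ) + m) ^ γ) * (l * q n) :=
          mul_le_mul h1 (hqdec n) (hq0 _).le (by positivity)
      _ = (1 + 1 / m) * l * μ n := by simp only [hμ]; ring
      _ ≤ θ * μ n := mul_le_mul_of_nonneg_right h2 (hμ0 n)
  have hD := h.summable_dissipation hA hC₁ hγ hx
  have hD0 : ∀ n, 0 ≤ dissipation Q A x n := dissipation_nonneg (hA.nonneg hC₁)
  refine Real.tsum_le_of_sum_range_le (fun n => by positivity) fun N => ?_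
  calc ∑ n ∈ Finset.range N, ((n : ℝ) + 1) ^ γ * (√(x n) - √(x 0 ^ (n + 1) * Q n)) ^ 2
      ≤ ∑ n ∈ Finset.range N, μ n * s n ^ 2 := by
        refine Finset.sum_le_sum fun n _ => ?_
        have h1 : q n * s n ^ 2 = (√(x n) - √(q n)) ^ 2 := by
          have h2 := Real.sqrt_pos.2 (hq0 n)
          have h3 : √(x n) - √(q n) = √(q n) * s n := by simp only [hs]; field_simp
          rw [h3, mul_pow, Real.sq_sqrt (hq0 n).le]
        have h2 : ((n : ℝ) + 1) ^ γ ≤ ((n : ℝ) + m) ^ γ :=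
          Real.rpow_le_rpow (by positivity) (by linarith) hγ₀
        calc _ ≤ ((n : ℝ) + m) ^ γ * (√(x n) - √(q n)) ^ 2 :=
              mul_le_mul_of_nonneg_right h2 (sq_nonneg _)
          _ = _ := by rw [← h1]; simp only [hμ]; ring
    _ ≤ 4 / (1 - θ) ^ 2 * ∑ n ∈ Finset.range N, μ n * (s (n + 1) - s n) ^ 2 :=
        sum_mul_sq_le_of_geometric (by rw [hθ]; positivity) hθ1 hμ0 hdec hs0 N
    _ ≤ 4 / (1 - θ) ^ 2 * ∑ n ∈ Finset.range N, m / (C₁ * δ) * dissipation Q A x n := by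
        refine mul_le_mul_of_nonneg_left (Finset.sum_le_sum fun n _ => ?_) (by positivity)
        have e : dissipation Q A x n = A n * (x 0 * q n) * (s (n + 1) - s n) ^ 2 := by
          rw [h.dissipation_eq h0]
          simp only [hs]
          ring
        rw [e]
        have h1 : ((n : ℝ) + m) ^ γ ≤ m * ((n : ℝ) + 1) ^ γ := by
          calc ((n : ℝ) + m) ^ γ ≤ (m * ((n : ℝ) + 1)) ^ γ :=
                Real.rpow_le_rpow (by positivity) (by nlinarith [n.cast_nonneg (α := ℝ)]) hγ₀
            _ = m ^ γ * ((n : ℝ) + 1) ^ γ := Real.mul_rpow (by positivity) (by positivity)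
            _ ≤ m * ((n : ℝ) + 1) ^ γ := by
              gcongr
              calc m ^ γ ≤ m ^ (1 : ℝ) := Real.rpow_le_rpow_of_exponent_le hm1 hγ
                _ = _ := Real.rpow_one _
        have h2 : m * ((n : ℝ) + 1) ^ γ ≤ m / (C₁ * δ) * (A n * x 0) := by
          have := mul_le_mul (hA.le_rate n) hδx hδ.le (hA.nonneg hC₁ n)
          calc m * ((n : ℝ) + 1) ^ γ = m / (C₁ * δ) * (C₁ * ((n : ℝ) + 1) ^ γ * δ) := by
                field_simp
            _ ≤ _ := by gcongr
        calc μ n * (s (n + 1) - s n) ^ 2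
            ≤ m / (C₁ * δ) * (A n * x 0) * q n * (s (n + 1) - s n) ^ 2 := by
              refine mul_le_mul_of_nonneg_right ?_ (sq_nonneg _)
              exact mul_le_mul_of_nonneg_right (h1.trans h2) (hq0 n).le
          _ = _ := by ring
    _ ≤ _ := by
        rw [← Finset.mul_sum, ← mul_assoc]
        have := hD.sum_le_tsum (Finset.range N) (fun n _ => hD0 n)
        gcongr

/-- The entropy is controlled by the distance to the quasi-equilibrium. -/
theorem exists_freeEnergy_le_sum_sq (h : EquilibriumData Q zs R ϱ z) {δ w : ℝ} (hδ : 0 < δ)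
    (hw : w < zs) :
    ∃ B, 0 < B ∧ ∀ x : ℕ → ℝ, MassState ϱ x → δ ≤ x 0 → x 0 ≤ w →
      freeEnergy Q z x ≤
        B * ∑' n : ℕ, ((n : ℝ) + 1) * (√(x n) - √(x 0 ^ (n + 1) * Q n)) ^ 2 := by
  have hL := logBound_nonneg R ϱ δ
  refine ⟨9 + 2 * logBound R ϱ δ, by positivity, fun x hx hδx hxw => ?_⟩
  have h0 : 0 < x 0 := hδ.trans_le hδx
  -- Passing from z to the current monomer density x_0 only increases the free energy, and allows a
  -- comparison with the quasi-equilibrium.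
  refine (h.freeEnergy_le_of_density hx h0 (hxw.trans_lt hw)).trans ?_
  have hq0 : ∀ n, 0 < x 0 ^ (n + 1) * Q n := fun n => mul_pos (pow_pos h0 _) (h.Q_pos n)
  have hsum : Summable fun n : ℕ => ((n : ℝ) + 1) * (√(x n) - √(x 0 ^ (n + 1) * Q n)) ^ 2 := by
    refine Summable.of_nonneg_of_le (fun n => by positivity) (fun n => ?_)
      (hx.summable.add (h.summable_pow h0.le (hxw.trans_lt hw)))
    rw [← mul_add]
    refine mul_le_mul_of_nonneg_left ?_ (by positivity)
    have a1 := Real.sq_sqrt (hx.nonneg n)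
    have a2 := Real.sq_sqrt (hq0 n).le
    have a3 := mul_nonneg (Real.sqrt_nonneg (x n)) (Real.sqrt_nonneg (x 0 ^ (n + 1) * Q n))
    nlinarith
  rw [← tsum_mul_left]
  refine Summable.tsum_le_tsum (fun n => ?_)
    (h.summable_freeEnergyDensity hx h0 (hxw.trans_lt hw)) (hsum.mul_left _)
  refine (entropyDensity_le_sq (hq0 n) (hx.nonneg n) (Λ := logBound R ϱ δ * ((n : ℝ) + 1))
    (by positivity) (h.log_div_le (hx.nonneg n) (hx.le n) hδ hδx n)).trans ?_
  nlinarith [mul_nonneg n.cast_nonneg (sq_nonneg (√(x n) - √(x 0 ^ (n + 1) * Q n)))]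

/-- With few monomers fragmentation dominates: (√u - √v)² ≥ v/2 - u. The constant 1/4 combines this
1/2 with the loss 2 in (n + 2)^γ ≤ 2 (n + 1)^γ. -/
theorem le_dissipation_of_monomer_le (h : EquilibriumData Q zs R ϱ z) (hC₁ : 0 < C₁)
    (hγ₀ : 0 ≤ γ) (hγ : γ ≤ 1) {A x : ℕ → ℝ} (hA : RateBounds A γ C₁ C₂) (hx : MassState ϱ x) :
    C₁ * zs / 4 * ∑' n : ℕ, ((n : ℝ) + 1) ^ γ * (if n = 0 then 0 else x n) - C₂ * ϱ * x 0 ≤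
      ∑' n, dissipation Q A x n := by
  have hzs := h.zs_pos
  have hC₂ := hA.C₂_pos hC₁
  have sγ : Summable fun n : ℕ => ((n : ℝ) + 1) ^ γ * (if n = 0 then 0 else x n) := by
    refine summable_rpow_mul_of_le hγ (fun n => ?_) ?_
    · split_ifs
      · exact le_rfl
      · exact hx.nonneg n
    · simp only [Real.rpow_one]
      refine Summable.of_nonneg_of_le (fun n => ?_) (fun n => ?_) hx.summable
      · split_ifs
        · simp
        · exact mul_nonneg (by positivity) (hx.nonneg n)
      · split_ifs
        · simpa using mul_nonneg (by positivity : 0 ≤ (n : ℝ) + 1) (hx.nonneg n)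
        · exact le_rfl
  have e1 : ∑' n : ℕ, ((n : ℝ) + 1) ^ γ * (if n = 0 then 0 else x n) =
      ∑' n : ℕ, (((n + 1 : ℕ) : ℝ) + 1) ^ γ * x (n + 1) := by
    rw [sγ.tsum_eq_zero_add]; simp
  have sγ' : Summable fun n : ℕ => (((n + 1 : ℕ) : ℝ) + 1) ^ γ * x (n + 1) := by
    simpa using (summable_nat_add_iff 1).2 sγ
  rw [e1]
  have key := hasSum_le (fun n => ?_)
    ((sγ'.hasSum.mul_left (C₁ * zs / 4)).sub (hx.hasSum.mul_left (C₂ * x 0)))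
    (h.summable_dissipation hA hC₁ hγ hx).hasSum
  · linarith
  have h0 := hx.nonneg 0
  have hn := hx.nonneg n
  have hn1 := hx.nonneg (n + 1)
  have hr := h.ratio_pos n
  have b1 : Q n / Q (n + 1) * x (n + 1) / 2 - x 0 * x n ≤
      (√(x 0 * x n) - √(Q n / Q (n + 1) * x (n + 1))) ^ 2 := by
    have a1 := Real.sq_sqrt (mul_nonneg h0 hn)
    have a2 := Real.sq_sqrt (mul_nonneg hr.le hn1)
    nlinarith [sq_nonneg (2 * √(x 0 * x n) - √(Q n / Q (n + 1) * x (n + 1)))]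
  have b2 := mul_le_mul_of_nonneg_left b1 (hA.nonneg hC₁ n)
  have b3 : A n * (x 0 * x n) ≤ C₂ * x 0 * (((n : ℝ) + 1) * x n) := by
    have := mul_le_mul_of_nonneg_right (hA.rate_le_linear hC₁ hγ n) (mul_nonneg h0 hn)
    linarith
  have b4 : C₁ * zs / 4 * ((((n + 1 : ℕ) : ℝ) + 1) ^ γ * x (n + 1)) ≤
      A n * (Q n / Q (n + 1) * x (n + 1) / 2) := by
    have c1 : (((n + 1 : ℕ) : ℝ) + 1) ^ γ ≤ 2 * ((n : ℝ) + 1) ^ γ := by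
      calc (((n + 1 : ℕ) : ℝ) + 1) ^ γ ≤ (2 * ((n : ℝ) + 1)) ^ γ :=
            Real.rpow_le_rpow (by positivity) (by push_cast; linarith [n.cast_nonneg (α := ℝ)]) hγ₀
        _ = 2 ^ γ * ((n : ℝ) + 1) ^ γ := Real.mul_rpow (by norm_num) (by positivity)
        _ ≤ 2 * ((n : ℝ) + 1) ^ γ := by
          gcongr
          calc (2 : ℝ) ^ γ ≤ 2 ^ (1 : ℝ) := Real.rpow_le_rpow_of_exponent_le one_le_two hγ
            _ = _ := Real.rpow_one _
    have c2 := mul_le_mul (hA.le_rate n) (mul_le_mul_of_nonneg_right (h.ratio_ge n) hn1)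
      (by positivity) (hA.nonneg hC₁ n)
    have c3 := mul_le_mul_of_nonneg_left (mul_le_mul_of_nonneg_right c1 hn1)
      (by positivity : 0 ≤ C₁ * zs / 4)
    linarith
  unfold dissipation
  linarith

/-- The entropy - entropy dissipation inequality. -/
theorem exists_coercivity (h : EquilibriumData Q zs R ϱ z) (hC₁ : 0 < C₁) (hC₂ : 0 < C₂)
    (hγ₀ : 0 ≤ γ) (hγ : γ ≤ 1) {p C w : ℝ} (hp : 0 < p) (hC : 0 < C) (hzw : z < w) (hw : w < zs) :
    ∃ K, 0 < K ∧ ∀ A x : ℕ → ℝ, RateBounds A γ C₁ C₂ → MassState ϱ x →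
      Interpolates γ p C (fun n => x n + w ^ (n + 1) * Q n) →
      K * freeEnergy Q z x ^ p ≤ ∑' n, dissipation Q A x n := by
  have hϱ := h.mass_pos
  have hzs := h.zs_pos
  have hw0 : 0 < w := h.z_pos.trans hzw
  -- The fragmentation contribution when at least half of the mass lies outside the monomers; δ is
  -- chosen so that this holds for x_0 ≤ δ and so that the coagulation term consumes at most a/2.
  set a := C₁ * zs / 4 * ((ϱ / 2) ^ p / C) with ha
  have ha0 : 0 < a := by positivity
  set δ := min (ϱ / 2) (a / (2 * C₂ * ϱ)) with hδ
  have hδ0 : 0 < δ := lt_min (by positivity) (by positivity)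
  obtain ⟨ε, hε, hεD⟩ := h.exists_le_dissipation_of_le (C₂ := C₂) hC₁ hγ₀ hγ hzw hw
  obtain ⟨B, hB, hBD⟩ := h.exists_sum_sq_le_dissipation (C₂ := C₂) hC₁ hγ₀ hγ hδ0 hw0 hw
  obtain ⟨E, hE, hEH⟩ := h.exists_freeEnergy_le_sum_sq hδ0 hw
  have hF := h.freeEnergyBound_pos
  set F := freeEnergyBound R ϱ z
  refine ⟨min (min (ε / F ^ p) (a / 2 / F ^ p)) (1 / (E ^ p * C * B)), by positivity,
    fun A x hA hx hI => ?_⟩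
  have hH0 := h.freeEnergy_nonneg hx
  have hH1 : freeEnergy Q z x ^ p ≤ F ^ p := Real.rpow_le_rpow hH0 (h.freeEnergy_le hx) hp.le
  have hH2 : 0 ≤ freeEnergy Q z x ^ p := by positivity
  have hFp : 0 < F ^ p := by positivity
  have aux : ∀ k, 0 ≤ k → k / F ^ p * freeEnergy Q z x ^ p ≤ k := by
    intro k hk
    calc k / F ^ p * freeEnergy Q z x ^ p ≤ k / F ^ p * F ^ p := by gcongr
      _ = k := by field_simp
  -- Three regimes: x_0 ≥ w, x_0 ≤ δ, and in between. In the first two the dissipation is at least ε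
  -- or a/2, and `aux` trades this constant for a multiple of the bounded free energy.
  rcases le_total w (x 0) with h1 | h1
  · refine le_trans ?_ (hεD A x hA hx h1)
    refine le_trans ?_ (aux ε hε.le)
    gcongr
    exact (min_le_left _ _).trans (min_le_left _ _)
  rcases le_total (x 0) δ with h2 | h2
  · refine le_trans ?_ (h.le_dissipation_of_monomer_le hC₁ hγ₀ hγ hA hx)
    have hu := hI (fun n => if n = 0 then 0 else x n)
      (fun n => by split_ifs <;> [exact le_rfl; exact hx.nonneg n])
      (fun n => by
        have b1 := hx.nonneg n
        have b2 := (h.Q_pos n).le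
        have b3 : 0 ≤ w ^ (n + 1) * Q n := by positivity
        split_ifs <;> linarith)
    have hmass : ∑' n : ℕ, ((n : ℝ) + 1) * (if n = 0 then 0 else x n) = ϱ - x 0 := by
      have b1 := hx.summable.tsum_eq_zero_add
      rw [hx.hasSum.tsum_eq] at b1
      have b2 : Summable fun n : ℕ => ((n : ℝ) + 1) * (if n = 0 then 0 else x n) := by
        refine (summable_nat_add_iff 1).1 ?_
        simpa using (summable_nat_add_iff 1).2 hx.summable
      rw [b2.tsum_eq_zero_add]
      simp at b1 ⊢
      linarith
    rw [hmass] at hu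
    have h3 : x 0 ≤ ϱ / 2 := h2.trans (min_le_left _ _)
    have h4 : (ϱ / 2) ^ p ≤ (ϱ - x 0) ^ p :=
      Real.rpow_le_rpow (by positivity) (by linarith) hp.le
    have h5 : (ϱ / 2) ^ p / C ≤ ∑' n : ℕ, ((n : ℝ) + 1) ^ γ * (if n = 0 then 0 else x n) := by
      rw [div_le_iff₀ hC]; linarith
    have h6 : C₂ * ϱ * x 0 ≤ a / 2 := by
      calc C₂ * ϱ * x 0 ≤ C₂ * ϱ * (a / (2 * C₂ * ϱ)) := by
            gcongr; exact h2.trans (min_le_right _ _)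
        _ = a / 2 := by field_simp
    have h7 := mul_le_mul_of_nonneg_left h5 (by positivity : 0 ≤ C₁ * zs / 4)
    have h8 : min (min (ε / F ^ p) (a / 2 / F ^ p)) (1 / (E ^ p * C * B)) *
        freeEnergy Q z x ^ p ≤ a / 2 := by
      refine le_trans ?_ (aux (a / 2) (by positivity))
      gcongr
      exact (min_le_left _ _).trans (min_le_right _ _)
    linarith
  · set D := ∑' n, dissipation Q A x n
    have hq0 : ∀ n, 0 ≤ x 0 ^ (n + 1) * Q n := fun n =>
      mul_nonneg (pow_nonneg (hx.nonneg 0) _) (h.Q_pos n).le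
    -- The squares are at most x_n + x_0^{n+1} Q_n, hence below the majorant with w, so
    -- interpolation applies to them.
    have hu := hI (fun n => (√(x n) - √(x 0 ^ (n + 1) * Q n)) ^ 2) (fun n => sq_nonneg _)
      (fun n => by
        have a1 := Real.sq_sqrt (hx.nonneg n)
        have a2 := Real.sq_sqrt (hq0 n)
        have a3 := mul_nonneg (Real.sqrt_nonneg (x n)) (Real.sqrt_nonneg (x 0 ^ (n + 1) * Q n))
        have a4 : x 0 ^ (n + 1) * Q n ≤ w ^ (n + 1) * Q n :=
          mul_le_mul_of_nonneg_right (pow_le_pow_left₀ (hx.nonneg 0) h1 _) (h.Q_pos n).le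
        dsimp only
        nlinarith)
    set S := ∑' n : ℕ, ((n : ℝ) + 1) * (√(x n) - √(x 0 ^ (n + 1) * Q n)) ^ 2
    have hS0 : 0 ≤ S := tsum_nonneg fun n => by positivity
    have h3 := hBD A x hA hx h2 h1
    have h4 : freeEnergy Q z x ^ p ≤ E ^ p * (C * (B * D)) := by
      calc freeEnergy Q z x ^ p ≤ (E * S) ^ p := Real.rpow_le_rpow hH0 (hEH x hx h2 h1) hp.le
        _ = E ^ p * S ^ p := Real.mul_rpow hE.le hS0
        _ ≤ E ^ p * (C * (B * D)) := by
          refine mul_le_mul_of_nonneg_left (hu.trans ?_) (by positivity)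
          exact mul_le_mul_of_nonneg_left h3 hC.le
    calc _ ≤ 1 / (E ^ p * C * B) * freeEnergy Q z x ^ p := by
          gcongr; exact min_le_right _ _
      _ ≤ 1 / (E ^ p * C * B) * (E ^ p * (C * (B * D))) := by gcongr
      _ = D := by field_simp

end EquilibriumData

/-! ### Trajectories: mass conservation, regularity and positivity -/

/-- The net rates, indexed from `0`, in terms of the detailed balance coefficients. -/
noncomputable def flux (Q A x : ℕ → ℝ) (n : ℕ) : ℝ :=
  A n * (x 0 * x n - Q n / Q (n + 1) * x (n + 1))

/-- Mass conserving solutions of the Becker–Döring equations, indexed from `0`. -/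
structure Trajectory (Q A : ℕ → ℝ) (ϱ : ℝ) (x : ℝ → ℕ → ℝ) : Prop where
  continuous : ∀ n, Continuous fun t => x t n
  state : ∀ t, MassState ϱ (x t)
  succ_eq : ∀ t, 0 ≤ t → ∀ n, x t (n + 1) =
    x 0 (n + 1) + ∫ s in (0 : ℝ)..t, (flux Q A (x s) n - flux Q A (x s) (n + 1))
  zero_eq : ∀ t, 0 ≤ t → x t 0 =
    x 0 0 + ∫ s in (0 : ℝ)..t, (-flux Q A (x s) 0 - ∑' k, flux Q A (x s) k)
  tail_eq : ∀ t, 0 ≤ t → ∀ n, ∑' k, x t (k + (n + 1)) =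
    ∑' k, x 0 (k + (n + 1)) + ∫ s in (0 : ℝ)..t, flux Q A (x s) n

theorem continuous_flux {Q A : ℕ → ℝ} {x : ℝ → ℕ → ℝ} (hx : ∀ n, Continuous fun t => x t n)
    (n : ℕ) : Continuous fun t => flux Q A (x t) n := by
  have := hx 0
  have := hx n
  have := hx (n + 1)
  unfold flux
  fun_prop

theorem EquilibriumData.abs_flux_le {Q A x : ℕ → ℝ} {zs R ϱ z γ C₁ C₂ B : ℝ}
    (h : EquilibriumData Q zs R ϱ z) (hA : RateBounds A γ C₁ C₂) (hC₁ : 0 < C₁)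
    (hγ : γ ≤ 1) (hx : ∀ n, 0 ≤ x n) (hB : x 0 ≤ B) (n : ℕ) :
    |flux Q A x n| ≤ C₂ * (B + R) * (((n : ℝ) + 1) * x n + ((n : ℝ) + 2) * x (n + 1)) := by
  have h0 := hx 0
  have hn := hx n
  have hn1 := hx (n + 1)
  have hr := (h.ratio_pos n).le
  have hR := h.R_pos
  have e1 : |x 0 * x n - Q n / Q (n + 1) * x (n + 1)| ≤ (B + R) * (x n + x (n + 1)) := by
    have b1 := mul_le_mul_of_nonneg_right hB hn
    have b2 := mul_le_mul_of_nonneg_right (h.ratio_le n) hn1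
    have b3 := mul_nonneg hR.le hn
    have b4 := mul_nonneg (h0.trans hB) hn1
    have b5 := mul_nonneg h0 hn
    have b6 := mul_nonneg hr hn1
    rw [abs_le]; constructor <;> linarith
  have e4 : 0 ≤ (B + R) * (x n + x (n + 1)) := (abs_nonneg _).trans e1
  have e5 : 0 ≤ C₂ * (B + R) * x (n + 1) := by
    have := hA.C₂_pos hC₁
    have := h0.trans hB
    positivity
  unfold flux
  rw [abs_mul, abs_of_nonneg (hA.nonneg hC₁ n)]
  calc A n * |x 0 * x n - Q n / Q (n + 1) * x (n + 1)|
      ≤ C₂ * ((n : ℝ) + 1) * ((B + R) * (x n + x (n + 1))) :=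
        mul_le_mul (hA.rate_le_linear hC₁ hγ n) e1 (abs_nonneg _)
          ((hA.nonneg hC₁ n).trans (hA.rate_le_linear hC₁ hγ n))
    _ ≤ _ := by linarith

/-- The sum depends on the state only through x_0. Along a trajectory of constant mass it is
therefore continuous in time, which is what Dini's theorem requires. -/
theorem MassState.hasSum_pair {ϱ : ℝ} {x : ℕ → ℝ} (h : MassState ϱ x) :
    HasSum (fun n : ℕ => ((n : ℝ) + 1) * x n + ((n : ℝ) + 2) * x (n + 1)) (ϱ + (ϱ - x 0)) := by
  refine h.hasSum.add ?_
  have := (hasSum_nat_add_iff' 1).2 h.hasSum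
  simp only [Finset.sum_range_one, Nat.cast_zero, zero_add, one_mul] at this
  have e : (fun n : ℕ => ((n : ℝ) + 2) * x (n + 1)) =
      fun n : ℕ => (((n + 1 : ℕ) : ℝ) + 1) * x (n + 1) := by
    funext n; push_cast; ring
  rwa [e]

/-- Mass conservation and the tail equations are consequences of the integrated equations. The state
is frozen for negative times so that continuity can be stated on the whole line. -/
theorem trajectory_of_integral_eq {Q A : ℕ → ℝ} {x : ℝ → ℕ → ℝ} {zs R ϱ z γ C₁ C₂ : ℝ}
    (h : EquilibriumData Q zs R ϱ z) (hA : RateBounds A γ C₁ C₂) (hC₁ : 0 < C₁) (hγ : γ ≤ 1)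
    (hnn : ∀ t n, 0 ≤ x t n) (hc : ∀ n, Continuous fun t => x t n)
    (hB : ∀ T, ∃ B, ∀ t ≤ T, (Summable fun n : ℕ => ((n : ℝ) + 1) * x t n) ∧
      ∑' n : ℕ, ((n : ℝ) + 1) * x t n ≤ B)
    (hneg : ∀ t ≤ 0, x t = x 0)
    (h0 : HasSum (fun n : ℕ => ((n : ℝ) + 1) * x 0 n) ϱ)
    (succ_eq : ∀ t, 0 ≤ t → ∀ n, x t (n + 1) =
      x 0 (n + 1) + ∫ s in (0 : ℝ)..t, (flux Q A (x s) n - flux Q A (x s) (n + 1)))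
    (zero_eq : ∀ t, 0 ≤ t → x t 0 =
      x 0 0 + ∫ s in (0 : ℝ)..t, (-flux Q A (x s) 0 - ∑' k, flux Q A (x s) k)) :
    Trajectory Q A ϱ x := by
  have hfc := continuous_flux (Q := Q) (A := A) hc
  have main : ∀ t, 0 ≤ t → HasSum (fun n : ℕ => ((n : ℝ) + 1) * x t n) ϱ ∧
      ∀ n, ∑' k, x t (k + (n + 1)) =
        ∑' k, x 0 (k + (n + 1)) + ∫ s in (0 : ℝ)..t, flux Q A (x s) n := by
    intro t ht
    obtain ⟨B, hB⟩ := hB t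
    have hst : ∀ s ≤ t, MassState (∑' n : ℕ, ((n : ℝ) + 1) * x s n) (x s) := fun s hs =>
      ⟨hnn s, (hB s hs).1.hasSum⟩
    set w : ℕ → ℝ := fun n => ∫ s in (0 : ℝ)..t, flux Q A (x s) n with hw
    have hii : ∀ n, IntervalIntegrable (fun s => flux Q A (x s) n) volume 0 t := fun n =>
      (hfc n).intervalIntegrable _ _
    have hdiff : ∀ n, x t (n + 1) - x 0 (n + 1) = w n - w (n + 1) := by
      intro n
      rw [succ_eq t ht n, intervalIntegral.integral_sub (hii _) (hii _)]; ring
    have hfb : ∀ s ≤ t, ∀ n, |flux Q A (x s) n| ≤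
        C₂ * (B + R) * (((n : ℝ) + 1) * x s n + ((n : ℝ) + 2) * x s (n + 1)) := fun s hs n =>
      h.abs_flux_le hA hC₁ hγ (hnn s) (((hst s hs).le 0).trans (hB s hs).2) n
    have hB0 : 0 ≤ B := (hst t le_rfl).mass_nonneg.trans (hB t le_rfl).2
    have hC : 0 ≤ C₂ * (B + R) := by
      have := hA.C₂_pos hC₁
      have := h.R_pos
      positivity
    have hsf : ∀ s ≤ t, Summable fun n => flux Q A (x s) n := fun s hs =>
      Summable.of_abs (Summable.of_nonneg_of_le (fun _ => abs_nonneg _) (hfb s hs)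
        ((hst s hs).hasSum_pair.summable.mul_left _))
    have hsb : ∀ s ≤ t, ∀ N, ∑ n ∈ Finset.range N, |flux Q A (x s) n| ≤ C₂ * (B + R) * (2 * B) := by
      intro s hs N
      refine (Finset.sum_le_sum fun n _ => hfb s hs n).trans ?_
      rw [← Finset.mul_sum]
      refine mul_le_mul_of_nonneg_left ?_ hC
      refine (sum_le_hasSum _ (fun n _ => ?_) (hst s hs).hasSum_pair).trans ?_
      · exact add_nonneg (mul_nonneg (by positivity) (hnn _ _))
          (mul_nonneg (by positivity) (hnn _ _))
      · linarith [(hB s hs).2, hnn s 0]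
    have hlim : Tendsto (fun N => -w 0 - ∑ n ∈ Finset.range N, w n) atTop
        (𝓝 (x t 0 - x 0 0)) := by
      have e : x t 0 - x 0 0 = ∫ s in (0 : ℝ)..t, (-flux Q A (x s) 0 - ∑' k, flux Q A (x s) k) := by
        rw [zero_eq t ht]; ring
      rw [e]
      have e2 : (fun N => -w 0 - ∑ n ∈ Finset.range N, w n) = fun N =>
          ∫ s in (0 : ℝ)..t, (-flux Q A (x s) 0 - ∑ n ∈ Finset.range N, flux Q A (x s) n) := by
        funext N
        have hc2 : Continuous fun s => ∑ n ∈ Finset.range N, flux Q A (x s) n :=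
          continuous_finsetSum _ fun n _ => hfc n
        have hn : IntervalIntegrable (fun s => -flux Q A (x s) 0) volume 0 t := (hii 0).neg
        rw [intervalIntegral.integral_sub hn (hc2.intervalIntegrable _ _),
          intervalIntegral.integral_neg, intervalIntegral.integral_finsetSum fun n _ => hii n]
      rw [e2]
      refine intervalIntegral.tendsto_integral_filter_of_dominated_convergence
        (fun _ => C₂ * (B + R) * (2 * B) + C₂ * (B + R) * (2 * B)) ?_ ?_ (by simp) ?_
      · refine Eventually.of_forall fun N => Continuous.aestronglyMeasurable ?_
        exact (hfc 0).neg.sub (continuous_finsetSum _ fun n _ => hfc n)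
      · refine Eventually.of_forall fun N => Eventually.of_forall fun s hs => ?_
        rw [uIoc_of_le ht] at hs
        have h1 := hsb s hs.2 1
        have h2 := hsb s hs.2 N
        have h3 := Finset.abs_sum_le_sum_abs (fun n => flux Q A (x s) n) (Finset.range N)
        simp only [Finset.sum_range_one] at h1
        rw [Real.norm_eq_abs]
        have h4 := abs_sub (-flux Q A (x s) 0) (∑ n ∈ Finset.range N, flux Q A (x s) n)
        rw [abs_neg] at h4
        linarith
      · refine Eventually.of_forall fun s hs => ?_
        rw [uIoc_of_le ht] at hs
        exact tendsto_const_nhds.sub (hsf s hs.2).hasSum.tendsto_sum_nat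
    -- The monomer equation makes the partial sums of the integrated fluxes converge, so the fluxes
    -- themselves tend to zero. Telescoping then gives the tail equations.
    have hw0 : Tendsto w atTop (𝓝 0) := by
      have h1 := hlim.sub (hlim.comp (tendsto_add_atTop_nat 1))
      rw [sub_self] at h1
      refine h1.congr fun N => ?_
      simp only [Function.comp_apply, Finset.sum_range_succ]; ring
    have hsx : ∀ s ≤ t, ∀ n, Summable fun k => x s (k + (n + 1)) := fun s hs n =>
      (summable_nat_add_iff (n + 1)).2 (hst s hs).summable_coe
    have htail : ∀ n, HasSum (fun k => x t (k + (n + 1)) - x 0 (k + (n + 1))) (w n) := by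
      intro n
      have h1 := (hsx t le_rfl n).sub (hsx 0 ht n)
      have h2 : Tendsto (fun N => w n - w (N + n)) atTop (𝓝 (w n - 0)) :=
        tendsto_const_nhds.sub (hw0.comp (tendsto_add_atTop_nat n))
      rw [sub_zero] at h2
      have h3 : (fun N => w n - w (N + n)) =
          fun N => ∑ k ∈ Finset.range N, (x t (k + (n + 1)) - x 0 (k + (n + 1))) := by
        funext N
        induction N with
        | zero => simp
        | succ N ih =>
          rw [Finset.sum_range_succ, ← ih, show N + (n + 1) = (N + n) + 1 by ring, hdiff,
            show N + 1 + n = N + n + 1 by ring]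
          ring
      rw [h3] at h2
      rw [← tendsto_nhds_unique h1.hasSum.tendsto_sum_nat h2]
      exact h1.hasSum
    refine ⟨?_, fun n => ?_⟩
    -- By the tail equation, (n + 1)|w_n| is at most the mass above size n at times 0 and t, and
    -- both tend to zero.
    · have hnw : Tendsto (fun n : ℕ => ((n : ℝ) + 1) * w n) atTop (𝓝 0) := by
        have t1 := tendsto_sum_nat_add (fun n : ℕ => ((n : ℝ) + 1) * x t n)
        have t2 := tendsto_sum_nat_add (fun n : ℕ => ((n : ℝ) + 1) * x 0 n)
        have t3 := ((t1.add t2).comp (tendsto_add_atTop_nat 1))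
        rw [add_zero] at t3
        refine squeeze_zero_norm (fun n => ?_) t3
        have s1 := (summable_nat_add_iff (n + 1)).2 (hst t le_rfl).summable
        have s2 := (summable_nat_add_iff (n + 1)).2 (hst 0 ht).summable
        simp only [Function.comp_apply]
        rw [← s1.tsum_add s2, Real.norm_eq_abs, abs_le]
        have p : ∀ k, |((n : ℝ) + 1) * (x t (k + (n + 1)) - x 0 (k + (n + 1)))| ≤
            (((k + (n + 1) : ℕ) : ℝ) + 1) * x t (k + (n + 1)) +
            (((k + (n + 1) : ℕ) : ℝ) + 1) * x 0 (k + (n + 1)) := by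
          intro k
          have a1 := hnn t (k + (n + 1))
          have a2 := hnn 0 (k + (n + 1))
          have a3 : (0 : ℝ) ≤ k := k.cast_nonneg
          have a4 : (0 : ℝ) ≤ n := n.cast_nonneg
          push_cast
          rw [abs_le]
          constructor <;> nlinarith [mul_nonneg a3 a1, mul_nonneg a3 a2, mul_nonneg a4 a1,
            mul_nonneg a4 a2]
        have hs := (htail n).mul_left ((n : ℝ) + 1)
        constructor
        · rw [← tsum_neg]
          exact hasSum_le (fun k => (abs_le.1 (p k)).1) (s1.add s2).neg.hasSum hs
        · exact hasSum_le (fun k => (abs_le.1 (p k)).2) hs (s1.add s2).hasSum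
      -- The change of the truncated mass is the defect of the truncated monomer equation minus (N +
      -- 1) w_N, and both vanish in the limit.
      have hid : ∀ N : ℕ, ∑ k ∈ Finset.range (N + 1), (((k : ℝ) + 1) * x t k -
          ((k : ℝ) + 1) * x 0 k) = (x t 0 - x 0 0) - (-w 0 - ∑ n ∈ Finset.range N, w n) -
            ((N : ℝ) + 1) * w N := by
        intro N
        induction N with
        | zero => simp
        | succ N ih =>
          rw [Finset.sum_range_succ, ih, Finset.sum_range_succ]
          have := hdiff N
          push_cast
          linear_combination ((N : ℝ) + 2) * this
      have l1 : Tendsto (fun N : ℕ => ∑ k ∈ Finset.range (N + 1), (((k : ℝ) + 1) * x t k -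
          ((k : ℝ) + 1) * x 0 k)) atTop (𝓝 0) := by
        simp only [hid]
        have l0 := ((tendsto_const_nhds (x := x t 0 - x 0 0)).sub hlim).sub hnw
        rwa [sub_self, sub_zero] at l0
      have l2 := ((hB t le_rfl).1.sub (hB 0 ht).1).hasSum.tendsto_sum_nat.comp
        (tendsto_add_atTop_nat 1)
      have l3 := tendsto_nhds_unique l1 l2
      rw [(hB t le_rfl).1.tsum_sub (hB 0 ht).1, h0.tsum_eq] at l3
      have l4 := (hB t le_rfl).1.hasSum
      rwa [show ∑' n : ℕ, ((n : ℝ) + 1) * x t n = ϱ by linarith] at l4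
    · have := (htail n).tsum_eq
      rw [(hsx t le_rfl n).tsum_sub (hsx 0 ht n)] at this
      linarith
  refine ⟨hc, fun t => ⟨hnn t, ?_⟩, succ_eq, zero_eq, fun t ht => (main t ht).2⟩
  rcases le_total 0 t with ht | ht
  · exact (main t ht).1
  · rw [hneg t ht]; exact h0

/-- By Dini's theorem the dominating series, nonnegative with continuous sum, converges locally
uniformly; its remainders bound those of the given series. -/
theorem tendstoLocallyUniformly_tsum_of_le {f u : ℕ → ℝ → ℝ} {U : ℝ → ℝ}
    (hf : ∀ n t, |f n t| ≤ u n t) (hu : ∀ n, Continuous (u n))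
    (hU : ∀ t, HasSum (fun n => u n t) (U t)) (hUc : Continuous U) :
    TendstoLocallyUniformly (fun N t => ∑ n ∈ Finset.range N, f n t) (fun t => ∑' n, f n t)
      atTop := by
  have hu0 : ∀ n t, 0 ≤ u n t := fun n t => (abs_nonneg _).trans (hf n t)
  have hsf : ∀ t, Summable fun n => f n t := fun t =>
    Summable.of_abs (Summable.of_nonneg_of_le (fun _ => abs_nonneg _) (hf · t) (hU t).summable)
  have h1 : TendstoLocallyUniformly (fun N t => ∑ n ∈ Finset.range N, u n t) U atTop := by
    refine Monotone.tendstoLocallyUniformly_of_forall_tendsto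
      (fun N => continuous_finsetSum _ fun n _ => hu n) ?_ hUc
      fun t => (hU t).tendsto_sum_nat
    intro N M hNM t
    exact Finset.sum_le_sum_of_subset_of_nonneg (Finset.range_mono hNM) fun n _ _ => hu0 n t
  rw [Metric.tendstoLocallyUniformly_iff] at h1 ⊢
  intro ε hε t
  obtain ⟨s, hs, h2⟩ := h1 ε hε t
  refine ⟨s, hs, h2.mono fun N hN y hy => ?_⟩
  refine lt_of_le_of_lt ?_ (hN y hy)
  rw [Real.dist_eq, Real.dist_eq]
  have a1 := (hsf y).sum_add_tsum_nat_add N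
  have a2 := (hU y).summable.sum_add_tsum_nat_add N
  rw [(hU y).tsum_eq] at a2
  have s1 := (summable_nat_add_iff N).2 (hsf y)
  have s2 := (summable_nat_add_iff N).2 (hU y).summable
  refine le_trans ?_ (le_abs_self _)
  rw [show ∑' n, f n y - ∑ n ∈ Finset.range N, f n y = ∑' n, f (n + N) y by linarith,
    show U y - ∑ n ∈ Finset.range N, u n y = ∑' n, u (n + N) y by linarith, abs_le, ← tsum_neg]
  exact ⟨hasSum_le (fun n => (abs_le.1 (hf _ y)).1) s2.neg.hasSum s1.hasSum,
    hasSum_le (fun n => (abs_le.1 (hf _ y)).2) s1.hasSum s2.hasSum⟩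

theorem hasDerivAt_of_integral_eq {y g : ℝ → ℝ} {y₀ : ℝ} (hg : Continuous g)
    (hy : ∀ t, 0 ≤ t → y t = y₀ + ∫ s in (0 : ℝ)..t, g s) {t : ℝ} (ht : 0 < t) :
    HasDerivAt y (g t) t := by
  have h1 : HasDerivAt (fun t => y₀ + ∫ s in (0 : ℝ)..t, g s) (g t) t :=
    (hg.integral_hasStrictDerivAt 0 t).hasDerivAt.const_add y₀
  refine h1.congr_of_eventuallyEq ?_
  filter_upwards [lt_mem_nhds ht] with s hs using hy s hs.le

/-- Integrating factor: a component that is positive at time 0 remains so. -/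
theorem monotoneOn_exp_mul {y y' : ℝ → ℝ} {L : ℝ} (hc : ContinuousOn y (Ici 0))
    (hd : ∀ t, 0 < t → HasDerivAt y (y' t) t) (hle : ∀ t, 0 < t → -L * y t ≤ y' t) :
    MonotoneOn (fun t => Real.exp (L * t) * y t) (Ici 0) := by
  have hd' : ∀ t, 0 < t → HasDerivAt (fun t => Real.exp (L * t) * y t)
      (Real.exp (L * t) * L * y t + Real.exp (L * t) * y' t) t := by
    intro t ht
    have h1 : HasDerivAt (fun t => Real.exp (L * t)) (Real.exp (L * t) * L) t := by
      simpa using ((hasDerivAt_id t).const_mul L).exp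
    exact h1.mul (hd t ht)
  refine monotoneOn_of_deriv_nonneg (convex_Ici 0) ?_ ?_ ?_
  · exact ContinuousOn.mul (by fun_prop) hc
  · intro t ht
    rw [interior_Ici] at ht
    exact (hd' t ht).differentiableAt.differentiableWithinAt
  · intro t ht
    rw [interior_Ici] at ht
    rw [(hd' t ht).deriv]
    have := hle t ht
    have h2 := Real.exp_pos (L * t)
    nlinarith

/-- The strict version, which creates positivity from a zero initial value when there is a positive
source. -/
theorem pos_of_hasDerivAt_gt {y y' : ℝ → ℝ} {L : ℝ} (hc : ContinuousOn y (Ici 0)) (h0 : 0 ≤ y 0)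
    (hd : ∀ t, 0 < t → HasDerivAt y (y' t) t) (hlt : ∀ t, 0 < t → -L * y t < y' t) {t : ℝ}
    (ht : 0 < t) : 0 < y t := by
  have hd' : ∀ t, 0 < t → HasDerivAt (fun t => Real.exp (L * t) * y t)
      (Real.exp (L * t) * L * y t + Real.exp (L * t) * y' t) t := by
    intro t ht
    have h1 : HasDerivAt (fun t => Real.exp (L * t)) (Real.exp (L * t) * L) t := by
      simpa using ((hasDerivAt_id t).const_mul L).exp
    exact h1.mul (hd t ht)
  have hm : StrictMonoOn (fun t => Real.exp (L * t) * y t) (Ici 0) := by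
    refine strictMonoOn_of_deriv_pos (convex_Ici 0) ?_ ?_
    · exact ContinuousOn.mul (by fun_prop) hc
    · intro t ht
      rw [interior_Ici] at ht
      rw [(hd' t ht).deriv]
      have := hlt t ht
      have h2 := Real.exp_pos (L * t)
      nlinarith
  have h1 := hm (self_mem_Ici) (mem_Ici.2 ht.le) ht
  simp only [mul_zero, Real.exp_zero, one_mul] at h1
  exact pos_of_mul_pos_right (h0.trans_lt h1) (Real.exp_pos _).le

namespace Trajectory

variable {Q A : ℕ → ℝ} {x : ℝ → ℕ → ℝ} {zs R ϱ z γ C₁ C₂ : ℝ}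

theorem tendstoLocallyUniformly_tsum (hx : Trajectory Q A ϱ x) {f : ℕ → ℝ → ℝ} {C : ℝ}
    (hf : ∀ n t, |f n t| ≤ C * (((n : ℝ) + 1) * x t n + ((n : ℝ) + 2) * x t (n + 1))) :
    TendstoLocallyUniformly (fun N t => ∑ n ∈ Finset.range N, f n t) (fun t => ∑' n, f n t)
      atTop := by
  have hc := hx.continuous
  refine tendstoLocallyUniformly_tsum_of_le hf (fun n => ?_)
    (fun t => (hx.state t).hasSum_pair.mul_left C) ?_
  · have := hc n
    have := hc (n + 1)
    fun_prop
  · have := hc 0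
    fun_prop

theorem continuous_tsum (hx : Trajectory Q A ϱ x) {f : ℕ → ℝ → ℝ} {C : ℝ}
    (hfc : ∀ n, Continuous (f n))
    (hf : ∀ n t, |f n t| ≤ C * (((n : ℝ) + 1) * x t n + ((n : ℝ) + 2) * x t (n + 1))) :
    Continuous fun t => ∑' n, f n t :=
  (hx.tendstoLocallyUniformly_tsum hf).continuous
    (Frequently.of_forall fun _ => continuous_finsetSum _ fun n _ => hfc n)

theorem abs_flux_le (hx : Trajectory Q A ϱ x) (h : EquilibriumData Q zs R ϱ z)
    (hA : RateBounds A γ C₁ C₂) (hC₁ : 0 < C₁) (hγ : γ ≤ 1) (n : ℕ) (t : ℝ) :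
    |flux Q A (x t) n| ≤
      C₂ * (ϱ + R) * (((n : ℝ) + 1) * x t n + ((n : ℝ) + 2) * x t (n + 1)) :=
  h.abs_flux_le hA hC₁ hγ (hx.state t).nonneg ((hx.state t).le 0) n

theorem summable_flux (hx : Trajectory Q A ϱ x) (h : EquilibriumData Q zs R ϱ z)
    (hA : RateBounds A γ C₁ C₂) (hC₁ : 0 < C₁) (hγ : γ ≤ 1) (t : ℝ) :
    Summable fun n => flux Q A (x t) n :=
  Summable.of_abs (Summable.of_nonneg_of_le (fun _ => abs_nonneg _)
    (fun n => hx.abs_flux_le h hA hC₁ hγ n t) ((hx.state t).hasSum_pair.summable.mul_left _))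

theorem continuous_tsum_flux (hx : Trajectory Q A ϱ x) (h : EquilibriumData Q zs R ϱ z)
    (hA : RateBounds A γ C₁ C₂) (hC₁ : 0 < C₁) (hγ : γ ≤ 1) :
    Continuous fun t => ∑' n, flux Q A (x t) n :=
  hx.continuous_tsum (continuous_flux hx.continuous) (hx.abs_flux_le h hA hC₁ hγ)

theorem continuous_dissipation (hx : Trajectory Q A ϱ x) (n : ℕ) :
    Continuous fun t => dissipation Q A (x t) n := by
  have := hx.continuous 0
  have := hx.continuous n
  have := hx.continuous (n + 1)
  unfold dissipation
  fun_prop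

theorem continuous_tsum_dissipation (hx : Trajectory Q A ϱ x) (h : EquilibriumData Q zs R ϱ z)
    (hA : RateBounds A γ C₁ C₂) (hC₁ : 0 < C₁) (hγ : γ ≤ 1) :
    Continuous fun t => ∑' n, dissipation Q A (x t) n := by
  refine hx.continuous_tsum (C := C₂ * (ϱ + R)) hx.continuous_dissipation fun n t => ?_
  rw [abs_of_nonneg (dissipation_nonneg (hA.nonneg hC₁) n)]
  refine (h.dissipation_le hA hC₁ hγ (hx.state t) n).trans ?_
  have h1 := (hx.state t).nonneg (n + 1)
  have h2 := hA.C₂_pos hC₁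
  have h3 := h.R_pos
  have h4 := h.mass_pos
  gcongr
  linarith

theorem hasDerivAt_succ (hx : Trajectory Q A ϱ x) (n : ℕ) {t : ℝ} (ht : 0 < t) :
    HasDerivAt (fun t => x t (n + 1)) (flux Q A (x t) n - flux Q A (x t) (n + 1)) t :=
  hasDerivAt_of_integral_eq
    (g := fun s => flux Q A (x s) n - flux Q A (x s) (n + 1))
    ((continuous_flux hx.continuous n).sub (continuous_flux hx.continuous (n + 1)))
    (fun t ht => hx.succ_eq t ht n) ht

theorem hasDerivAt_zero (hx : Trajectory Q A ϱ x) (h : EquilibriumData Q zs R ϱ z)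
    (hA : RateBounds A γ C₁ C₂) (hC₁ : 0 < C₁) (hγ : γ ≤ 1) {t : ℝ} (ht : 0 < t) :
    HasDerivAt (fun t => x t 0) (-flux Q A (x t) 0 - ∑' k, flux Q A (x t) k) t :=
  hasDerivAt_of_integral_eq (g := fun s => -flux Q A (x s) 0 - ∑' k, flux Q A (x s) k)
    ((continuous_flux hx.continuous 0).neg.sub (hx.continuous_tsum_flux h hA hC₁ hγ))
    hx.zero_eq ht

theorem hasDerivAt_tail (hx : Trajectory Q A ϱ x) (n : ℕ) {t : ℝ} (ht : 0 < t) :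
    HasDerivAt (fun t => ∑' k, x t (k + (n + 1))) (flux Q A (x t) n) t :=
  hasDerivAt_of_integral_eq (g := fun s => flux Q A (x s) n)
    (continuous_flux hx.continuous n) (fun t ht => hx.tail_eq t ht n) ht

/-- Positivity of all components for positive times. -/
theorem pos (hx : Trajectory Q A ϱ x) (h : EquilibriumData Q zs R ϱ z)
    (hA : RateBounds A γ C₁ C₂) (hC₁ : 0 < C₁) (hγ : γ ≤ 1) (n : ℕ) {t : ℝ} (ht : 0 < t) :
    0 < x t n := by
  have hnn := fun t => (hx.state t).nonneg
  have hAp := hA.pos hC₁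
  have hρ := h.ratio_pos
  have hC₂ := hA.C₂_pos hC₁
  have hϱ := h.mass_pos
  set L : ℕ → ℝ := fun n => A (n + 1) * ϱ + A n * (Q n / Q (n + 1)) with hL
  have lower : ∀ n t, -L n * x t (n + 1) + A n * (x t 0 * x t n) +
      A (n + 1) * (Q (n + 1) / Q (n + 2) * x t (n + 2)) ≤
        flux Q A (x t) n - flux Q A (x t) (n + 1) := by
    intro n t
    have h1 := mul_le_mul_of_nonneg_right ((hx.state t).le 0) (hnn t (n + 1))
    have h2 := mul_le_mul_of_nonneg_left h1 (hAp (n + 1)).le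
    simp only [hL, flux]
    linarith
  have sumlower : ∀ t, -(C₂ * ϱ + A 0 * ϱ) * x t 0 + A 0 * (Q 0 / Q 1 * x t 1) ≤
      -flux Q A (x t) 0 - ∑' k, flux Q A (x t) k := by
    intro t
    have h1 : ∑' k, flux Q A (x t) k ≤ C₂ * x t 0 * ϱ := by
      refine hasSum_le (fun k => ?_) (hx.summable_flux h hA hC₁ hγ t).hasSum
        ((hx.state t).hasSum.mul_left (C₂ * x t 0))
      have a1 := mul_le_mul_of_nonneg_right (hA.rate_le_linear hC₁ hγ k)
        (mul_nonneg (hnn t 0) (hnn t k))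
      have a2 := mul_nonneg (hAp k).le (mul_nonneg (hρ k).le (hnn t (k + 1)))
      unfold flux
      linarith
    have h2 : A 0 * (x t 0 * x t 0) ≤ A 0 * (ϱ * x t 0) :=
      mul_le_mul_of_nonneg_left (mul_le_mul_of_nonneg_right ((hx.state t).le 0) (hnn t 0))
        (hAp 0).le
    have e : flux Q A (x t) 0 = A 0 * (x t 0 * x t 0 - Q 0 / Q 1 * x t 1) := rfl
    rw [e]
    linarith
  -- Positive mass gives one component j that is positive initially, hence always. Fragmentation
  -- carries positivity down from j to the monomer, and coagulation with monomers then carries it up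
  -- to every size.
  have hex : ∃ j, 0 < x 0 j := by
    by_contra! hcon
    have : x 0 = fun _ => 0 := funext fun n => le_antisymm (hcon n) (hnn 0 n)
    have h1 := (hx.state 0).hasSum
    simp only [this, mul_zero] at h1
    exact hϱ.ne (hasSum_zero.unique h1)
  obtain ⟨j, hj⟩ := hex
  have hcont : ∀ n, ContinuousOn (fun t => x t n) (Ici 0) := fun n => (hx.continuous n).continuousOn
  have hjpos : ∀ t, 0 < t → 0 < x t j := by
    intro t ht
    have key : ∃ L : ℝ, MonotoneOn (fun t => Real.exp (L * t) * x t j) (Ici 0) := by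
      cases j with
      | zero =>
        refine ⟨_, monotoneOn_exp_mul (hcont 0) (fun t ht => hx.hasDerivAt_zero h hA hC₁ hγ ht)
          (L := C₂ * ϱ + A 0 * ϱ) fun t _ => ?_⟩
        have a1 := sumlower t
        have a2 := mul_nonneg (hAp 0).le (mul_nonneg (hρ 0).le (hnn t 1))
        simp only [zero_add] at a2
        linarith
      | succ j =>
        refine ⟨_, monotoneOn_exp_mul (hcont (j + 1)) (fun t ht => hx.hasDerivAt_succ j ht)
          (L := L j) fun t _ => ?_⟩
        have a1 := lower j t
        have a2 := mul_nonneg (hAp j).le (mul_nonneg (hnn t 0) (hnn t j))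
        have a3 := mul_nonneg (hAp (j + 1)).le (mul_nonneg (hρ (j + 1)).le (hnn t (j + 2)))
        have e : Q (j + 1 + 1) = Q (j + 2) := rfl
        rw [e] at a3
        linarith
    obtain ⟨L, hL⟩ := key
    have h1 := hL (self_mem_Ici) (mem_Ici.2 ht.le) ht.le
    simp only [mul_zero, Real.exp_zero, one_mul] at h1
    exact pos_of_mul_pos_right (hj.trans_le h1) (Real.exp_pos _).le
  have down : ∀ k, (∀ t, 0 < t → 0 < x t (k + 1)) → ∀ t, 0 < t → 0 < x t k := by
    intro k hk t ht
    cases k with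
    | zero =>
      refine pos_of_hasDerivAt_gt (hcont 0) (hnn 0 0)
        (fun t ht => hx.hasDerivAt_zero h hA hC₁ hγ ht) (L := C₂ * ϱ + A 0 * ϱ) (fun t ht => ?_) ht
      have a1 := sumlower t
      have a2 := mul_pos (hAp 0) (mul_pos (hρ 0) (hk t ht))
      simp only [zero_add] at a2
      linarith
    | succ k =>
      refine pos_of_hasDerivAt_gt (hcont (k + 1)) (hnn 0 (k + 1))
        (fun t ht => hx.hasDerivAt_succ k ht) (L := L k) (fun t ht => ?_) ht
      have a1 := lower k t
      have a2 := mul_nonneg (hAp k).le (mul_nonneg (hnn t 0) (hnn t k))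
      have a3 := mul_pos (hAp (k + 1)) (mul_pos (hρ (k + 1)) (hk t ht))
      have e : Q (k + 1 + 1) = Q (k + 2) := rfl
      rw [e] at a3
      linarith
  have zpos : ∀ t, 0 < t → 0 < x t 0 := by
    have : ∀ k, (∀ t, 0 < t → 0 < x t k) → ∀ t, 0 < t → 0 < x t 0 := by
      intro k
      induction k with
      | zero => exact id
      | succ k ih => exact fun hk => ih (down k hk)
    exact this j hjpos
  induction n generalizing t with
  | zero => exact zpos t ht
  | succ n ih =>
    refine pos_of_hasDerivAt_gt (hcont (n + 1)) (hnn 0 (n + 1))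
      (fun t ht => hx.hasDerivAt_succ n ht) (L := L n) (fun t ht => ?_) ht
    have a1 := lower n t
    have a2 := mul_pos (hAp n) (mul_pos (zpos t ht) (ih ht))
    have a3 := mul_nonneg (hAp (n + 1)).le (mul_nonneg (hρ (n + 1)).le (hnn t (n + 2)))
    have e : Q (n + 1 + 1) = Q (n + 2) := rfl
    rw [e] at a3
    linarith

end Trajectory

/-! ### The energy inequality -/

theorem sq_sqrt_sub_le_mul_log {x y : ℝ} (hx : 0 < x) (hy : 0 < y) :
    (√x - √y) ^ 2 ≤ (x - y) * (Real.log x - Real.log y) := by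
  have key : ∀ a b : ℝ, 0 < a → 0 < b → b ≤ a →
      (a - b) ^ 2 ≤ (a ^ 2 - b ^ 2) * (Real.log (a ^ 2) - Real.log (b ^ 2)) := by
    intro a b ha hb hab
    have h1 := Real.one_sub_inv_le_log_of_pos (div_pos ha hb)
    rw [inv_div, Real.log_div ha.ne' hb.ne'] at h1
    rw [Real.log_pow, Real.log_pow]
    have h2 : (a - b) ^ 2 ≤ (a ^ 2 - b ^ 2) * (1 - b / a) := by
      have : (a ^ 2 - b ^ 2) * (1 - b / a) = (a - b) ^ 2 * ((a + b) / a) := by field_simp; ring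
      rw [this]
      refine le_mul_of_one_le_right (sq_nonneg _) ?_
      rw [le_div_iff₀ ha]; linarith
    have h3 : 0 ≤ a ^ 2 - b ^ 2 := by nlinarith
    have h4 := mul_le_mul_of_nonneg_left h1 h3
    have h5 : 0 ≤ (a ^ 2 - b ^ 2) * (Real.log a - Real.log b) := (sq_nonneg _).trans (h2.trans h4)
    push_cast
    nlinarith
  have e1 := Real.sq_sqrt hx.le
  have e2 := Real.sq_sqrt hy.le
  rcases le_total (√y) (√x) with h | h
  · have := key _ _ (Real.sqrt_pos.2 hx) (Real.sqrt_pos.2 hy) h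
    rwa [e1, e2] at this
  · have := key _ _ (Real.sqrt_pos.2 hy) (Real.sqrt_pos.2 hx) h
    rw [e1, e2] at this
    nlinarith

/-- Otherwise the harmonic series would converge. This selects the truncation sizes in the energy
inequality. -/
theorem frequently_lt_of_summable_div {y : ℕ → ℝ}
    (h : Summable fun n : ℕ => y n / ((n : ℝ) + 1)) {ε : ℝ} (hε : 0 < ε) :
    ∃ᶠ n in atTop, y n < ε := by
  intro hcon
  simp only [not_lt] at hcon
  have h1 : Summable fun n : ℕ => ((n + 1 : ℕ) : ℝ)⁻¹ := by
    refine Summable.of_norm_bounded_eventually_nat (h.mul_left ε⁻¹) ?_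
    filter_upwards [hcon] with n hn
    rw [Real.norm_of_nonneg (by positivity)]
    push_cast
    rw [inv_eq_one_div, ← div_eq_inv_mul, div_div, mul_comm, ← div_div]
    gcongr
    rwa [le_div_iff₀ hε, one_mul]
  exact Real.not_summable_natCast_inv ((summable_nat_add_iff 1).1 h1)

theorem hasDerivAt_entropyDensity {y : ℝ → ℝ} {y' q t : ℝ} (hq : 0 < q) (hy : HasDerivAt y y' t)
    (h0 : 0 < y t) :
    HasDerivAt (fun t => entropyDensity q (y t)) (y' * Real.log (y t / q)) t := by
  have h1 : HasDerivAt (fun t => Real.log (y t / q)) (y' / q / (y t / q)) t :=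
    (hy.div_const q).log (by positivity)
  have h2 := (hy.mul (h1.sub_const 1)).add_const q
  refine h2.congr_deriv ?_
  field_simp
  ring

namespace Trajectory

variable {Q A : ℕ → ℝ} {x : ℝ → ℕ → ℝ} {zs R ϱ z γ C₁ C₂ : ℝ}

/-- The powers of z cancel in the combination of logarithms, leaving the difference of the
logarithms of the two reaction rates. -/
theorem dissipation_le_flux_mul_log (hx : Trajectory Q A ϱ x) (h : EquilibriumData Q zs R ϱ z)
    (hA : RateBounds A γ C₁ C₂) (hC₁ : 0 < C₁) (hγ : γ ≤ 1) {t : ℝ} (ht : 0 < t) (k : ℕ) :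
    dissipation Q A (x t) k ≤ flux Q A (x t) k *
      (Real.log (x t k / (z ^ (k + 1) * Q k)) + Real.log (x t 0 / (z ^ (0 + 1) * Q 0)) -
        Real.log (x t (k + 1) / (z ^ (k + 1 + 1) * Q (k + 1)))) := by
  have p := fun n => hx.pos h hA hC₁ hγ n ht
  have hz := h.z_pos
  have hQ := h.Q_pos
  have e : Real.log (x t k / (z ^ (k + 1) * Q k)) + Real.log (x t 0 / (z ^ (0 + 1) * Q 0)) -
      Real.log (x t (k + 1) / (z ^ (k + 1 + 1) * Q (k + 1))) =
      Real.log (x t 0 * x t k) - Real.log (Q k / Q (k + 1) * x t (k + 1)) := by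
    have hq : ∀ n, z ^ (n + 1) * Q n ≠ 0 := fun n => (mul_pos (pow_pos hz _) (hQ n)).ne'
    rw [Real.log_div (p k).ne' (hq k), Real.log_div (p 0).ne' (hq 0),
      Real.log_div (p (k + 1)).ne' (hq (k + 1)), Real.log_mul (p 0).ne' (p k).ne',
      Real.log_mul (h.ratio_pos k).ne' (p (k + 1)).ne', Real.log_div (hQ k).ne' (hQ (k + 1)).ne',
      Real.log_mul (by positivity) (hQ k).ne', Real.log_mul (by positivity) (hQ 0).ne',
      Real.log_mul (by positivity) (hQ (k + 1)).ne', Real.log_pow, Real.log_pow, Real.log_pow,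
      h.Q_zero, Real.log_one]
    push_cast
    ring
  rw [e]
  unfold dissipation flux
  rw [mul_assoc]
  exact mul_le_mul_of_nonneg_left (sq_sqrt_sub_le_mul_log (mul_pos (p 0) (p k))
    (mul_pos (h.ratio_pos k) (p (k + 1)))) (hA.nonneg hC₁ k)

/-- The right hand side of the Becker–Döring equations. -/
noncomputable def rate (Q A x : ℕ → ℝ) : ℕ → ℝ
  | 0 => -flux Q A x 0 - ∑' k, flux Q A x k
  | n + 1 => flux Q A x n - flux Q A x (n + 1)

theorem hasDerivAt_rate (hx : Trajectory Q A ϱ x) (h : EquilibriumData Q zs R ϱ z)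
    (hA : RateBounds A γ C₁ C₂) (hC₁ : 0 < C₁) (hγ : γ ≤ 1) (n : ℕ) {t : ℝ} (ht : 0 < t) :
    HasDerivAt (fun t => x t n) (rate Q A (x t) n) t := by
  cases n with
  | zero => exact hx.hasDerivAt_zero h hA hC₁ hγ ht
  | succ n => exact hx.hasDerivAt_succ n ht

theorem continuous_rate (hx : Trajectory Q A ϱ x) (h : EquilibriumData Q zs R ϱ z)
    (hA : RateBounds A γ C₁ C₂) (hC₁ : 0 < C₁) (hγ : γ ≤ 1) (n : ℕ) :
    Continuous fun t => rate Q A (x t) n := by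
  cases n with
  | zero =>
    exact (continuous_flux hx.continuous 0).neg.sub (hx.continuous_tsum_flux h hA hC₁ hγ)
  | succ n => exact (continuous_flux hx.continuous n).sub (continuous_flux hx.continuous (n + 1))

/-- Summation by parts. Truncation leaves two errors: the flux through size N, and the tail of the
flux sum that acts on the monomer equation. -/
theorem sum_rate_mul (Q A x l : ℕ → ℝ) (N : ℕ) :
    ∑ k ∈ Finset.range (N + 1), rate Q A x k * l k =
      ∑ k ∈ Finset.range N, flux Q A x k * (l (k + 1) - l k - l 0) - flux Q A x N * l N -
        (∑' k, flux Q A x k - ∑ k ∈ Finset.range N, flux Q A x k) * l 0 := by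
  induction N with
  | zero => simp [rate]; ring
  | succ N ih =>
    rw [Finset.sum_range_succ, ih, Finset.sum_range_succ, Finset.sum_range_succ]
    simp only [rate]
    ring

/-- The energy inequality. -/
theorem freeEnergy_add_integral_le (hx : Trajectory Q A ϱ x) (h : EquilibriumData Q zs R ϱ z)
    (hA : RateBounds A γ C₁ C₂) (hC₁ : 0 < C₁) (hγ : γ ≤ 1) {s t : ℝ} (hs : 0 < s) (hst : s ≤ t) :
    EquilibriumData.freeEnergy Q z (x t) + ∫ τ in s..t, ∑' n, dissipation Q A (x τ) n ≤
      EquilibriumData.freeEnergy Q z (x s) := by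
  have hC₂ := hA.C₂_pos hC₁
  have hϱ := h.mass_pos
  have hR := h.R_pos
  have hz := h.z_pos
  set L := EquilibriumData.logBound R ϱ z with hL
  have hL0 : 0 ≤ L := EquilibriumData.logBound_nonneg _ _ _
  set q : ℕ → ℝ := fun n => z ^ (n + 1) * Q n with hq
  have hq0 : ∀ n, 0 < q n := fun n => mul_pos (pow_pos hz _) (h.Q_pos n)
  set l : ℕ → ℝ → ℝ := fun n τ => Real.log (x τ n / q n) with hl
  have hpos : ∀ τ ∈ Icc s t, 0 < τ := fun τ hτ => hs.trans_le hτ.1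
  have hp : ∀ n, ∀ τ ∈ Icc s t, 0 < x τ n := fun n τ hτ => hx.pos h hA hC₁ hγ n (hpos τ hτ)
  have hlc : ∀ n, ContinuousOn (l n) (Icc s t) := fun n =>
    ContinuousOn.log ((hx.continuous n).continuousOn.div_const _)
      fun τ hτ => (div_pos (hp n τ hτ) (hq0 n)).ne'
  -- The logarithm of the monomer density is bounded on [s, t] because positivity holds for all
  -- sizes at times s > 0.
  obtain ⟨Λ, hΛ⟩ := isCompact_Icc.exists_bound_of_continuousOn (hlc 0)
  have hΛ0 : 0 ≤ Λ := (norm_nonneg _).trans (hΛ s (left_mem_Icc.2 hst))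
  set D : ℝ → ℝ := fun τ => ∑' n, dissipation Q A (x τ) n with hD
  have hDc : Continuous D := hx.continuous_tsum_dissipation h hA hC₁ hγ
  set E : ℕ → ℝ → ℝ := fun N τ => ∑ k ∈ Finset.range (N + 1), entropyDensity (q k) (x τ k) with hE
  have hElim : ∀ τ, Tendsto (fun N => E N τ) atTop (𝓝 (EquilibriumData.freeEnergy Q z (x τ))) :=
    fun τ => ((h.summable_freeEnergyDensity (hx.state τ) hz h.z_lt).hasSum.tendsto_sum_nat.comp
      (tendsto_add_atTop_nat 1))
  -- The time-integrated boundary term. Conservation of mass controls only ∑ y_N/(N + 1), so y_N is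
  -- small along a subsequence.
  set y : ℕ → ℝ := fun N => ((N : ℝ) + 1) ^ 2 * ∫ τ in s..t, x τ (N + 1) with hy
  have hI0 : ∀ N, 0 ≤ ∫ τ in s..t, x τ (N + 1) := fun N =>
    intervalIntegral.integral_nonneg hst fun τ _ => (hx.state τ).nonneg _
  have hy0 : ∀ N, 0 ≤ y N := fun N => mul_nonneg (by positivity) (hI0 N)
  have hysum : Summable fun N : ℕ => y N / ((N : ℝ) + 1) := by
    refine summable_of_sum_range_le (c := ∫ τ in s..t, ϱ)
      (fun N => div_nonneg (hy0 N) (by positivity)) fun M => ?_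
    have e : ∑ N ∈ Finset.range M, y N / ((N : ℝ) + 1) =
        ∫ τ in s..t, ∑ N ∈ Finset.range M, ((N : ℝ) + 1) * x τ (N + 1) := by
      have hi : ∀ N : ℕ, IntervalIntegrable (fun τ => ((N : ℝ) + 1) * x τ (N + 1)) volume s t :=
        fun N => (continuous_const.mul (hx.continuous (N + 1))).intervalIntegrable _ _
      rw [intervalIntegral.integral_finsetSum fun N _ => hi N]
      refine Finset.sum_congr rfl fun N _ => ?_
      rw [intervalIntegral.integral_const_mul]
      simp only [hy]
      field_simp
    rw [e]
    refine intervalIntegral.integral_mono_on hst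
      ((continuous_finsetSum _ fun N _ =>
        continuous_const.mul (hx.continuous (N + 1))).intervalIntegrable _ _)
      (by simp) fun τ _ => ?_
    have a1 := (hx.state τ).sum_le (Finset.range (M + 1))
    rw [Finset.sum_range_succ'] at a1
    have a2 := (hx.state τ).nonneg 0
    have a3 : ∑ N ∈ Finset.range M, ((N : ℝ) + 1) * x τ (N + 1) ≤
        ∑ N ∈ Finset.range M, (((N + 1 : ℕ) : ℝ) + 1) * x τ (N + 1) :=
      Finset.sum_le_sum fun N _ =>
        mul_le_mul_of_nonneg_right (by push_cast; linarith) ((hx.state τ).nonneg _)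
    simp at a1 a3
    linarith
  have uniform : ∀ {f : ℕ → ℝ → ℝ} {C : ℝ},
      (∀ n τ, |f n τ| ≤ C * (((n : ℝ) + 1) * x τ n + ((n : ℝ) + 2) * x τ (n + 1))) →
      ∀ η : ℝ, 0 < η → ∀ᶠ N in atTop, ∀ τ ∈ Icc s t,
        |∑' n, f n τ - ∑ n ∈ Finset.range N, f n τ| < η := by
    intro f C hf η hη
    have h1 := (hx.tendstoLocallyUniformly_tsum hf).tendstoLocallyUniformlyOn (s := Icc s t)
    rw [tendstoLocallyUniformlyOn_iff_tendstoUniformlyOn_of_compact isCompact_Icc,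
      Metric.tendstoUniformlyOn_iff] at h1
    exact h1 η hη
  have uW := uniform (hx.abs_flux_le h hA hC₁ hγ)
  have uD := uniform (f := fun n τ => dissipation Q A (x τ) n) (C := C₂ * (ϱ + R)) (by
    intro n τ
    rw [abs_of_nonneg (dissipation_nonneg (hA.nonneg hC₁) n)]
    refine (h.dissipation_le hA hC₁ hγ (hx.state τ) n).trans ?_
    have h1 := (hx.state τ).nonneg (n + 1)
    gcongr
    linarith)
  have hqlim : Tendsto (fun N : ℕ => ((N : ℝ) + 1) * q N) atTop (𝓝 0) :=
    h.hasSum.summable.tendsto_atTop_zero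
  set c := (t - s) * (C₂ * ϱ) + C₂ * R * L + (t - s) * (1 + Λ) with hc
  have hts : 0 ≤ t - s := by linarith
  have hc0 : 0 ≤ c := by positivity
  refine le_of_forall_pos_le_add fun e he => ?_
  set η := e / (c + 1) with hη
  have hη0 : 0 < η := by positivity
  have hfreq : ∃ᶠ N in atTop, E N t - E N s ≤ -(∫ τ in s..t, D τ) + c * η := by
    refine ((frequently_lt_of_summable_div hysum hη0).and_eventually
      ((uW η hη0).and ((uD η hη0).and (hqlim.eventually (gt_mem_nhds hη0))))).mono ?_
    rintro N ⟨hyN, hWN, hDN, hqN⟩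
    have hint : E N t - E N s = ∫ τ in s..t,
        ∑ k ∈ Finset.range (N + 1), rate Q A (x τ) k * l k τ := by
      symm
      refine intervalIntegral.integral_eq_sub_of_hasDerivAt (fun τ hτ => ?_) ?_
      · rw [uIcc_of_le hst] at hτ
        exact HasDerivAt.fun_sum fun k _ => hasDerivAt_entropyDensity (hq0 k)
          (hx.hasDerivAt_rate h hA hC₁ hγ k (hpos τ hτ)) (hp k τ hτ)
      · refine ContinuousOn.intervalIntegrable ?_
        rw [uIcc_of_le hst]
        exact continuousOn_finsetSum _ fun k _ =>
          (hx.continuous_rate h hA hC₁ hγ k).continuousOn.mul (hlc k)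
    set b : ℝ → ℝ := fun τ => -D τ + (C₂ * ϱ * (((N : ℝ) + 1) * q N) + (1 + Λ) * η) +
      C₂ * R * L * ((N : ℝ) + 1) ^ 2 * x τ (N + 1) with hb
    have hle : ∀ τ ∈ Icc s t, ∑ k ∈ Finset.range (N + 1), rate Q A (x τ) k * l k τ ≤ b τ := by
      intro τ hτ
      rw [sum_rate_mul Q A (x τ) (fun k => l k τ) N]
      have hxN := hp N τ hτ
      have hnn := (hx.state τ).nonneg
      have a1 : ∑ k ∈ Finset.range N, flux Q A (x τ) k * (l (k + 1) τ - l k τ - l 0 τ) ≤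
          -∑ k ∈ Finset.range N, dissipation Q A (x τ) k := by
        rw [← Finset.sum_neg_distrib]
        refine Finset.sum_le_sum fun k _ => ?_
        have := hx.dissipation_le_flux_mul_log h hA hC₁ hγ (hpos τ hτ) k
        change _ ≤ flux Q A (x τ) k * (l k τ + l 0 τ - l (k + 1) τ) at this
        linarith
      have a2 := (abs_lt.1 (hDN τ hτ)).2
      -- In the boundary flux, coagulation is controlled by -x log(x/q) ≤ q, and fragmentation by
      -- the linear bound on the logarithm; together with the rate this gives the factor (N + 1)².
      have a3 : -(flux Q A (x τ) N * l N τ) ≤ C₂ * ϱ * (((N : ℝ) + 1) * q N) +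
          C₂ * R * L * ((N : ℝ) + 1) ^ 2 * x τ (N + 1) := by
        have b1 : -(x τ N * l N τ) ≤ q N := by
          have := mul_log_div_ge (hq0 N) (hnn N)
          change _ ≤ x τ N * l N τ at this
          linarith
        have b2 : l N τ ≤ L * ((N : ℝ) + 1) :=
          h.log_div_le (hnn N) ((hx.state τ).le N) hz le_rfl N
        have b3 : A N * x τ 0 * (-(x τ N * l N τ)) ≤ C₂ * ((N : ℝ) + 1) * ϱ * q N := by
          have c1 := hA.nonneg hC₁ N
          calc A N * x τ 0 * (-(x τ N * l N τ)) ≤ A N * x τ 0 * q N :=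
                mul_le_mul_of_nonneg_left b1 (mul_nonneg c1 (hnn 0))
            _ ≤ C₂ * ((N : ℝ) + 1) * ϱ * q N := by
                refine mul_le_mul_of_nonneg_right ?_ (hq0 N).le
                exact mul_le_mul (hA.rate_le_linear hC₁ hγ N) ((hx.state τ).le 0) (hnn 0)
                  (by positivity)
        have b4 : A N * (Q N / Q (N + 1)) * x τ (N + 1) * l N τ ≤
            C₂ * ((N : ℝ) + 1) * R * x τ (N + 1) * (L * ((N : ℝ) + 1)) := by
          have c1 : 0 ≤ A N * (Q N / Q (N + 1)) * x τ (N + 1) :=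
            mul_nonneg (mul_nonneg (hA.nonneg hC₁ N) (h.ratio_pos N).le) (hnn _)
          refine (mul_le_mul_of_nonneg_left b2 c1).trans ?_
          refine mul_le_mul_of_nonneg_right ?_ (by positivity)
          refine mul_le_mul_of_nonneg_right ?_ (hnn _)
          exact mul_le_mul (hA.rate_le_linear hC₁ hγ N) (h.ratio_le N) (h.ratio_pos N).le
            (by positivity)
        have e : -(flux Q A (x τ) N * l N τ) = A N * x τ 0 * (-(x τ N * l N τ)) +
            A N * (Q N / Q (N + 1)) * x τ (N + 1) * l N τ := by
          unfold flux; ring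
        rw [e]
        linarith
      have a4 : -((∑' k, flux Q A (x τ) k - ∑ k ∈ Finset.range N, flux Q A (x τ) k) * l 0 τ) ≤
          η * Λ := by
        refine (neg_le_abs _).trans ?_
        rw [abs_mul]
        exact mul_le_mul (hWN τ hτ).le (hΛ τ hτ) (abs_nonneg _) hη0.le
      simp only [hb, hD]
      linarith
    have hbint : ∫ τ in s..t, b τ = -(∫ τ in s..t, D τ) +
        (t - s) * (C₂ * ϱ * (((N : ℝ) + 1) * q N) + (1 + Λ) * η) + C₂ * R * L * y N := by
      have i1 : IntervalIntegrable (fun τ => -D τ) volume s t := hDc.neg.intervalIntegrable _ _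
      have i2 : IntervalIntegrable (fun _ : ℝ => C₂ * ϱ * (((N : ℝ) + 1) * q N) + (1 + Λ) * η)
        volume s t := by simp
      have i3 : IntervalIntegrable (fun τ => C₂ * R * L * ((N : ℝ) + 1) ^ 2 * x τ (N + 1))
        volume s t := (continuous_const.mul (hx.continuous _)).intervalIntegrable _ _
      simp only [hb]
      rw [intervalIntegral.integral_add (i1.add i2) i3, intervalIntegral.integral_add i1 i2,
        intervalIntegral.integral_neg, intervalIntegral.integral_const,
        intervalIntegral.integral_const_mul, smul_eq_mul]
      simp only [hy]
      ring
    have hmono : ∫ τ in s..t, ∑ k ∈ Finset.range (N + 1), rate Q A (x τ) k * l k τ ≤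
        ∫ τ in s..t, b τ := by
      refine intervalIntegral.integral_mono_on hst ?_ ?_ hle
      · refine ContinuousOn.intervalIntegrable ?_
        rw [uIcc_of_le hst]
        exact continuousOn_finsetSum _ fun k _ =>
          (hx.continuous_rate h hA hC₁ hγ k).continuousOn.mul (hlc k)
      · exact ((hDc.neg.add continuous_const).add
          (continuous_const.mul (hx.continuous _))).intervalIntegrable _ _
    rw [hint]
    refine hmono.trans ?_
    rw [hbint]
    have f1 : (t - s) * (C₂ * ϱ * (((N : ℝ) + 1) * q N)) ≤ (t - s) * (C₂ * ϱ * η) := by gcongr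
    have f2 : C₂ * R * L * y N ≤ C₂ * R * L * η := by gcongr
    simp only [hc]
    linarith
  have hlimit := ((hElim t).sub (hElim s))
  -- The truncated energies converge, so the inequality along infinitely many N suffices.
  have hfin := le_of_tendsto_of_frequently hlimit hfreq
  have hcη : c * η ≤ e := by
    rw [hη, mul_div_assoc', div_le_iff₀ (by positivity)]
    nlinarith
  linarith

theorem freeEnergy_antitoneOn (hx : Trajectory Q A ϱ x) (h : EquilibriumData Q zs R ϱ z)
    (hA : RateBounds A γ C₁ C₂) (hC₁ : 0 < C₁) (hγ : γ ≤ 1) :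
    AntitoneOn (fun t => EquilibriumData.freeEnergy Q z (x t)) (Ioi 0) := by
  intro s hs t _ hst
  have h1 := hx.freeEnergy_add_integral_le h hA hC₁ hγ hs hst
  have h2 : 0 ≤ ∫ τ in s..t, ∑' n, dissipation Q A (x τ) n :=
    intervalIntegral.integral_nonneg hst fun τ _ =>
      tsum_nonneg fun n => dissipation_nonneg (hA.nonneg hC₁) n
  dsimp only
  linarith

end Trajectory

/-! ### Stationary supersolutions for the tails -/

/-- The profile `n ↦ a(2j + N) / a(n + j + N)`, `a(m) = m (m + 1) ⋯ (m + s - 1)`, a smooth version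
of the indicator function of `n ≤ j`. -/
noncomputable def profile (N s j n : ℕ) : ℝ :=
  ((2 * j + N).ascFactorial s : ℝ) / ((n + j + N).ascFactorial s : ℝ)

theorem ascFactorial_cast_pos {m : ℕ} (hm : 0 < m) (s : ℕ) : 0 < (m.ascFactorial s : ℝ) := by
  obtain ⟨k, rfl⟩ := Nat.exists_eq_succ_of_ne_zero hm.ne'
  exact_mod_cast Nat.ascFactorial_pos k s

theorem profile_nonneg (N s j n : ℕ) : 0 ≤ profile N s j n := by
  unfold profile; positivity

/-- From m a(m + 1) = (m + s) a(m) with m = n + j + N, so that one step multiplies the profile by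
m/(m + s). -/
theorem profile_succ {N s : ℕ} (hN : 0 < N) (j n : ℕ) :
    profile N s j (n + 1) = profile N s j n * (((n + j + N : ℕ) : ℝ) / ((n + j + N : ℕ) + s)) := by
  have h1 := Nat.succ_ascFactorial (n + j + N) s
  have h2 : ((n + j + N : ℕ) : ℝ) * ((n + j + N + 1).ascFactorial s : ℝ) =
      ((n + j + N : ℕ) + s) * ((n + j + N).ascFactorial s : ℝ) := by exact_mod_cast h1
  have h3 := ascFactorial_cast_pos (by omega : 0 < n + j + N) s
  have h4 := ascFactorial_cast_pos (by omega : 0 < n + j + N + 1) s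
  have h5 : (0 : ℝ) < ((n + j + N : ℕ) : ℝ) := by exact_mod_cast (by omega : 0 < n + j + N)
  unfold profile
  rw [show n + 1 + j + N = n + j + N + 1 by ring, div_mul_div_comm,
    div_eq_div_iff h4.ne' (by positivity)]
  linear_combination (-((2 * j + N).ascFactorial s : ℝ)) * h2

theorem profile_sub_succ {N s : ℕ} (hN : 0 < N) (j n : ℕ) :
    profile N s j n - profile N s j (n + 1) =
    profile N s j n * ((s : ℝ) / ((n + j + N : ℕ) + s)) := by
  have h5 : (0 : ℝ) < ((n + j + N : ℕ) : ℝ) := by exact_mod_cast (by omega : 0 < n + j + N)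
  rw [profile_succ hN]
  field_simp
  ring

theorem profile_succ_le {N s : ℕ} (hN : 0 < N) (j n : ℕ) :
    profile N s j (n + 1) ≤ profile N s j n := by
  have h1 := profile_sub_succ (s := s) hN j n
  have h2 : 0 ≤ profile N s j n * ((s : ℝ) / ((n + j + N : ℕ) + s)) :=
    mul_nonneg (profile_nonneg N s j n) (by positivity)
  linarith

/-- The supersolution condition. Successive decrements have ratio m/(m + 1 + s) with m ≥ N, and for
large N this is close enough to 1 to stay above w/zs. -/
theorem profile_convex {N s : ℕ} (hN : 0 < N) {w zs : ℝ} (hwzs : w < zs)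
    (hzs : w * (N + 1 + s) ≤ zs * N) (j n : ℕ) :
    w * (profile N s j n - profile N s j (n + 1)) ≤
      zs * (profile N s j (n + 1) - profile N s j (n + 2)) := by
  rw [profile_sub_succ hN, profile_sub_succ hN j (n + 1), profile_succ hN]
  set m : ℝ := ((n + j + N : ℕ) : ℝ) with hm
  have hm0 : 0 < m := by rw [hm]; exact_mod_cast (by omega : 0 < n + j + N)
  have hmN : (N : ℝ) ≤ m := by rw [hm]; exact_mod_cast (by omega : N ≤ n + j + N)
  have e : (((n + 1 + j + N : ℕ) : ℝ)) = m + 1 := by rw [hm]; push_cast; ring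
  rw [e]
  have h1 : w ≤ zs * (m / (m + 1 + s)) := by
    rw [mul_div_assoc', le_div_iff₀ (by positivity)]
    nlinarith
  have h2 : 0 ≤ profile N s j n * ((s : ℝ) / (m + s)) :=
    mul_nonneg (profile_nonneg N s j n) (by positivity)
  calc w * (profile N s j n * ((s : ℝ) / (m + s)))
      ≤ zs * (m / (m + 1 + s)) * (profile N s j n * ((s : ℝ) / (m + s))) :=
        mul_le_mul_of_nonneg_right h1 h2
    _ = _ := by ring

/-- Polynomial decay makes n times a decrement comparable with the profile itself; this absorbs
rates growing linearly in n while x_0 exceeds w. -/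
theorem mul_profile_sub_le {N s : ℕ} (hN : 0 < N) (j n : ℕ) :
    ((n : ℝ) + 1) * (profile N s j n - profile N s j (n + 1)) ≤ s * profile N s j (n + 1) := by
  rw [profile_sub_succ hN, profile_succ hN]
  have h1 : ((n : ℝ) + 1) ≤ ((n + j + N : ℕ) : ℝ) := by exact_mod_cast (by omega)
  have h2 : 0 ≤ profile N s j n * ((s : ℝ) / ((n + j + N : ℕ) + s)) :=
    mul_nonneg (profile_nonneg N s j n) (by positivity)
  calc _ ≤ ((n + j + N : ℕ) : ℝ) * (profile N s j n * ((s : ℝ) / ((n + j + N : ℕ) + s))) :=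
        mul_le_mul_of_nonneg_right h1 h2
    _ = _ := by ring

theorem one_le_profile {N s : ℕ} (hN : 0 < N) {j n : ℕ} (h : n ≤ j) : 1 ≤ profile N s j n := by
  have h3 := ascFactorial_cast_pos (by omega : 0 < n + j + N) s
  unfold profile
  rw [one_le_div h3]
  exact_mod_cast Nat.ascFactorial_le s (by omega : n + j + N ≤ 2 * j + N)

theorem profile_le_pow {N s : ℕ} (hN : 0 < N) (j n : ℕ) : profile N s j n ≤
    (s.factorial : ℝ) * 2 ^ s * (((j : ℝ) + N) / ((n : ℝ) + (j + N))) ^ s := by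
  have h5 : (0 : ℝ) < (n : ℝ) + (j + N) := by exact_mod_cast (by omega : 0 < n + (j + N))
  have h1 : ((2 * j + N).ascFactorial s : ℝ) ≤ s.factorial * (2 * ((j : ℝ) + N)) ^ s := by
    have a : ((2 * j + N).ascFactorial s : ℝ) ≤ s.factorial * ((2 * j + N : ℕ) : ℝ) ^ s := by
      exact_mod_cast Nat.ascFactorial_le_factorial_mul_pow (2 * j + N) s
    refine a.trans ?_
    push_cast
    gcongr
    linarith [N.cast_nonneg (α := ℝ)]
  have h2 : ((n : ℝ) + (j + N)) ^ s ≤ ((n + j + N).ascFactorial s : ℝ) := by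
    have a : (((n + j + N : ℕ) : ℝ)) ^ s ≤ ((n + j + N).ascFactorial s : ℝ) := by
      exact_mod_cast Nat.pow_succ_le_ascFactorial (n + j + N) s
    refine le_trans (le_of_eq ?_) a
    push_cast; ring
  unfold profile
  calc _ ≤ (s.factorial * (2 * ((j : ℝ) + N)) ^ s) / ((n : ℝ) + (j + N)) ^ s := by gcongr
    _ = _ := by rw [div_pow, mul_pow]; ring

theorem profile_le {N s : ℕ} (hN : 0 < N) (j n : ℕ) :
    profile N s j n ≤ (s.factorial : ℝ) * 2 ^ s := by
  refine (profile_le_pow hN j n).trans ?_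
  have h5 : (0 : ℝ) < (n : ℝ) + (j + N) := by exact_mod_cast (by omega : 0 < n + (j + N))
  refine mul_le_of_le_one_right (by positivity) (pow_le_one₀ (by positivity) ?_)
  rw [div_le_one h5]
  linarith [n.cast_nonneg (α := ℝ)]

/-- With J = j + N, the profile decays at least like (J/(n + J))^{β+1}. The weighted terms are thus
at most a multiple of J^{β+1}/(n + J)², whose sum telescopes to order J^β: a profile costs no more
than the β-th moment of a particle of size j + 1. -/
theorem sum_rpow_mul_profile_le {N s : ℕ} (hN : 0 < N) {β : ℝ} (hβ : 1 ≤ β) (hs : β + 1 ≤ s)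
    (j K : ℕ) :
    ∑ n ∈ Finset.range K, ((n : ℝ) + 1) ^ (β - 1) * profile N s j n ≤
      2 * ((s.factorial : ℝ) * 2 ^ s) * (N : ℝ) ^ β * ((j : ℝ) + 1) ^ β := by
  set J : ℝ := (j : ℝ) + N with hJ
  set c : ℝ := (s.factorial : ℝ) * 2 ^ s with hc
  have hc0 : 0 ≤ c := by positivity
  have hN1 : (1 : ℝ) ≤ N := by exact_mod_cast hN
  have hJ1 : 1 ≤ J := by rw [hJ]; linarith [j.cast_nonneg (α := ℝ)]
  have hJ0 : 0 < J := by linarith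
  have h1 : ∀ n : ℕ, ((n : ℝ) + 1) ^ (β - 1) * profile N s j n ≤
      c * J ^ (β + 1) * (2 * (1 / ((n : ℝ) + J) - 1 / (((n + 1 : ℕ) : ℝ) + J))) := by
    intro n
    have hm : 0 < (n : ℝ) + J := by positivity
    have a1 : (J / ((n : ℝ) + J)) ^ s ≤ (J / ((n : ℝ) + J)) ^ (β + 1) := by
      rw [← Real.rpow_natCast]
      refine Real.rpow_le_rpow_of_exponent_ge (by positivity) ?_ hs
      rw [div_le_one hm]
      linarith [n.cast_nonneg (α := ℝ)]
    have a2 : ((n : ℝ) + 1) ^ (β - 1) ≤ ((n : ℝ) + J) ^ (β - 1) :=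
      Real.rpow_le_rpow (by positivity) (by linarith) (by linarith)
    have a3 : ((n : ℝ) + J) ^ (β - 1) * (J / ((n : ℝ) + J)) ^ (β + 1) =
        J ^ (β + 1) * (1 / ((n : ℝ) + J) ^ 2) := by
      rw [Real.div_rpow hJ0.le hm.le,
        show β + 1 = (β - 1) + (2 : ℕ) by push_cast; ring, Real.rpow_add_natCast hm.ne']
      have : ((n : ℝ) + J) ^ (β - 1) ≠ 0 := by positivity
      field_simp
    have a4 : 1 / ((n : ℝ) + J) ^ 2 ≤ 2 * (1 / ((n : ℝ) + J) - 1 / (((n + 1 : ℕ) : ℝ) + J)) := by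
      push_cast
      have hm1 : 1 ≤ (n : ℝ) + J := by linarith [n.cast_nonneg (α := ℝ)]
      have e : 2 * (1 / ((n : ℝ) + J) - 1 / ((n : ℝ) + 1 + J)) =
          2 / (((n : ℝ) + J) * ((n : ℝ) + 1 + J)) := by field_simp; ring
      rw [e, div_le_div_iff₀ (by positivity) (by positivity)]
      nlinarith
    calc ((n : ℝ) + 1) ^ (β - 1) * profile N s j n
        ≤ ((n : ℝ) + J) ^ (β - 1) * (c * (J / ((n : ℝ) + J)) ^ (β + 1)) := by
          refine mul_le_mul a2 ((profile_le_pow hN j n).trans ?_) (profile_nonneg N s j n)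
            (by positivity)
          exact mul_le_mul_of_nonneg_left a1 hc0
      _ = c * J ^ (β + 1) * (1 / ((n : ℝ) + J) ^ 2) := by
          rw [mul_left_comm, a3]; ring
      _ ≤ _ := by gcongr
  refine (Finset.sum_le_sum fun n _ => h1 n).trans ?_
  rw [← Finset.mul_sum, ← Finset.mul_sum,
    Finset.sum_range_sub' (fun n : ℕ => 1 / ((n : ℝ) + J)) K]
  have h2 : 1 / (((0 : ℕ) : ℝ) + J) - 1 / ((K : ℝ) + J) ≤ 1 / J := by
    have : 0 ≤ 1 / ((K : ℝ) + J) := by positivity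
    simp at this ⊢
    linarith
  have h3 : J ^ β ≤ (N : ℝ) ^ β * ((j : ℝ) + 1) ^ β := by
    rw [← Real.mul_rpow (by positivity) (by positivity)]
    refine Real.rpow_le_rpow hJ0.le ?_ (by linarith)
    rw [hJ]
    nlinarith [j.cast_nonneg (α := ℝ)]
  calc _ ≤ c * J ^ (β + 1) * (2 * (1 / J)) := by gcongr
    _ = 2 * c * J ^ β := by rw [Real.rpow_add_one hJ0.ne']; field_simp
    _ ≤ 2 * c * ((N : ℝ) ^ β * ((j : ℝ) + 1) ^ β) := by gcongr
    _ = _ := by ring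

/-- Every sequence with finite `β`-th moment has its tails dominated by a stationary supersolution
of the same moment. -/
theorem exists_tail_majorant {w zs ϱ β M C₂ : ℝ} (hwzs : w < zs) (hβ : 1 ≤ β)
    (hC₂ : 0 ≤ C₂) :
    ∃ κ B, 0 ≤ κ ∧ 0 ≤ B ∧ ∀ y : ℕ → ℝ, MassState ϱ y →
      HasSum (fun n : ℕ => ((n : ℝ) + 1) ^ β * y n) M → ∃ G : ℕ → ℝ,
        (∀ n, 0 ≤ G n) ∧ ϱ ≤ G 0 ∧ (∀ n, ∑' k, y (k + n) ≤ G n) ∧ (∀ n, G (n + 1) ≤ G n) ∧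
        (∀ n, w * (G n - G (n + 1)) ≤ zs * (G (n + 1) - G (n + 2))) ∧
        (∀ n : ℕ, C₂ * ((n : ℝ) + 1) * (G n - G (n + 1)) ≤ κ * G (n + 1)) ∧
        ∀ K, ∑ n ∈ Finset.range K, ((n : ℝ) + 1) ^ (β - 1) * G n ≤ B := by
  obtain ⟨s, hs⟩ := exists_nat_ge (β + 1)
  -- Makes w (N + 1 + s) ≤ zs N, the hypothesis of `profile_convex`.
  obtain ⟨N₀, hN₀⟩ := exists_nat_ge (w * (1 + s) / (zs - w))
  set N := N₀ + 1 with hNdef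
  have hN : 0 < N := by omega
  have hNle : w * (N + 1 + s) ≤ zs * N := by
    rw [div_le_iff₀ (by linarith)] at hN₀
    have : (N : ℝ) = N₀ + 1 := by rw [hNdef]; push_cast; ring
    rw [this]
    nlinarith
  set c := 2 * ((s.factorial : ℝ) * 2 ^ s) * (N : ℝ) ^ β with hc
  have hc0 : 0 ≤ c := by positivity
  refine ⟨C₂ * s, c * (|M| + |ϱ|), by positivity, by positivity, fun y hy hM => ?_⟩
  have hϱ := hy.mass_nonneg
  -- The majorant is the superposition of profiles weighted by m. The extra ϱ at j = 0 ensures that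
  -- its value at n = 0 is at least ϱ, so the comparison holds there at all times.
  set m : ℕ → ℝ := fun j => y j + if j = 0 then ϱ else 0 with hm
  have hm0 : ∀ j, 0 ≤ m j := fun j => by
    have := hy.nonneg j
    simp only [hm]
    split_ifs <;> linarith
  have hym : ∀ j, y j ≤ m j := fun j => by
    simp only [hm]
    split_ifs <;> linarith
  have hmM : HasSum (fun j : ℕ => ((j : ℝ) + 1) ^ β * m j) (M + ϱ) := by
    have h1 : HasSum (fun j : ℕ => if j = 0 then ϱ else 0) ϱ := hasSum_ite_eq 0 ϱ
    refine (hM.add h1).congr_fun ?_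
    intro j
    simp only [hm]
    split_ifs with hj
    · subst hj; simp
    · ring
  have hms : Summable m := by
    refine Summable.of_nonneg_of_le hm0 (fun j => ?_) hmM.summable
    refine le_mul_of_one_le_left (hm0 j) (Real.one_le_rpow ?_ (by linarith))
    linarith [j.cast_nonneg (α := ℝ)]
  have hsP : ∀ n, Summable fun j => m j * profile N s j n := fun n =>
    Summable.of_nonneg_of_le (fun j => mul_nonneg (hm0 j) (profile_nonneg N s j n))
      (fun j => mul_le_mul_of_nonneg_left (profile_le hN j n) (hm0 j)) (hms.mul_right _)
  have hG : ∀ n, HasSum (fun j => m j * profile N s j n) (∑' j, m j * profile N s j n) :=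
    fun n => (hsP n).hasSum
  have hnn : ∀ n j, 0 ≤ m j * profile N s j n := fun n j =>
    mul_nonneg (hm0 j) (profile_nonneg N s j n)
  refine ⟨fun n => ∑' j, m j * profile N s j n, fun n => tsum_nonneg (hnn n), ?_, fun n => ?_,
    fun n => ?_, fun n => ?_, fun n => ?_, fun K => ?_⟩
  · refine le_trans ?_ (le_hasSum (hG 0) 0 fun j _ => hnn 0 j)
    have h1 : ϱ ≤ m 0 := by simp [hm, hy.nonneg 0]
    exact h1.trans (le_mul_of_one_le_right (hm0 0) (one_le_profile hN le_rfl))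
  · have h1 := (hsP n).sum_add_tsum_nat_add n
    have h2 : 0 ≤ ∑ j ∈ Finset.range n, m j * profile N s j n :=
      Finset.sum_nonneg fun j _ => hnn n j
    have h3 : ∑' k, y (k + n) ≤ ∑' k, m (k + n) * profile N s (k + n) n := by
      refine Summable.tsum_le_tsum (fun k => ?_) ((summable_nat_add_iff n).2 hy.summable_coe)
        ((summable_nat_add_iff n).2 (hsP n))
      exact (hym _).trans (le_mul_of_one_le_right (hm0 _) (one_le_profile hN (by omega)))
    linarith
  · exact hasSum_le (fun j => mul_le_mul_of_nonneg_left (profile_succ_le hN j n) (hm0 j))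
      (hG (n + 1)) (hG n)
  · refine hasSum_le (fun j => ?_) (((hG n).sub (hG (n + 1))).mul_left w)
      (((hG (n + 1)).sub (hG (n + 2))).mul_left zs)
    have := mul_le_mul_of_nonneg_left (profile_convex (s := s) hN hwzs hNle j n) (hm0 j)
    linarith
  · refine hasSum_le (fun j => ?_) (((hG n).sub (hG (n + 1))).mul_left (C₂ * ((n : ℝ) + 1)))
      ((hG (n + 1)).mul_left (C₂ * s))
    have := mul_le_mul_of_nonneg_left (mul_profile_sub_le (s := s) hN j n)
      (mul_nonneg hC₂ (hm0 j))
    linarith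
  · have h1 : HasSum (fun j => ∑ n ∈ Finset.range K,
        ((n : ℝ) + 1) ^ (β - 1) * (m j * profile N s j n))
        (∑ n ∈ Finset.range K, ((n : ℝ) + 1) ^ (β - 1) * ∑' j, m j * profile N s j n) :=
      hasSum_sum fun n _ => (hG n).mul_left _
    refine (hasSum_le (fun j => ?_) h1 (hmM.mul_left c)).trans ?_
    · have := mul_le_mul_of_nonneg_left (sum_rpow_mul_profile_le hN hβ hs j K) (hm0 j)
      calc _ = m j * ∑ n ∈ Finset.range K, ((n : ℝ) + 1) ^ (β - 1) * profile N s j n := by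
            rw [Finset.mul_sum]; exact Finset.sum_congr rfl fun n _ => by ring
        _ ≤ m j * (c * ((j : ℝ) + 1) ^ β) := this
        _ = _ := by ring
    · exact mul_le_mul_of_nonneg_left (add_le_add (le_abs_self _) (le_abs_self _)) hc0

/-! ### Comparison principle and uniform moment bounds -/

theorem exists_first_nonneg {u : ℕ → ℝ → ℝ} {M : ℕ} (hu : ∀ n, ContinuousOn (u n) (Ici 0))
    (h0 : ∀ n < M, u n 0 < 0) {t : ℝ} (ht : 0 ≤ t) {n : ℕ} (hn : n < M) (hnt : 0 ≤ u n t) :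
    ∃ τ, 0 < τ ∧ (∃ n < M, 0 ≤ u n τ) ∧ ∀ m < M, ∀ σ, 0 ≤ σ → σ < τ → u m σ < 0 := by
  set S : Set ℝ := Icc 0 t ∩ ⋃ n ∈ Finset.range M, (Icc 0 t ∩ u n ⁻¹' Ici 0) with hS
  have hclosed : IsClosed S := by
    refine isClosed_Icc.inter (isClosed_biUnion_finset fun n _ => ?_)
    exact ((hu n).mono Icc_subset_Ici_self).preimage_isClosed_of_isClosed isClosed_Icc isClosed_Ici
  have hmem : ∀ σ, σ ∈ S ↔ σ ∈ Icc 0 t ∧ ∃ n < M, 0 ≤ u n σ := by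
    intro σ
    simp only [hS, mem_inter_iff, mem_iUnion, Finset.mem_range, mem_preimage, mem_Ici]
    constructor
    · rintro ⟨h1, n, h2, _, h3⟩; exact ⟨h1, n, h2, h3⟩
    · rintro ⟨h1, n, h2, h3⟩; exact ⟨h1, n, h2, h1, h3⟩
  have hne : S.Nonempty := ⟨t, (hmem t).2 ⟨⟨ht, le_rfl⟩, n, hn, hnt⟩⟩
  have hbdd : BddBelow S := ⟨0, fun σ hσ => ((hmem σ).1 hσ).1.1⟩
  have hτ := hclosed.csInf_mem hne hbdd
  obtain ⟨h1, k, hk, h2⟩ := (hmem _).1 hτ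
  refine ⟨sInf S, ?_, ⟨k, hk, h2⟩, fun m hm σ hσ0 hσ => ?_⟩
  · refine lt_of_le_of_ne h1.1 fun h => ?_
    rw [← h] at h2
    exact absurd h2 (not_le.2 (h0 k hk))
  · by_contra! hcon
    have := csInf_le hbdd ((hmem σ).2 ⟨⟨hσ0, hσ.le.trans h1.2⟩, m, hm, hcon⟩)
    linarith

theorem deriv_nonneg_of_left_neg {u : ℝ → ℝ} {d τ : ℝ} (hd : HasDerivAt u d τ) (hτ : 0 < τ)
    (h0 : 0 ≤ u τ) (hneg : ∀ σ, 0 ≤ σ → σ < τ → u σ < 0) : 0 ≤ d := by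
  have h1 : Tendsto (slope u τ) (𝓝[<] τ) (𝓝 d) :=
    (hasDerivAt_iff_tendsto_slope_left_right.1 hd).1
  refine ge_of_tendsto h1 ?_
  filter_upwards [self_mem_nhdsWithin, mem_nhdsWithin_of_mem_nhds (lt_mem_nhds hτ)] with σ h2 h3
  rw [slope_def_field]
  have := hneg σ (le_of_lt h3) h2
  exact div_nonneg_of_nonpos (by linarith) (by linarith [mem_Iio.1 h2])

namespace Trajectory

variable {Q A : ℕ → ℝ} {x : ℝ → ℕ → ℝ} {zs R ϱ z γ C₁ C₂ : ℝ}

theorem tsum_add_eq (hx : Trajectory Q A ϱ x) (t : ℝ) (n : ℕ) :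
    ∑' k, x t (k + n) = x t n + ∑' k, x t (k + (n + 1)) := by
  rw [((summable_nat_add_iff n).2 (hx.state t).summable_coe).tsum_eq_zero_add, zero_add]
  congr 2
  funext k
  congr 1; ring

theorem mul_tail_le (hx : Trajectory Q A ϱ x) (t : ℝ) (n : ℕ) :
    ((n : ℝ) + 1) * ∑' k, x t (k + n) ≤ ϱ := by
  have h1 := (hx.state t).summable.sum_add_tsum_nat_add n
  rw [(hx.state t).hasSum.tsum_eq] at h1
  have h2 : 0 ≤ ∑ k ∈ Finset.range n, ((k : ℝ) + 1) * x t k :=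
    Finset.sum_nonneg fun k _ => mul_nonneg (by positivity) ((hx.state t).nonneg k)
  rw [← tsum_mul_left]
  have h3 : ∑' k, ((n : ℝ) + 1) * x t (k + n) ≤ ∑' k, (((k + n : ℕ) : ℝ) + 1) * x t (k + n) := by
    refine Summable.tsum_le_tsum (fun k => ?_)
      (((summable_nat_add_iff n).2 (hx.state t).summable_coe).mul_left _)
      ((summable_nat_add_iff n).2 (hx.state t).summable)
    refine mul_le_mul_of_nonneg_right ?_ ((hx.state t).nonneg _)
    push_cast
    linarith [k.cast_nonneg (α := ℝ)]
  linarith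

theorem continuousOn_tail (hx : Trajectory Q A ϱ x) (n : ℕ) :
    ContinuousOn (fun t => ∑' k, x t (k + (n + 1))) (Ici 0) := by
  have h1 : Continuous fun t => ∑' k, x 0 (k + (n + 1)) + ∫ s in (0 : ℝ)..t, flux Q A (x s) n :=
    continuous_const.add (intervalIntegral.continuous_primitive
      (fun a b => (continuous_flux hx.continuous n).intervalIntegrable a b) 0)
  exact h1.continuousOn.congr fun t ht => hx.tail_eq t ht n

/-- Comparison principle for the tails of a solution. -/
theorem tail_le (hx : Trajectory Q A ϱ x) (h : EquilibriumData Q zs R ϱ z)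
    (hA : RateBounds A γ C₁ C₂) (hC₁ : 0 < C₁) (hγ : γ ≤ 1) {w κ : ℝ} {G : ℕ → ℝ}
    (hG : ∀ n, 0 ≤ G n) (hG0 : ϱ ≤ G 0) (hGx : ∀ n, ∑' k, x 0 (k + n) ≤ G n)
    (hanti : ∀ n, G (n + 1) ≤ G n)
    (hsuper : ∀ n, w * (G n - G (n + 1)) ≤ zs * (G (n + 1) - G (n + 2)))
    (hκ : 0 ≤ κ) (hGκ : ∀ n : ℕ, C₂ * ((n : ℝ) + 1) * (G n - G (n + 1)) ≤ κ * G (n + 1))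
    {t : ℝ} (ht : 0 ≤ t) (n : ℕ) :
    ∑' k, x t (k + n) ≤ Real.exp (κ * ∫ s in (0 : ℝ)..t, max (x s 0 - w) 0) * G n := by
  set P : ℝ → ℝ := fun s => max (x s 0 - w) 0 with hP
  have hPc : Continuous P := ((hx.continuous 0).sub continuous_const).max continuous_const
  have hP0 : ∀ s, 0 ≤ P s := fun s => le_max_right _ _
  set e : ℝ → ℝ := fun t => Real.exp (κ * ∫ s in (0 : ℝ)..t, P s) with he
  have hed : ∀ t, HasDerivAt e (e t * (κ * P t)) t := fun t =>
    ((hPc.integral_hasStrictDerivAt 0 t).hasDerivAt.const_mul κ).exp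
  have hec : Continuous e := continuous_iff_continuousAt.2 fun t => (hed t).continuousAt
  have he1 : ∀ t, 0 ≤ t → 1 ≤ e t := fun t ht => Real.one_le_exp
    (mul_nonneg hκ (intervalIntegral.integral_nonneg ht fun s _ => hP0 s))
  have he0 : e 0 = 1 := by simp [he]
  set F : ℕ → ℝ → ℝ := fun n t => ∑' k, x t (k + n) with hF
  have hF0 : ∀ t, 0 ≤ t → F 0 t ≤ e t * G 0 := by
    intro t ht
    have h1 := hx.mul_tail_le t 0
    simp only [Nat.cast_zero, zero_add, one_mul] at h1
    have h2 := mul_le_mul_of_nonneg_right (he1 t ht) (hG 0)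
    exact h1.trans (by linarith)
  cases n with
  | zero => exact hF0 t ht
  | succ n =>
  change F (n + 1) t ≤ e t * G (n + 1)
  have main : ∀ ε, 0 < ε → F (n + 1) t ≤ e t * G (n + 1) + ε * (1 + t) := by
    intro ε hε
    -- The term ε(1 + t) makes the comparison strict. As tails are at most ϱ/(n + 1), only finitely
    -- many sizes can violate it, so a first contact time exists.
    set v : ℕ → ℝ → ℝ := fun n t => F n t - e t * G n - ε * (1 + t) with hv
    obtain ⟨M₀, hM₀⟩ := exists_nat_gt (ϱ / ε)
    have hlarge : ∀ m, M₀ ≤ m → ∀ σ, 0 ≤ σ → v (m + 1) σ < 0 := by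
      intro m hm σ hσ
      have a1 := hx.mul_tail_le σ (m + 1)
      have a2 : (M₀ : ℝ) ≤ m := by exact_mod_cast hm
      have a3 : ϱ < ε * (((m + 1 : ℕ) : ℝ) + 1) := by
        rw [div_lt_iff₀ hε] at hM₀
        push_cast
        nlinarith
      have a4 : F (m + 1) σ < ε := by
        have : (0 : ℝ) < ((m + 1 : ℕ) : ℝ) + 1 := by positivity
        by_contra! hcon
        have := mul_le_mul_of_nonneg_left hcon this.le
        simp only [hF] at this
        linarith
      have a5 := mul_nonneg ((zero_le_one).trans (he1 σ hσ)) (hG (m + 1))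
      simp only [hv]
      nlinarith
    by_contra! hcon
    have hn : n < M₀ := by
      by_contra! hn
      have := hlarge n hn t ht
      simp only [hv] at this
      linarith
    obtain ⟨τ, hτ, ⟨k, hk, hk0⟩, hbefore⟩ := exists_first_nonneg (u := fun m => v (m + 1))
      (M := M₀) (fun m => ((hx.continuousOn_tail m).sub (hec.mul continuous_const).continuousOn).sub
        (by fun_prop)) (fun m _ => by
          have := hGx (m + 1)
          simp only [hv, he0, hF]
          linarith) ht hn (by simp only [hv]; linarith)
    have hvd : ∀ m, HasDerivAt (v (m + 1)) (flux Q A (x τ) m - e τ * (κ * P τ) * G (m + 1) - ε) τ := by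
      intro m
      have := ((hx.hasDerivAt_tail m hτ).sub ((hed τ).mul_const (G (m + 1)))).sub
        (((hasDerivAt_id τ).const_add 1).const_mul ε)
      exact this.congr_deriv (by simp)
    have hvle : ∀ m, v m τ ≤ 0 := by
      intro m
      cases m with
      | zero =>
        have := hF0 τ hτ.le
        simp only [hv]
        nlinarith
      | succ m =>
        rcases lt_or_ge m M₀ with hm | hm
        · have hc : Tendsto (v (m + 1)) (𝓝[<] τ) (𝓝 (v (m + 1) τ)) :=
            (hvd m).continuousAt.tendsto.mono_left nhdsWithin_le_nhds
          refine le_of_tendsto hc ?_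
          filter_upwards [self_mem_nhdsWithin,
            mem_nhdsWithin_of_mem_nhds (lt_mem_nhds hτ)] with σ h2 h3
          exact (hbefore m hm σ (le_of_lt h3) h2).le
        · exact (hlarge m hm τ hτ.le).le
    have hd := deriv_nonneg_of_left_neg (hvd k) hτ hk0 (hbefore k hk)
    have hvk : v (k + 1) τ = 0 := le_antisymm (hvle _) hk0
    -- At contact v vanishes at k + 1 and is nonpositive at both neighbours, so differences of tails
    -- are ordered with those of the majorant; the ε terms cancel. The flux is then at most e κ P G,
    -- and the time derivative of v would be at most -ε.
    have b1 : x τ k ≤ e τ * (G k - G (k + 1)) := by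
      have c1 := hvle k
      have c2 := hx.tsum_add_eq τ k
      simp only [hv, hF] at c1 hvk
      linarith
    have b2 : e τ * (G (k + 1) - G (k + 2)) ≤ x τ (k + 1) := by
      have c1 := hvle (k + 2)
      have c2 := hx.tsum_add_eq τ (k + 1)
      simp only [hv, hF] at c1 hvk
      linarith
    have heτ : 0 < e τ := Real.exp_pos _
    have g0 : 0 ≤ G k - G (k + 1) := by linarith [hanti k]
    have g1 : 0 ≤ G (k + 1) - G (k + 2) := by linarith [hanti (k + 1)]
    have hP1 : x τ 0 ≤ P τ + w := by
      have := le_max_left (x τ 0 - w) 0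
      simp only [hP]
      linarith
    have b3 : x τ 0 * x τ k - Q k / Q (k + 1) * x τ (k + 1) ≤
        e τ * (P τ * (G k - G (k + 1))) := by
      have c1 := mul_le_mul_of_nonneg_left b1 ((hx.state τ).nonneg 0)
      have c2 := mul_le_mul_of_nonneg_left b2 (h.ratio_pos k).le
      have c3 := mul_le_mul_of_nonneg_right (h.ratio_ge k) (mul_nonneg heτ.le g1)
      have c4 := mul_le_mul_of_nonneg_left (hsuper k) heτ.le
      have c5 := mul_le_mul_of_nonneg_right hP1 (mul_nonneg heτ.le g0)
      linarith
    have b4 : flux Q A (x τ) k ≤ e τ * (κ * P τ) * G (k + 1) := by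
      have c1 := mul_le_mul_of_nonneg_left b3 (hA.nonneg hC₁ k)
      have c2 := mul_le_mul_of_nonneg_right (hA.rate_le_linear hC₁ hγ k)
        (mul_nonneg heτ.le (mul_nonneg (hP0 τ) g0))
      have c3 := mul_le_mul_of_nonneg_left (hGκ k) (mul_nonneg heτ.le (hP0 τ))
      unfold flux
      linarith
    linarith
  refine le_of_forall_pos_le_add fun ε hε => ?_
  have := main (ε / (1 + t)) (by positivity)
  rwa [div_mul_cancel₀ _ (by positivity)] at this

/-- Summation by parts turns the moment into a sum over tails, with (K + 1)^β - K^β ≤ β (K +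
1)^{β-1} from Bernoulli's inequality. -/
theorem sum_rpow_mul_le (hx : Trajectory Q A ϱ x) {β : ℝ} (hβ : 1 ≤ β) (t : ℝ) (K : ℕ) :
    ∑ n ∈ Finset.range K, ((n : ℝ) + 1) ^ β * x t n ≤
      β * ∑ n ∈ Finset.range K, ((n : ℝ) + 1) ^ (β - 1) * ∑' k, x t (k + n) := by
  have key : ∀ K : ℕ, ∑ n ∈ Finset.range K, ((n : ℝ) + 1) ^ β * x t n +
      (K : ℝ) ^ β * ∑' k, x t (k + K) ≤
      β * ∑ n ∈ Finset.range K, ((n : ℝ) + 1) ^ (β - 1) * ∑' k, x t (k + n) := by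
    intro K
    induction K with
    | zero => simp [Real.zero_rpow (by linarith : β ≠ 0)]
    | succ K ih =>
      rw [Finset.sum_range_succ, Finset.sum_range_succ, mul_add]
      have h1 := hx.tsum_add_eq t K
      have h0 : 0 ≤ ∑' k, x t (k + K) := tsum_nonneg fun k => (hx.state t).nonneg _
      have h2 : ((K : ℝ) + 1) ^ β - (K : ℝ) ^ β ≤ β * ((K : ℝ) + 1) ^ (β - 1) := by
        have hy : (0 : ℝ) < (K : ℝ) + 1 := by positivity
        have hK : (0 : ℝ) ≤ K := K.cast_nonneg
        have a1 : 1 + β * (-(1 / ((K : ℝ) + 1))) ≤ (1 + -(1 / ((K : ℝ) + 1))) ^ β := by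
          refine one_add_mul_self_le_rpow_one_add ?_ hβ
          rw [neg_le_neg_iff, div_le_one hy]; linarith
        have a2 : 1 + -(1 / ((K : ℝ) + 1)) = K / ((K : ℝ) + 1) := by field_simp; ring
        rw [a2, Real.div_rpow hK hy.le, le_div_iff₀ (by positivity)] at a1
        have a3 : ((K : ℝ) + 1) ^ β = ((K : ℝ) + 1) ^ (β - 1) * ((K : ℝ) + 1) := by
          rw [← Real.rpow_add_one hy.ne']; congr 1; ring
        have a4 : (1 + β * (-(1 / ((K : ℝ) + 1)))) * ((K : ℝ) + 1) ^ β =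
            ((K : ℝ) + 1) ^ β - β * ((K : ℝ) + 1) ^ (β - 1) := by
          rw [a3]; field_simp; ring
        linarith
      have h3 := mul_le_mul_of_nonneg_right h2 h0
      push_cast
      have h4 : ((K : ℝ) + 1) ^ β * ∑' k, x t (k + K) =
          ((K : ℝ) + 1) ^ β * x t K + ((K : ℝ) + 1) ^ β * ∑' k, x t (k + (K + 1)) := by
        rw [h1]; ring
      linarith
  have h1 : 0 ≤ (K : ℝ) ^ β * ∑' k, x t (k + K) :=
    mul_nonneg (by positivity) (tsum_nonneg fun k => (hx.state t).nonneg _)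
  linarith [key K]

/-- While x_0 ≥ w the dissipation is at least ε, and x_0 - w ≤ ϱ. The total dissipation is limited
by the initial budget of free energy. -/
theorem integral_supercritical_le (hx : Trajectory Q A ϱ x) (h : EquilibriumData Q zs R ϱ z)
    (hA : RateBounds A γ C₁ C₂) (hC₁ : 0 < C₁) (hγ : γ ≤ 1) {w ε : ℝ} (hw : 0 ≤ w) (hε : 0 < ε)
    (hD : ∀ y : ℕ → ℝ, MassState ϱ y → w ≤ y 0 → ε ≤ ∑' n, dissipation Q A y n)
    {t : ℝ} (ht : 0 ≤ t) :
    ∫ s in (0 : ℝ)..t, max (x s 0 - w) 0 ≤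
      ϱ / ε * EquilibriumData.freeEnergyBound R ϱ z := by
  have hϱ := h.mass_pos
  have hF := h.freeEnergyBound_pos
  rcases ht.eq_or_lt with rfl | ht
  · simp; positivity
  have hPc : Continuous fun s => max (x s 0 - w) 0 :=
    ((hx.continuous 0).sub continuous_const).max continuous_const
  have hDc := hx.continuous_tsum_dissipation h hA hC₁ hγ
  have hD0 : ∀ s, 0 ≤ ∑' n, dissipation Q A (x s) n := fun s =>
    tsum_nonneg fun n => dissipation_nonneg (hA.nonneg hC₁) n
  refine le_of_forall_pos_le_add fun e he => ?_
  -- The energy inequality starts at positive times; the initial layer [0, s] contributes at most e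
  -- because the integrand is at most ϱ.
  set s := min t (e / ϱ) with hs
  have hs0 : 0 < s := lt_min ht (by positivity)
  have hst : s ≤ t := min_le_left _ _
  rw [← intervalIntegral.integral_add_adjacent_intervals (b := s) (hPc.intervalIntegrable _ _)
    (hPc.intervalIntegrable _ _)]
  have h1 : ∫ τ in (0 : ℝ)..s, max (x τ 0 - w) 0 ≤ e := by
    calc ∫ τ in (0 : ℝ)..s, max (x τ 0 - w) 0 ≤ ∫ _ in (0 : ℝ)..s, ϱ := by
          refine intervalIntegral.integral_mono_on hs0.le (hPc.intervalIntegrable _ _) (by simp)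
            fun τ _ => max_le ?_ hϱ.le
          linarith [(hx.state τ).le 0]
      _ = s * ϱ := by simp
      _ ≤ e := by
          have : s ≤ e / ϱ := min_le_right _ _
          rwa [le_div_iff₀ hϱ] at this
  have h2 : ∫ τ in s..t, max (x τ 0 - w) 0 ≤ ϱ / ε * EquilibriumData.freeEnergyBound R ϱ z := by
    calc ∫ τ in s..t, max (x τ 0 - w) 0
        ≤ ∫ τ in s..t, ϱ / ε * ∑' n, dissipation Q A (x τ) n := by
          refine intervalIntegral.integral_mono_on hst (hPc.intervalIntegrable _ _)
            ((continuous_const.mul hDc).intervalIntegrable _ _) fun τ _ => max_le ?_ ?_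
          · rcases le_total w (x τ 0) with hwx | hwx
            · have := mul_le_mul_of_nonneg_left (hD _ (hx.state τ) hwx)
                (by positivity : 0 ≤ ϱ / ε)
              rw [div_mul_cancel₀ _ hε.ne'] at this
              linarith [(hx.state τ).le 0]
            · have := mul_nonneg (by positivity : 0 ≤ ϱ / ε) (hD0 τ)
              linarith
          · exact mul_nonneg (by positivity) (hD0 τ)
      _ = ϱ / ε * ∫ τ in s..t, ∑' n, dissipation Q A (x τ) n :=
          intervalIntegral.integral_const_mul _ _
      _ ≤ _ := by
          have a1 := hx.freeEnergy_add_integral_le h hA hC₁ hγ hs0 hst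
          have a2 := h.freeEnergy_nonneg (hx.state t)
          have a3 := h.freeEnergy_le (hx.state s)
          gcongr
          linarith
  linarith

end Trajectory

/-- Moments of subcritical solutions are bounded uniformly in time. -/
theorem EquilibriumData.exists_moment_bound {Q : ℕ → ℝ} {zs R ϱ z γ C₁ C₂ β : ℝ}
    (h : EquilibriumData Q zs R ϱ z) (hC₁ : 0 < C₁) (hC₂ : 0 < C₂) (hγ₀ : 0 ≤ γ) (hγ : γ ≤ 1)
    (hβ : 1 ≤ β) (M : ℝ) :
    ∃ B, 0 ≤ B ∧ ∀ (A : ℕ → ℝ) (x : ℝ → ℕ → ℝ), RateBounds A γ C₁ C₂ → Trajectory Q A ϱ x →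
      HasSum (fun n : ℕ => ((n : ℝ) + 1) ^ β * x 0 n) M → ∀ t, 0 ≤ t →
        (Summable fun n : ℕ => ((n : ℝ) + 1) ^ β * x t n) ∧
          ∑' n : ℕ, ((n : ℝ) + 1) ^ β * x t n ≤ B := by
  obtain ⟨w, hzw, hw⟩ := exists_between h.z_lt
  have hw0 := h.z_pos.trans hzw
  obtain ⟨ε, hε, hD⟩ := h.exists_le_dissipation_of_le (C₂ := C₂) hC₁ hγ₀ hγ hzw hw
  obtain ⟨κ, B, hκ, hB, hmaj⟩ := exists_tail_majorant (ϱ := ϱ) (M := M) hw hβ hC₂.le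
  set E := Real.exp (κ * (ϱ / ε * freeEnergyBound R ϱ z)) with hE
  refine ⟨β * (E * B), by positivity, fun A x hA hx hM t ht => ?_⟩
  obtain ⟨G, hG, hG0, hGx, hanti, hsuper, hGκ, hGB⟩ := hmaj (x 0) (hx.state 0) hM
  have hI := hx.integral_supercritical_le h hA hC₁ hγ hw0.le hε (fun y hy hy' => hD A y hA hy hy') ht
  have hsum : ∀ K, ∑ n ∈ Finset.range K, ((n : ℝ) + 1) ^ β * x t n ≤ β * (E * B) := by
    intro K
    refine (hx.sum_rpow_mul_le hβ t K).trans ?_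
    refine mul_le_mul_of_nonneg_left ?_ (by linarith)
    calc ∑ n ∈ Finset.range K, ((n : ℝ) + 1) ^ (β - 1) * ∑' k, x t (k + n)
        ≤ ∑ n ∈ Finset.range K, E * (((n : ℝ) + 1) ^ (β - 1) * G n) := by
          refine Finset.sum_le_sum fun n _ => ?_
          have h1 := hx.tail_le h hA hC₁ hγ hG hG0 hGx hanti hsuper hκ hGκ ht n
          have h2 : Real.exp (κ * ∫ s in (0 : ℝ)..t, max (x s 0 - w) 0) * G n ≤ E * G n := by
            refine mul_le_mul_of_nonneg_right ?_ (hG n)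
            exact Real.exp_le_exp.2 (mul_le_mul_of_nonneg_left hI hκ)
          have h3 := mul_le_mul_of_nonneg_left (h1.trans h2)
            (by positivity : 0 ≤ ((n : ℝ) + 1) ^ (β - 1))
          linarith
      _ ≤ E * B := by
          rw [← Finset.mul_sum]
          exact mul_le_mul_of_nonneg_left (hGB K) (Real.exp_pos _).le
  have hnn : ∀ n : ℕ, 0 ≤ ((n : ℝ) + 1) ^ β * x t n := fun n =>
    mul_nonneg (by positivity) ((hx.state t).nonneg n)
  exact ⟨summable_of_sum_range_le hnn hsum, Real.tsum_le_of_sum_range_le hnn hsum⟩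

/-! ### Decay from integrated differential inequalities -/

/-- An implicit Euler step of unit length divides φ by at least 1 + K, which explains the rate log(1
+ K). No differentiability of φ is needed. -/
theorem exp_decay_of_step {φ : ℝ → ℝ} {F K : ℝ} (hK : 0 < K) (h0 : ∀ t, 0 ≤ φ t)
    (hF : ∀ t, φ t ≤ F) (hstep : ∀ s t, 0 < s → s ≤ t → φ t + (t - s) * (K * φ t) ≤ φ s)
    {t : ℝ} (ht : 0 ≤ t) : φ t ≤ F * (1 + K) * Real.exp (-Real.log (1 + K) * t) := by
  have hF0 : 0 ≤ F := (h0 0).trans (hF 0)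
  have hK1 : 0 < 1 + K := by linarith
  have hiter : ∀ n : ℕ, ∀ s, 0 < s → φ (s + n) * (1 + K) ^ n ≤ F := by
    intro n
    induction n with
    | zero => intro s _; simpa using hF s
    | succ n ih =>
      intro s hs
      have h1 := hstep (s + n) (s + (n + 1 : ℕ)) (by positivity) (by push_cast; linarith)
      have h2 := ih s hs
      push_cast at h1 ⊢
      calc φ (s + (n + 1)) * (1 + K) ^ (n + 1)
          = (φ (s + (n + 1)) + (s + (n + 1) - (s + n)) * (K * φ (s + (n + 1)))) * (1 + K) ^ n := by
            ring
        _ ≤ φ (s + n) * (1 + K) ^ n := by gcongr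
        _ ≤ F := h2
  have hexp : Real.exp (-Real.log (1 + K) * t) = ((1 + K) ^ t)⁻¹ := by
    rw [Real.rpow_def_of_pos hK1, ← Real.exp_neg, neg_mul]
  rw [hexp, ← div_eq_mul_inv, le_div_iff₀ (by positivity)]
  -- For t > 0, n unit steps lead to t from t - n in (0, 1], as steps must start at positive times.
  -- The incomplete step costs the factor 1 + K.
  obtain ⟨n, hn1, hn2⟩ : ∃ n : ℕ, t - 1 ≤ n ∧ (t = 0 ∨ (n : ℝ) < t) := by
    rcases ht.eq_or_lt with h | h
    · exact ⟨0, by simp [← h], Or.inl h.symm⟩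
    · refine ⟨⌈t⌉₊ - 1, ?_, Or.inr ?_⟩
      · have h1 := Nat.le_ceil t
        have h2 : 1 ≤ ⌈t⌉₊ := Nat.one_le_ceil_iff.2 h
        push_cast [Nat.cast_sub h2]
        linarith
      · have h1 := Nat.ceil_lt_add_one ht
        have h2 : 1 ≤ ⌈t⌉₊ := Nat.one_le_ceil_iff.2 h
        push_cast [Nat.cast_sub h2]
        linarith
  rcases hn2 with rfl | hn2
  · have := hF 0
    simp only [Real.rpow_zero, mul_one]
    nlinarith
  · have h1 := hiter n (t - n) (by linarith)
    rw [sub_add_cancel] at h1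
    have h2 : (1 + K) ^ t ≤ (1 + K) ^ n * (1 + K) := by
      rw [← pow_succ, ← Real.rpow_natCast]
      exact Real.rpow_le_rpow_of_exponent_le (by linarith) (by push_cast; linarith)
    calc φ t * (1 + K) ^ t ≤ φ t * ((1 + K) ^ n * (1 + K)) := by
          gcongr; exact h0 t
      _ = φ t * (1 + K) ^ n * (1 + K) := by ring
      _ ≤ F * (1 + K) := by gcongr

/-- From log(1 + u) ≥ u/2 the left side is at most 1/(1 + κu/2), a convex function of u whose chord
on [0, 1] is the right side. -/
theorem one_add_rpow_neg_le {u κ : ℝ} (hu₀ : 0 ≤ u) (hu₁ : u ≤ 1) (hκ : 0 < κ) :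
    (1 + u) ^ (-κ) ≤ 1 - κ / (2 + κ) * u := by
  have h1 : u / 2 ≤ Real.log (1 + u) := by
    have h := Real.one_sub_inv_le_log_of_pos (by linarith : 0 < 1 + u)
    refine le_trans ?_ h
    rw [← sub_nonneg]
    have : 1 - (1 + u)⁻¹ - u / 2 = u * (1 - u) / (2 * (1 + u)) := by field_simp; ring
    rw [this]
    exact div_nonneg (mul_nonneg hu₀ (by linarith)) (by linarith)
  rw [Real.rpow_def_of_pos (by linarith)]
  have h2 : Real.exp (Real.log (1 + u) * -κ) ≤ Real.exp (-(κ * u / 2)) :=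
    Real.exp_le_exp.2 (by nlinarith)
  refine h2.trans ?_
  have hy : 0 ≤ κ * u / 2 := by positivity
  have h3 := Real.add_one_le_exp (κ * u / 2)
  rw [Real.exp_neg]
  have h4 : (Real.exp (κ * u / 2))⁻¹ ≤ (κ * u / 2 + 1)⁻¹ := inv_anti₀ (by linarith) h3
  refine h4.trans ?_
  rw [← sub_nonneg]
  have : 1 - κ / (2 + κ) * u - (κ * u / 2 + 1)⁻¹ =
      κ ^ 2 * u * (1 - u) / ((2 + κ) * (κ * u + 2)) := by field_simp; ring
  rw [this]
  exact div_nonneg (mul_nonneg (by positivity) (by linarith)) (by positivity)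

/-- The power φ^{-κ} grows at least linearly: a step gives φ_r (1 + u) ≤ φ_s with u = K (r - s)
φ_r^κ. Steps of length at most 1/(K F^κ) keep u ≤ 1, where the chord bound applies. -/
theorem rpow_decay_of_step {φ : ℝ → ℝ} {F K κ : ℝ} (hK : 0 < K) (hκ : 0 < κ) (hF₀ : 0 < F)
    (h0 : ∀ t, 0 ≤ φ t) (hF : ∀ t, φ t ≤ F)
    (hstep : ∀ s t, 0 < s → s ≤ t → φ t + (t - s) * (K * φ t ^ (1 + κ)) ≤ φ s)
    {t : ℝ} (ht : 0 ≤ t) :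
    φ t ≤ 1 / (F ^ (-κ) + κ * (K / (2 + κ)) * t) ^ (1 / κ) := by
  rcases (h0 t).eq_or_lt with hφ | hφ
  · rw [← hφ]; positivity
  set c := κ / (2 + κ) * K with hc
  have hc0 : 0 < c := by positivity
  have hanti : ∀ s, 0 < s → s ≤ t → 0 < φ s := fun s hs hst => by
    have h1 := hstep s t hs hst
    have h2 : 0 ≤ (t - s) * (K * φ t ^ (1 + κ)) := mul_nonneg (by linarith) (by positivity)
    linarith
  have hsmall : ∀ s r, 0 < s → s ≤ r → r ≤ t → r - s ≤ 1 / (K * F ^ κ) →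
      φ s ^ (-κ) + c * (r - s) ≤ φ r ^ (-κ) := by
    intro s r hs hsr hrt hd
    have hr := hanti r (hs.trans_le hsr) hrt
    set u := K * (r - s) * φ r ^ κ with hu
    have hu0 : 0 ≤ u := mul_nonneg (mul_nonneg hK.le (by linarith)) (by positivity)
    have hu1 : u ≤ 1 := by
      have a1 : φ r ^ κ ≤ F ^ κ := Real.rpow_le_rpow hr.le (hF r) hκ.le
      rw [le_div_iff₀ (by positivity)] at hd
      have a2 := mul_le_mul_of_nonneg_left a1 (mul_nonneg hK.le (by linarith : 0 ≤ r - s))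
      linarith
    have h1 : φ r * (1 + u) ≤ φ s := by
      have := hstep s r hs hsr
      rw [Real.rpow_add hr, Real.rpow_one] at this
      rw [hu]
      linarith
    have h2 : φ s ^ (-κ) ≤ (φ r * (1 + u)) ^ (-κ) :=
      Real.rpow_le_rpow_of_nonpos (by positivity) h1 (by linarith)
    rw [Real.mul_rpow hr.le (by linarith)] at h2
    have h3 := mul_le_mul_of_nonneg_left (one_add_rpow_neg_le hu0 hu1 hκ)
      (by positivity : 0 ≤ φ r ^ (-κ))
    have h4 : φ r ^ (-κ) * u = K * (r - s) := by
      rw [hu, Real.rpow_neg hr.le]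
      have : φ r ^ κ ≠ 0 := by positivity
      field_simp
    have h5 : φ r ^ (-κ) * (1 - κ / (2 + κ) * u) = φ r ^ (-κ) - c * (r - s) := by
      rw [mul_sub, mul_one, mul_left_comm, h4, hc]; ring
    linarith
  have hall : ∀ n : ℕ, ∀ s r, 0 < s → s ≤ r → r ≤ t → r - s ≤ n * (1 / (K * F ^ κ)) →
      φ s ^ (-κ) + c * (r - s) ≤ φ r ^ (-κ) := by
    intro n
    induction n with
    | zero =>
      intro s r _ hsr _ hd
      have : s = r := le_antisymm hsr (by simp at hd; linarith)
      simp [this]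
    | succ n ih =>
      intro s r hs hsr hrt hd
      set δ := 1 / (K * F ^ κ) with hδ
      have hδ0 : 0 < δ := by positivity
      have m1 : s ≤ max s (r - δ) := le_max_left _ _
      have m2 : max s (r - δ) ≤ r := max_le hsr (by linarith)
      have a1 := hsmall (max s (r - δ)) r (hs.trans_le m1) m2 hrt
        (by linarith [le_max_right s (r - δ)])
      have a2 := ih s (max s (r - δ)) hs m1 (m2.trans hrt) (by
        rcases max_choice s (r - δ) with h | h <;> rw [h]
        · simp; positivity
        · push_cast at hd; linarith)
      linarith
  have hlow : F ^ (-κ) + c * t ≤ φ t ^ (-κ) := by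
    rcases ht.eq_or_lt with rfl | ht
    · simpa using Real.rpow_le_rpow_of_nonpos hφ (hF 0) (by linarith : -κ ≤ 0)
    refine le_of_forall_pos_le_add fun e he => ?_
    -- Starting at s > 0 instead of 0 loses c s ≤ e.
    set s := min t (e / c) with hs
    have hs0 : 0 < s := lt_min ht (by positivity)
    have hst : s ≤ t := min_le_left _ _
    obtain ⟨n, hn⟩ := exists_nat_ge ((t - s) / (1 / (K * F ^ κ)))
    rw [div_le_iff₀ (by positivity)] at hn
    have h1 := hall n s t hs0 hst le_rfl hn
    have h2 : F ^ (-κ) ≤ φ s ^ (-κ) :=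
      Real.rpow_le_rpow_of_nonpos (hanti s hs0 hst) (hF s) (by linarith)
    have h3 : s * c ≤ e := by
      have : s ≤ e / c := min_le_right _ _
      rwa [le_div_iff₀ hc0] at this
    linarith
  have hX : 0 < F ^ (-κ) + κ * (K / (2 + κ)) * t := by positivity
  have hXe : F ^ (-κ) + κ * (K / (2 + κ)) * t = F ^ (-κ) + c * t := by rw [hc]; ring
  rw [hXe] at hX ⊢
  rw [le_div_iff₀ (by positivity)]
  have h1 : (F ^ (-κ) + c * t) ^ (1 / κ) ≤ (φ t ^ (-κ)) ^ (1 / κ) :=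
    Real.rpow_le_rpow hX.le hlow (by positivity)
  have h2 : (φ t ^ (-κ)) ^ (1 / κ) = (φ t)⁻¹ := by
    rw [← Real.rpow_mul hφ.le, show -κ * (1 / κ) = -1 by field_simp, Real.rpow_neg_one]
  rw [h2] at h1
  calc φ t * (F ^ (-κ) + c * t) ^ (1 / κ) ≤ φ t * (φ t)⁻¹ := by gcongr
    _ = 1 := mul_inv_cancel₀ hφ.ne'

/-! ### Decay of the free energy along trajectories -/

/-- The free energy is nonincreasing, so on [s, t] the dissipation is at least the coercivity bound
at the final time. -/
theorem Trajectory.freeEnergy_step {Q A : ℕ → ℝ} {x : ℝ → ℕ → ℝ} {zs R ϱ z γ C₁ C₂ K p : ℝ}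
    (hx : Trajectory Q A ϱ x) (h : EquilibriumData Q zs R ϱ z) (hA : RateBounds A γ C₁ C₂)
    (hC₁ : 0 < C₁) (hγ : γ ≤ 1) (hK : 0 < K) (hp : 0 < p)
    (hD : ∀ t, 0 < t →
      K * EquilibriumData.freeEnergy Q z (x t) ^ p ≤ ∑' n, dissipation Q A (x t) n)
    {s t : ℝ} (hs : 0 < s) (hst : s ≤ t) :
    EquilibriumData.freeEnergy Q z (x t) +
      (t - s) * (K * EquilibriumData.freeEnergy Q z (x t) ^ p) ≤
        EquilibriumData.freeEnergy Q z (x s) := by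
  have h1 := hx.freeEnergy_add_integral_le h hA hC₁ hγ hs hst
  have h2 : ∫ _ in s..t, K * EquilibriumData.freeEnergy Q z (x t) ^ p ≤
      ∫ τ in s..t, ∑' n, dissipation Q A (x τ) n := by
    refine intervalIntegral.integral_mono_on hst (by simp)
      ((hx.continuous_tsum_dissipation h hA hC₁ hγ).intervalIntegrable _ _) fun τ hτ => ?_
    have hτ0 : 0 < τ := hs.trans_le hτ.1
    refine le_trans ?_ (hD τ hτ0)
    have h3 := hx.freeEnergy_antitoneOn h hA hC₁ hγ hτ0 (hs.trans_le hst) hτ.2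
    exact mul_le_mul_of_nonneg_left
      (Real.rpow_le_rpow (h.freeEnergy_nonneg (hx.state t)) h3 hp.le) hK.le
  rw [intervalIntegral.integral_const, smul_eq_mul] at h2
  linarith

namespace EquilibriumData

variable {Q : ℕ → ℝ} {zs R ϱ z γ C₁ C₂ : ℝ}

/-- Exponential convergence to equilibrium for `γ = 1`. -/
theorem exists_exp_decay (h : EquilibriumData Q zs R ϱ z) (hC₁ : 0 < C₁) (hC₂ : 0 < C₂) :
    ∃ K C, 0 < K ∧ 0 < C ∧ ∀ (A : ℕ → ℝ) (x : ℝ → ℕ → ℝ), RateBounds A 1 C₁ C₂ →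
      Trajectory Q A ϱ x → ∀ t, 0 ≤ t → freeEnergy Q z (x t) ≤ C * Real.exp (-K * t) := by
  obtain ⟨w, hzw, hw⟩ := exists_between h.z_lt
  obtain ⟨K, hK, hD⟩ := h.exists_coercivity (γ := 1) hC₁ hC₂ zero_le_one le_rfl one_pos one_pos
    hzw hw
  have hF := h.freeEnergyBound_pos
  refine ⟨Real.log (1 + K), freeEnergyBound R ϱ z * (1 + K), Real.log_pos (by linarith),
    by positivity, fun A x hA hx t ht => ?_⟩
  refine exp_decay_of_step (φ := fun t => freeEnergy Q z (x t)) hK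
    (fun t => h.freeEnergy_nonneg (hx.state t)) (fun t => h.freeEnergy_le (hx.state t))
    (fun s t hs hst => ?_) ht
  have := hx.freeEnergy_step h hA hC₁ le_rfl hK one_pos
    (fun t _ => hD A (x t) hA (hx.state t) (interpolates_one _)) hs hst
  simpa only [Real.rpow_one] using this

/-- Algebraic convergence to equilibrium for `γ < 1`. -/
theorem exists_rpow_decay (h : EquilibriumData Q zs R ϱ z) (hC₁ : 0 < C₁) (hC₂ : 0 < C₂)
    (hγ₀ : 0 ≤ γ) (hγ : γ < 1) {β : ℝ} (hβ : 1 < β) (M : ℝ) :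
    ∃ K C, 0 < K ∧ 0 < C ∧ ∀ (A : ℕ → ℝ) (x : ℝ → ℕ → ℝ), RateBounds A γ C₁ C₂ →
      Trajectory Q A ϱ x → HasSum (fun n : ℕ => ((n : ℝ) + 1) ^ β * x 0 n) M →
      ∀ t, 0 ≤ t → freeEnergy Q z (x t) ≤
        1 / (C + (1 - γ) / (β - 1) * K * t) ^ ((β - 1) / (1 - γ)) := by
  obtain ⟨w, hzw, hw⟩ := exists_between h.z_lt
  have hw0 := h.z_pos.trans hzw
  obtain ⟨B, hB, hmom⟩ := h.exists_moment_bound (C₂ := C₂) hC₁ hC₂ hγ₀ hγ.le hβ.le M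
  have hq := h.summable_rpow hw0.le hw β
  set S := ∑' n : ℕ, ((n : ℝ) + 1) ^ β * (w ^ (n + 1) * Q n) with hS
  have hS0 : 0 ≤ S := tsum_nonneg fun n =>
    mul_nonneg (by positivity) (mul_nonneg (by positivity) (h.Q_pos n).le)
  have hM' : 0 < B + S + 1 := by positivity
  set κ := (1 - γ) / (β - 1) with hκ
  have hκ0 : 0 < κ := div_pos (by linarith) (by linarith)
  -- The constant in the interpolation bounds the β-th moment of the majorant: B for the solution, S
  -- for the equilibrium at w, and 1 for strict positivity.
  obtain ⟨K, hK, hD⟩ := h.exists_coercivity (γ := γ) (p := 1 + κ)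
    (C := 2 * (2 * (B + S + 1)) ^ κ) hC₁ hC₂ hγ₀ hγ.le (by positivity) (by positivity) hzw hw
  have hF := h.freeEnergyBound_pos
  refine ⟨K / (2 + κ), freeEnergyBound R ϱ z ^ (-κ), by positivity, by positivity,
    fun A x hA hx hM t ht => ?_⟩
  rw [show (β - 1) / (1 - γ) = 1 / κ by rw [hκ, one_div_div]]
  refine rpow_decay_of_step (φ := fun t => freeEnergy Q z (x t)) hK hκ0 hF
    (fun t => h.freeEnergy_nonneg (hx.state t)) (fun t => h.freeEnergy_le (hx.state t))
    (fun s t hs hst => ?_) ht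
  refine hx.freeEnergy_step h hA hC₁ hγ.le hK (by positivity) (fun t ht => ?_) hs hst
  refine hD A (x t) hA (hx.state t) (interpolates_of_moment hγ hβ hM' ?_ ?_)
  · simp only [mul_add]
    exact (hmom A x hA hx hM t ht.le).1.add hq
  · simp only [mul_add]
    rw [(hmom A x hA hx hM t ht.le).1.tsum_add hq]
    linarith [(hmom A x hA hx hM t ht.le).2]

end EquilibriumData

/-! ### Translation from positive integers to indices starting at 0 -/

section Transfer

variable {a b α : ℕ+ → ℝ} {zs γ C₁ C₂ ϱ z : ℝ}

theorem hasSum_succPNat {f : ℕ+ → ℝ} {s : ℝ} :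
    HasSum (fun n : ℕ => f n.succPNat) s ↔ HasSum f s :=
  Equiv.pnatEquivNat.symm.hasSum_iff (f := f)

theorem summable_succPNat {f : ℕ+ → ℝ} : Summable (fun n : ℕ => f n.succPNat) ↔ Summable f :=
  Equiv.pnatEquivNat.symm.summable_iff (f := f)

theorem tsum_succPNat (f : ℕ+ → ℝ) : ∑' n : ℕ, f n.succPNat = ∑' i, f i :=
  Equiv.pnatEquivNat.symm.tsum_eq f

theorem succPNat_add_one (n : ℕ) : n.succPNat + 1 = (n + 1).succPNat := rfl

theorem Admissible.rateBounds (hadm : Admissible a b zs α γ C₁ C₂) :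
    RateBounds (fun n => a n.succPNat) γ C₁ C₂ :=
  ⟨fun n => by simpa using hadm.le_a n.succPNat, fun n => by simpa using hadm.a_le n.succPNat⟩

theorem Admissible.detailedBalance_eq (hadm : Admissible a b zs α γ C₁ C₂) (n : ℕ) :
    detailedBalance a b n.succPNat = α n.succPNat / zs ^ n := by
  rw [hadm.Q_eq, Nat.succPNat_coe, show (1 : ℤ) - ((n.succ : ℕ) : ℤ) = -(n : ℤ) by push_cast; ring,
    zpow_neg, zpow_natCast]
  ring

theorem Admissible.exists_le_mul_succ (hadm : Admissible a b zs α γ C₁ C₂) :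
    ∃ R : ℝ, 0 < R ∧ ∀ i, α i ≤ R * α (i + 1) := by
  have h1 : Tendsto (fun n : ℕ => (α (n.succPNat + 1) / α n.succPNat)⁻¹) atTop (𝓝 1) := by
    have h2 : Tendsto (fun n : ℕ => n.succPNat) atTop atTop :=
      tendsto_atTop_atTop.2 fun i => ⟨i, fun n hn => by
        rw [← PNat.coe_le_coe, Nat.succPNat_coe]; omega⟩
    simpa using (hadm.α_ratio.comp h2).inv₀ one_ne_zero
  obtain ⟨R, hR⟩ := h1.bddAbove_range
  refine ⟨max R 1, by positivity, fun i => ?_⟩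
  have h2 := hR ⟨i.natPred, rfl⟩
  simp only [PNat.succPNat_natPred, inv_div] at h2
  rw [← div_le_iff₀ (hadm.α_pos _)]
  exact h2.trans (le_max_left _ _)

theorem Admissible.equilibriumData (hadm : Admissible a b zs α γ C₁ C₂) (hϱ : 0 < ϱ)
    (hlt : ENNReal.ofReal ϱ < criticalMass (detailedBalance a b))
    (hz : IsEquilibriumMonomerDensity (detailedBalance a b) ϱ z) :
    ∃ R, EquilibriumData (fun n => detailedBalance a b n.succPNat) zs R ϱ z := by
  have hzs := hadm.zs_pos
  obtain ⟨R, hR, hαR⟩ := hadm.exists_le_mul_succ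
  have hQ : ∀ i, 0 < detailedBalance a b i := fun i => by
    rw [hadm.Q_eq]
    exact mul_pos (zpow_pos hzs _) (hadm.α_pos i)
  have hs : HasSum
      (fun n : ℕ => ((n : ℝ) + 1) * (z ^ (n + 1) * detailedBalance a b n.succPNat)) ϱ := by
    refine (hasSum_succPNat.2 hz.2).congr_fun fun n => ?_
    simp only [Nat.succPNat_coe, Nat.cast_succ, Nat.succ_eq_add_one]
    ring
  refine ⟨zs * R, ⟨?_, fun n => hQ _, hzs, fun n => ?_, fun n => ?_, ?_, ?_, hs⟩⟩
  · exact detailedBalance_one a b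
  · rw [hadm.detailedBalance_eq, hadm.detailedBalance_eq, pow_succ]
    have h1 : α (n + 1).succPNat ≤ α n.succPNat :=
      hadm.α_anti (Nat.succPNat_le_succPNat.2 n.le_succ)
    calc zs * (α (n + 1).succPNat / (zs ^ n * zs)) = α (n + 1).succPNat / zs ^ n := by field_simp
      _ ≤ _ := by gcongr
  · rw [hadm.detailedBalance_eq, hadm.detailedBalance_eq, pow_succ]
    have h1 := hαR n.succPNat
    rw [succPNat_add_one] at h1
    calc α n.succPNat / zs ^ n ≤ R * α (n + 1).succPNat / zs ^ n := by gcongr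
      _ = _ := by field_simp
  · refine lt_of_le_of_ne hz.1 fun h0 => ?_
    rw [← h0] at hs
    simp only [ne_eq, Nat.add_eq_zero_iff, one_ne_zero, and_false, not_false_eq_true, zero_pow,
      zero_mul, mul_zero] at hs
    exact hϱ.ne (hasSum_zero.unique hs)
  -- If z ≥ zs, termwise comparison would give a critical mass of at most ϱ.
  · by_contra! hle
    refine absurd hlt (not_lt.2 ?_)
    have h1 : ENNReal.ofReal ϱ = ∑' i : ℕ+, ENNReal.ofReal ((i : ℝ) * detailedBalance a b i *
        z ^ (i : ℕ)) := by
      rw [← hz.2.tsum_eq]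
      exact ENNReal.ofReal_tsum_of_nonneg (fun i => by
        have := (hQ i).le
        have := hz.1
        positivity) hz.2.summable
    rw [h1, criticalMass, hadm.zs_eq]
    refine ENNReal.tsum_le_tsum fun i => ?_
    rw [← ENNReal.ofReal_natCast, ← ENNReal.ofReal_pow hzs.le,
      ← ENNReal.ofReal_mul (by positivity), ← ENNReal.ofReal_mul (by
        have := (hQ i).le
        positivity)]
    refine ENNReal.ofReal_le_ofReal ?_
    have := (hQ i).le
    gcongr

/-- The recursion for Q expresses b_{i+1} as a_i Q_i / Q_{i+1}, which eliminates the fragmentation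
coefficients. -/
theorem Admissible.netRate_eq_flux (hadm : Admissible a b zs α γ C₁ C₂) (c : ℕ+ → ℝ) (n : ℕ) :
    netRate a b c n.succPNat = flux (fun n => detailedBalance a b n.succPNat)
      (fun n => a n.succPNat) (fun n => c n.succPNat) n := by
  have hQ : ∀ i, detailedBalance a b i ≠ 0 := fun i => by
    rw [hadm.Q_eq]
    exact (mul_pos (zpow_pos hadm.zs_pos _) (hadm.α_pos i)).ne'
  have h1 := detailedBalance_succ a b n.succPNat
  have h2 := (hadm.b_pos (n.succPNat + 1)).ne'
  have h3 := hQ n.succPNat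
  have h4 := (hadm.a_pos n.succPNat).ne'
  unfold netRate flux
  dsimp only
  rw [← succPNat_add_one, h1, show Nat.succPNat 0 = 1 from rfl]
  field_simp

theorem Admissible.trajectory (hadm : Admissible a b zs α γ C₁ C₂) (hγ : γ ≤ 1) {R : ℝ}
    {c : ℝ → ℕ+ → ℝ}
    (h : EquilibriumData (fun n => detailedBalance a b n.succPNat) zs R ϱ z)
    (hc : IsSolution a b c) (hm : HasMass (c 0) ϱ) :
    Trajectory (fun n => detailedBalance a b n.succPNat) (fun n => a n.succPNat) ϱ
      (fun t n => c (max t 0) n.succPNat) := by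
  have hmax : ∀ t : ℝ, 0 ≤ max t 0 := fun t => le_max_right _ _
  have hsum : ∀ t, ∑' k : ℕ, flux (fun n => detailedBalance a b n.succPNat)
      (fun n => a n.succPNat) (fun n => c t n.succPNat) k = ∑' k : ℕ+, netRate a b (c t) k := by
    intro t
    rw [← tsum_succPNat]
    exact tsum_congr fun n => (hadm.netRate_eq_flux (c t) n).symm
  refine trajectory_of_integral_eq h hadm.rateBounds hadm.C₁_pos hγ
    (fun t n => hc.nonneg _ (hmax t) _) (fun n => ?_) (fun T => ?_) (fun t ht => ?_) ?_
    (fun t ht n => ?_) (fun t ht => ?_)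
  · exact (hc.continuousOn n.succPNat).comp_continuous (by fun_prop) fun t => hmax t
  · obtain ⟨B, hB⟩ := hc.mass_bounded (max T 0)
    refine ⟨B, fun t ht => ?_⟩
    obtain ⟨h1, h2⟩ := hB (max t 0) ⟨hmax t, max_le_max ht le_rfl⟩
    rw [← tsum_succPNat] at h2
    rw [← summable_succPNat] at h1
    simp only [Nat.succPNat_coe, Nat.cast_succ, Nat.succ_eq_add_one] at h1 h2
    exact ⟨h1, h2⟩
  · simp [max_eq_right ht]
  · have := hasSum_succPNat.2 hm
    simpa using this
  · rw [max_eq_left ht, max_self, ← succPNat_add_one, hc.eq_succ t ht]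
    congr 1
    refine intervalIntegral.integral_congr fun s hs => ?_
    rw [uIcc_of_le ht] at hs
    rw [max_eq_left hs.1, succPNat_add_one, hadm.netRate_eq_flux, hadm.netRate_eq_flux]
  · rw [max_eq_left ht, max_self, show Nat.succPNat 0 = 1 from rfl, hc.eq_one t ht]
    congr 1
    refine intervalIntegral.integral_congr fun s hs => ?_
    rw [uIcc_of_le ht] at hs
    rw [max_eq_left hs.1, hsum, ← hadm.netRate_eq_flux]
    rfl

theorem relFreeEnergy_eq {Q : ℕ+ → ℝ} {c : ℕ+ → ℝ} {R : ℝ}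
    (h : EquilibriumData (fun n => Q n.succPNat) zs R ϱ z)
    (hc : MassState ϱ fun n => c n.succPNat) :
    Summable (freeEnergyTerm Q z c) ∧ relFreeEnergy Q z c =
      EquilibriumData.freeEnergy (fun n => Q n.succPNat) z fun n => c n.succPNat := by
  have hq : Summable fun n : ℕ => z ^ (n.succPNat : ℕ) * Q n.succPNat := by
    simpa using h.summable_rpow h.z_pos.le h.z_lt 0
  have hs : Summable fun n : ℕ => freeEnergyTerm Q z c n.succPNat := by
    refine ((h.summable_freeEnergyDensity hc h.z_pos h.z_lt).sub hq).congr fun n => ?_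
    simp [EquilibriumData.freeEnergyDensity, entropyDensity, freeEnergyTerm]
  refine ⟨summable_succPNat.1 hs, ?_⟩
  unfold relFreeEnergy EquilibriumData.freeEnergy
  rw [← tsum_succPNat, ← tsum_succPNat, ← hs.tsum_add hq]
  refine tsum_congr fun n => ?_
  simp [EquilibriumData.freeEnergyDensity, entropyDensity, freeEnergyTerm]

/-- Both sequences are determined by zs and α. This allows constants to be fixed before the
coefficients are chosen. -/
theorem Admissible.detailedBalance_unique {a' b' : ℕ+ → ℝ}
    (hadm : Admissible a b zs α γ C₁ C₂) (hadm' : Admissible a' b' zs α γ C₁ C₂) :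
    detailedBalance a b = detailedBalance a' b' :=
  funext fun i => by rw [hadm.Q_eq, hadm'.Q_eq]

theorem EquilibriumData.z_unique {Q : ℕ → ℝ} {R R' z' : ℝ} (h : EquilibriumData Q zs R ϱ z)
    (h' : EquilibriumData Q zs R' ϱ z') : z = z' := by
  have key : ∀ {y y' S S' : ℝ}, EquilibriumData Q zs S ϱ y → EquilibriumData Q zs S' ϱ y' →
      ¬ y < y' := by
    intro y y' S S' g g' hlt
    have := g.z_pos
    refine (Summable.tsum_lt_tsum (i := 0) (fun n => ?_) ?_ g.hasSum.summable
      g'.hasSum.summable).ne (g.hasSum.tsum_eq.trans g'.hasSum.tsum_eq.symm)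
    · have := (g.Q_pos n).le
      gcongr
    · simp [g.Q_zero, hlt]
  exact le_antisymm (not_lt.1 (key h' h)) (not_lt.1 (key h h'))

end Transfer

end BeckerDoring

/-! ### The theorem -/

open BeckerDoring in
theorem theorem1p3 (γ C₁ C₂ zs ϱ : ℝ) (α : ℕ+ → ℝ) (hγ₀ : 0 ≤ γ) (hγ₁ : γ ≤ 1) :
    (γ = 1 →
      ∃ K : ℝ, 0 < K ∧ ∀ H₀ : ℝ, ∃ C : ℝ, 0 < C ∧
        ∀ (a b : ℕ+ → ℝ) (z : ℝ) (c : ℝ → ℕ+ → ℝ),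
          BeckerDoring.Admissible a b zs α γ C₁ C₂ →
          BeckerDoring.IsSubcriticalSolution a b ϱ z c →
          BeckerDoring.relFreeEnergy (BeckerDoring.detailedBalance a b) z (c 0) = H₀ →
          ∀ t : ℝ, 0 ≤ t →
            Summable (BeckerDoring.freeEnergyTerm (BeckerDoring.detailedBalance a b) z (c t)) ∧
            BeckerDoring.relFreeEnergy (BeckerDoring.detailedBalance a b) z (c t) ≤
              C * Real.exp (-K * t)) ∧
    (γ < 1 → ∀ β : ℝ, 1 < β → ∀ M : ℝ,
      ∃ K : ℝ, 0 < K ∧ ∀ H₀ : ℝ, ∃ C : ℝ, 0 < C ∧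
        ∀ (a b : ℕ+ → ℝ) (z : ℝ) (c : ℝ → ℕ+ → ℝ),
          BeckerDoring.Admissible a b zs α γ C₁ C₂ →
          BeckerDoring.IsSubcriticalSolution a b ϱ z c →
          BeckerDoring.HasMoment β (c 0) M →
          BeckerDoring.relFreeEnergy (BeckerDoring.detailedBalance a b) z (c 0) = H₀ →
          ∀ t : ℝ, 0 ≤ t →
            Summable (BeckerDoring.freeEnergyTerm (BeckerDoring.detailedBalance a b) z (c t)) ∧
            BeckerDoring.relFreeEnergy (BeckerDoring.detailedBalance a b) z (c t) ≤
              1 / (C + (1 - γ) / (β - 1) * K * t) ^ ((β - 1) / (1 - γ))) := by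
  -- The constants are read off from one reference solution; without any solution the claim is
  -- vacuous. Since Q and z are the same for all solutions in question, these constants serve all of
  -- them.
  by_cases hex : ∃ (a b : ℕ+ → ℝ) (z : ℝ) (c : ℝ → ℕ+ → ℝ),
      Admissible a b zs α γ C₁ C₂ ∧ IsSubcriticalSolution a b ϱ z c
  swap
  · push Not at hex
    exact ⟨fun _ => ⟨1, one_pos, fun _ => ⟨1, one_pos, fun a b z c h1 h2 =>
        absurd h2 (hex a b z c h1)⟩⟩,
      fun _ _ _ _ => ⟨1, one_pos, fun _ => ⟨1, one_pos, fun a b z c h1 h2 =>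
        absurd h2 (hex a b z c h1)⟩⟩⟩
  obtain ⟨a₀, b₀, z₀, c₀, hadm₀, hsub₀⟩ := hex
  obtain ⟨R, h₀⟩ := hadm₀.equilibriumData hsub₀.mass_pos hsub₀.mass_lt hsub₀.equilibrium
  have hC₁ := hadm₀.C₁_pos
  have hC₂ := hadm₀.C₂_pos
  have transfer : ∀ (a b : ℕ+ → ℝ) (z : ℝ) (c : ℝ → ℕ+ → ℝ),
      Admissible a b zs α γ C₁ C₂ → IsSubcriticalSolution a b ϱ z c →
      Trajectory (fun n => detailedBalance a₀ b₀ n.succPNat) (fun n => a n.succPNat) ϱ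
        (fun t n => c (max t 0) n.succPNat) ∧
      ∀ t, 0 ≤ t → Summable (freeEnergyTerm (detailedBalance a b) z (c t)) ∧
        relFreeEnergy (detailedBalance a b) z (c t) =
          EquilibriumData.freeEnergy (fun n => detailedBalance a₀ b₀ n.succPNat) z₀
            (fun n => c (max t 0) n.succPNat) := by
    intro a b z c hadm hsub
    have hQ := hadm.detailedBalance_unique hadm₀
    obtain ⟨R', h'⟩ := hadm.equilibriumData hsub.mass_pos hsub.mass_lt hsub.equilibrium
    have htraj := hadm.trajectory hγ₁ h' hsub.solution hsub.mass
    rw [hQ] at h' htraj ⊢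
    obtain rfl := h'.z_unique h₀
    refine ⟨htraj, fun t ht => ?_⟩
    have hst := htraj.state t
    simp only [max_eq_left ht] at hst ⊢
    exact relFreeEnergy_eq h' hst
  refine ⟨fun hγ => ?_, fun hγ β hβ M => ?_⟩
  · subst hγ
    obtain ⟨K, C, hK, hC, hdecay⟩ := h₀.exists_exp_decay hC₁ hC₂
    refine ⟨K, hK, fun _ => ⟨C, hC, fun a b z c hadm hsub _ t ht => ?_⟩⟩
    obtain ⟨htraj, hE⟩ := transfer a b z c hadm hsub
    refine ⟨(hE t ht).1, ?_⟩
    rw [(hE t ht).2]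
    exact hdecay _ _ hadm.rateBounds htraj t ht
  · obtain ⟨K, C, hK, hC, hdecay⟩ := h₀.exists_rpow_decay hC₁ hC₂ hγ₀ hγ hβ M
    refine ⟨K, hK, fun _ => ⟨C, hC, fun a b z c hadm hsub hM _ t ht => ?_⟩⟩
    obtain ⟨htraj, hE⟩ := transfer a b z c hadm hsub
    refine ⟨(hE t ht).1, ?_⟩
    rw [(hE t ht).2]
    refine hdecay _ _ hadm.rateBounds htraj ?_ t ht
    have := hasSum_succPNat.2 hM
    simpa using this
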